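/- **Setting.** Fix function and predicate symbols with fixed arities, infinitely many variables, and a ground term $0$; $\mathit{true}$ abbreviates $0=0$. Formulas, taken up to renaming of bound variables, are $$G ::= t=t \mid p(t,\dots,t)\mid G\wedge G\mid G\vee G\mid \neg G\mid \exists x\,G\mid \mathit{if}[\vec x](G,G),$$ where $\mathit{if}[\vec x](B,C)$ binds the variables $\vec x$ in $B$ and $C$. A clause is $p(t_1,\dots,t_n)\leftarrow \eta$, where the body $\eta$ is a finite, possibly empty sequence of formulas and cuts $!$. A program is a finite sequence of clauses, and $\mathit{clauses}(p,P)$ is the subsequence of the clauses of $P$ with head predicate $p$. A goal stack is a finite sequence of elements, each a formula, or $p(\vec s)\,\mathit{using}(\gamma)$ with $\gamma$ a sequence of clauses, or $\mathit{body}(\eta)$ with $\eta$ a clause body. A result $\rho$ is a substitution or one of the symbols $\mathit{fail}$, $\mathit{flounder}$, $\mathit{diverge}$. Substitutions compose left to right; mgus are idempotent. **Liberal general semantics.** A computation with respect to $P$ is a finite tree of judgements $\theta:\alpha\Rightarrow\rho$ built by the following rules (conclusion $\Leftarrow$ premises; $\varepsilon$ is the empty sequence; $\eta_1$ and the $\eta$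 in the "nocut" rules contain no cut). * $\theta:(s=t),\alpha\Rightarrow\rho\ \Leftarrow\ \theta\sigma:\alpha\sigma\Rightarrow\rho$ if $\sigma$ is an mgu of $s,t$; and $\theta:(s=t),\alpha\Rightarrow\mathit{fail}$ if $s,t$ are not unifiable. Also $\theta:\varepsilon\Rightarrow\theta$. * $\theta: B\wedge C,\alpha\Rightarrow\rho\ \Leftarrow\ \theta:B,C,\alpha\Rightarrow\rho$. * $\theta: B\vee C,\alpha\Rightarrow\rho\ \Leftarrow\ \theta:B,\alpha\Rightarrow\rho$ if $\rho\ne\mathit{fail}$; and $\theta: B\vee C,\alpha\Rightarrow\rho\ \Leftarrow\ \theta:B,\alpha\Rightarrow\mathit{fail}$ and $\theta:C,\alpha\Rightarrow\rho$. * $\theta:\exists x\,B,\alpha\Rightarrow\rho\ \Leftarrow\ \theta:B[x:=x'],\alpha\Rightarrow\rho$, with $x'$ new. * $\theta:\neg B,\alpha\Rightarrow\mathit{fail}\ \Leftarrow\ \theta:B\Rightarrow\theta'$; and $\theta:\neg B,\alpha\Rightarrow\rho\ \Leftarrow\ \theta:B\Rightarrow\mathit{fail}$ and $\theta:\alpha\Rightarrow\rho$.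 * $\theta:\mathit{if}[\vec x](B,C),\alpha\Rightarrow\rho\ \Leftarrow\ \theta:B[\vec x:=\vec x']\Rightarrow\theta'$ and $\theta':C[\vec x:=\vec x']\theta',\alpha\theta'\Rightarrow\rho$; and $\theta:\mathit{if}[\vec x](B,C),\alpha\Rightarrow\mathit{fail}\ \Leftarrow\ \theta:B[\vec x:=\vec x']\Rightarrow\mathit{fail}$; with $\vec x'$ new and distinct. * $\theta:p(\vec s),\alpha\Rightarrow\rho\ \Leftarrow\ \theta:p(\vec s)\,\mathit{using}(\gamma),\alpha\Rightarrow\rho$, where $\gamma$ is $\mathit{clauses}(p,P)$ with its variables renamed to new ones. * (cut) If $C$ is $p(\vec t)\leftarrow\eta_1,!,\eta_2$: $\theta:p(\vec s)\,\mathit{using}(C;\gamma),\alpha\Rightarrow\rho\ \Leftarrow\ \theta:\vec s=\vec t,\eta_1\Rightarrow\theta'$ and $\theta':\mathit{body}(\eta_2)\theta',\alpha\theta'\Rightarrow\rho$; or $\Leftarrow\ \theta:\vec s=\vec t,\eta_1\Rightarrow\mathit{fail}$ and $\theta:p(\vec s)\,\mathit{using}(\gamma),\alpha\Rightarrow\rho$.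 * (nocut) If $C$ is $p(\vec t)\leftarrow\eta$: $\theta:p(\vec s)\,\mathit{using}(C;\gamma),\alpha\Rightarrow\theta'\ \Leftarrow\ \theta:\vec s=\vec t,\eta,\alpha\Rightarrow\theta'$; and $\theta:p(\vec s)\,\mathit{using}(C;\gamma),\alpha\Rightarrow\rho\ \Leftarrow\ \theta:\vec s=\vec t,\eta,\alpha\Rightarrow\mathit{fail}$ and $\theta:p(\vec s)\,\mathit{using}(\gamma),\alpha\Rightarrow\rho$. * $\theta:p(\vec s)\,\mathit{using}(\varepsilon),\alpha\Rightarrow\mathit{fail}$. * $\theta:\mathit{body}(\eta_1,!,\eta_2),\alpha\Rightarrow\rho\ \Leftarrow\ \theta:\eta_1\Rightarrow\theta'$ and $\theta':\mathit{body}(\eta_2)\theta',\alpha\theta'\Rightarrow\rho$; $\theta:\mathit{body}(\eta_1,!,\eta_2),\alpha\Rightarrow\mathit{fail}\ \Leftarrow\ \theta:\eta_1\Rightarrow\mathit{fail}$; and (nocut) $\theta:\mathit{body}(\eta),\alpha\Rightarrow\rho\ \Leftarrow\ \theta:\eta,\alpha\Rightarrow\rho$. "New" means: not occurring on the left-hand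 side $\theta:\alpha$ of the conclusion of the rule, nor on that of any judgement between it and the root of the tree, and not among the variables $\vec x'$ introduced by an $\mathit{if}$ rule on that path. Write $\theta:\alpha\Rightarrow_P\rho$ if some computation with respect to $P$ has root $\theta:\alpha\Rightarrow\rho'$, where $\rho'$ is the same result as $\rho$: either both are the same symbol, or both are substitutions and for some permutation $\pi$ of the variables $(x\rho')\pi=x\rho$ for every variable $x$ occurring in $\theta$ (in its domain or in a value on it) or free in $\alpha$. That is, bindings of auxiliary variables and the names chosen for them are ignored. **Augmented Clark completion.** A program $P'$ is an augmented Clark completion $acc(P)$ of $P$ if it is the outcome of a run of the following algorithm, with any choices. 1. Choose distinct variables $x_1,x_2,\dots$ not occurring in $P$. 2. While some clause has a head other than $p(x_1,\dots,x_n)$, choose such a clause $C$, with head $p(t_1,\dots,t_k,x_{k+1},\dots,x_n)$, $t_k\neq x_k$, and body $\eta$. If $t_k$ is a variable $y\notin\{x_1,\dots,x_n\}$, replace $C$ by $C[y:=x_k]$; otherwise replace $t_k$ in the head by $x_k$ and the body by $(x_k=t_k),\eta$. 3. While possible, replace consecutive formulas $F,G$ in a body by $F\wedge G$. Then, 4.,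 replace empty bodies by $\mathit{true}$; 5., while possible, replace $!,!$ by $!$; 6., insert $\mathit{true}$ before a cut that begins a body; 7., insert $\mathit{true}$ after a cut that ends a body. 8. While some clause body has the form $\eta,!,F,!,G$, choose such a clause and a predicate $q$ not occurring in the program, replace this body by $\eta,!,q(\vec y)$, and add the clause $q(\vec y)\leftarrow F,!,G$ at the end of the program, where $\vec y$ lists the free variables of $F,G$. 9. While the last clause of some predicate is not of the form $p(\vec z)\leftarrow G$ with all free variables of $G$ in the head, choose such a clause; replace its body $G$ by $\exists\vec y\,(G)$, or its body $F,!,G$ by $\mathit{if}[\vec y](F,G)$, where $\vec y$ lists the free variables of the body that are not in the head. 10. While some predicate has more than one clause, choose one, with last two clauses $p(\vec z)\leftarrow\eta$ and $p(\vec z)\leftarrow H$; replace these two by the single clause with head $p(\vec z)$ and body $\exists\vec y(G)\vee H$ if $\eta$ is a formula $G$, or $\mathit{if}[\vec y](F,G)\vee((\neg\exists\vec y(F))\wedge H)$ if $\eta$ is $F,!,G$, where $\vec y$ lists the free variables of $\eta$ that are not in the head. **Theorem (Result Preservation of Completion Algorithm).** Let $P$ be a program and $P'$ an augmented Clark completion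 of $P$. Let $\theta$ be a substitution with finite domain, and $\alpha$ a goal stack in which no variable of the domain of $\theta$ is free and no predicate newly introduced by the completion (occurring in $P'$ but not in $P$) occurs. Then for every result $\rho$, $$\theta:\alpha\Rightarrow_P\rho\quad\Longleftrightarrow\quad\theta:\alpha\Rightarrow_{P'}\rho .$$ -/

import Mathlib

namespace CutLP

universe u v w

/-! ### Terms, formulas, clauses, programs

The function and predicate symbols are those of a first-order language `L` (so every predicate
symbol has a fixed arity).  Formulas are taken up to renaming of bound variables: a formula of
type `Formula L Var k` has free variables named in `Var` and `k` dangling bound indices, exactly as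
in `FirstOrder.Language.BoundedFormula`. -/

/-- Terms with free variables in `Var` and `k` bound variables in scope. -/
abbrev Tm (L : FirstOrder.Language.{u, v}) (Var : Type w) (k : ℕ) := L.Term (Var ⊕ Fin k)

/-- Goal formulas.  `ex` binds one variable, `ifthen n B C` is `if[x₁,…,xₙ](B, C)`, in which the
`n` variables are bound both in `B` and in `C`. -/
inductive Formula (L : FirstOrder.Language.{u, v}) (Var : Type w) : ℕ → Type (max u v w)
  | eq {k : ℕ} (s t : Tm L Var k) : Formula L Var k
  | atom {k n : ℕ} (p : L.Relations n) (ts : Fin n → Tm L Var k) : Formula L Var k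
  | conj {k : ℕ} (B C : Formula L Var k) : Formula L Var k
  | disj {k : ℕ} (B C : Formula L Var k) : Formula L Var k
  | neg {k : ℕ} (B : Formula L Var k) : Formula L Var k
  | ex {k : ℕ} (B : Formula L Var (k + 1)) : Formula L Var k
  | ifthen {k : ℕ} (n : ℕ) (B C : Formula L Var (k + n)) : Formula L Var k

/-- An element of a clause body: a formula or the cut `!`. -/
inductive BodyElt (L : FirstOrder.Language.{u, v}) (Var : Type w) : Type (max u v w)
  | fml (F : Formula L Var 0) : BodyElt L Var
  | cut : BodyElt L Var

/-- A clause `p(t₁,…,tₙ) :- body`. -/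
structure Clause (L : FirstOrder.Language.{u, v}) (Var : Type w) : Type (max u v w) where
  {arity : ℕ}
  pred : L.Relations arity
  args : Fin arity → Tm L Var 0
  body : List (BodyElt L Var)

/-- A program is a sequence of clauses. -/
abbrev Program (L : FirstOrder.Language.{u, v}) (Var : Type w) := List (Clause L Var)

/-- Goal stack elements: a formula, `p(s₁,…,sₙ) using (γ)`, or `body(η)`. -/
inductive StackElt (L : FirstOrder.Language.{u, v}) (Var : Type w) : Type (max u v w)
  | fml (F : Formula L Var 0) : StackElt L Var
  | using {n : ℕ} (p : L.Relations n) (s : Fin n → Tm L Var 0) (γ : List (Clause L Var)) :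
      StackElt L Var
  | body (η : List (BodyElt L Var)) : StackElt L Var

/-- Goal stacks. -/
abbrev Stack (L : FirstOrder.Language.{u, v}) (Var : Type w) := List (StackElt L Var)

/-- Substitutions, as maps on all variables; `x` is outside the domain of `θ` when `θ x = x`. -/
abbrev Subst (L : FirstOrder.Language.{u, v}) (Var : Type w) := Var → Tm L Var 0

/-- Results of computations. -/
inductive Result (L : FirstOrder.Language.{u, v}) (Var : Type w) : Type (max u w)
  | subst (θ : Subst L Var) : Result L Var
  | fail : Result L Var
  | flounder : Result L Var
  | diverge : Result L Var

variable {L : FirstOrder.Language.{u, v}} {Var : Type w}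

/-- The free variable `x`, as a term. -/
def fvar {k : ℕ} (x : Var) : Tm L Var k := FirstOrder.Language.Term.var (Sum.inl x)

/-- The bound variable with index `i`, as a term. -/
def bvar {k : ℕ} (i : Fin k) : Tm L Var k := FirstOrder.Language.Term.var (Sum.inr i)

/-! ### Simultaneous substitution -/

/-- Extend a simultaneous substitution under `n` further binders. -/
def underBinders (n : ℕ) {k m : ℕ} (f : Var ⊕ Fin k → Tm L Var m) :
    Var ⊕ Fin (k + n) → Tm L Var (m + n) :=
  Sum.elim (fun x => (f (Sum.inl x)).relabel (Sum.map id (Fin.castAdd n)))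
    (Fin.addCases (fun j => (f (Sum.inr j)).relabel (Sum.map id (Fin.castAdd n)))
      (fun j => bvar (Fin.natAdd m j)))

/-- Capture-avoiding replacement of all (free and dangling bound) variables by terms. -/
def Formula.bind {k : ℕ} : Formula L Var k → {m : ℕ} → (Var ⊕ Fin k → Tm L Var m) → Formula L Var m
  | .eq s t, _, f => .eq (s.subst f) (t.subst f)
  | .atom p ts, _, f => .atom p (fun i => (ts i).subst f)
  | .conj B C, _, f => .conj (B.bind f) (C.bind f)
  | .disj B C, _, f => .disj (B.bind f) (C.bind f)
  | .neg B, _, f => .neg (B.bind f)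
  | .ex B, _, f => .ex (B.bind (underBinders 1 f))
  | .ifthen n B C, _, f => .ifthen n (B.bind (underBinders n f)) (C.bind (underBinders n f))

/-- `tσ`. -/
def substTm (σ : Subst L Var) (t : Tm L Var 0) : Tm L Var 0 :=
  t.subst (Sum.elim σ (fun i => i.elim0))

/-- `Fσ`. -/
def Formula.subst (σ : Subst L Var) (F : Formula L Var 0) : Formula L Var 0 :=
  F.bind (Sum.elim σ (fun i => i.elim0))

/-- Substitution in a body element. -/
def BodyElt.subst (σ : Subst L Var) : BodyElt L Var → BodyElt L Var
  | .fml F => .fml (F.subst σ)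
  | .cut => .cut

/-- `Cσ`. -/
def Clause.subst (σ : Subst L Var) (c : Clause L Var) : Clause L Var where
  pred := c.pred
  args := fun i => substTm σ (c.args i)
  body := c.body.map (BodyElt.subst σ)

/-- Substitution in a goal stack element. -/
def StackElt.subst (σ : Subst L Var) : StackElt L Var → StackElt L Var
  | .fml F => .fml (F.subst σ)
  | .using p s γ => .using p (fun i => substTm σ (s i)) (γ.map (Clause.subst σ))
  | .body η => .body (η.map (BodyElt.subst σ))

/-- `ασ`. -/
def Stack.subst (σ : Subst L Var) (α : Stack L Var) : Stack L Var := α.map (StackElt.subst σ)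

/-- The composition `θσ`: first `θ`, then `σ`. -/
def Subst.comp (θ σ : Subst L Var) : Subst L Var := fun x => substTm σ (θ x)

/-- The substitution that renames every variable `x` to `π x`. -/
def renameBy (π : Equiv.Perm Var) : Subst L Var := fun x => fvar (π x)

/-- `[y := t]`. -/
def single [DecidableEq Var] (y : Var) (t : Tm L Var 0) : Subst L Var :=
  Function.update fvar y t

/-- `B[x⃗ := x⃗']` for a formula `B` standing in the scope of a binder of the variables `x⃗`. -/
def Formula.inst {n : ℕ} (xs : Fin n → Var) (B : Formula L Var (0 + n)) : Formula L Var 0 :=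
  B.bind (Sum.elim fvar (Fin.addCases (fun i => i.elim0) (fun i => fvar (xs i))))

/-- Put a formula in the scope of a binder of the listed variables. -/
def Formula.close [DecidableEq Var] (ys : List Var) (B : Formula L Var 0) :
    Formula L Var (0 + ys.length) :=
  B.bind (Sum.elim
    (fun x => if h : x ∈ ys then bvar (Fin.natAdd 0 ⟨ys.idxOf x, List.idxOf_lt_length_of_mem h⟩)
      else fvar x)
    (fun i => i.elim0))

/-- `∃ y₁ … ∃ yₙ G`. -/
def exs [DecidableEq Var] : List Var → Formula L Var 0 → Formula L Var 0
  | [], G => G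
  | y :: ys, G => .ex ((exs ys G).close [y])

/-- `if[y₁,…,yₙ](F, G)`. -/
def ifs [DecidableEq Var] (ys : List Var) (F G : Formula L Var 0) : Formula L Var 0 :=
  .ifthen ys.length (F.close ys) (G.close ys)

/-! ### Free variables and predicate symbols -/

section Occurrences

variable [DecidableEq Var]

/-- The free variables of a term. -/
def fvTm {k : ℕ} (t : Tm L Var k) : Set Var := t.varFinsetLeft

/-- The free variables of a formula. -/
def Formula.fv {k : ℕ} : Formula L Var k → Set Var
  | .eq s t => fvTm s ∪ fvTm t
  | .atom _ ts => ⋃ i, fvTm (ts i)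
  | .conj B C => B.fv ∪ C.fv
  | .disj B C => B.fv ∪ C.fv
  | .neg B => B.fv
  | .ex B => B.fv
  | .ifthen _ B C => B.fv ∪ C.fv

/-- The variables of a body element. -/
def BodyElt.fv : BodyElt L Var → Set Var
  | .fml F => F.fv
  | .cut => ∅

/-- The variables of a clause body. -/
def bodyFv (η : List (BodyElt L Var)) : Set Var := {x | ∃ e ∈ η, x ∈ e.fv}

/-- The variables of the head of a clause. -/
def Clause.headFv (c : Clause L Var) : Set Var := ⋃ i, fvTm (c.args i)

/-- The variables of a clause. -/
def Clause.fv (c : Clause L Var) : Set Var := c.headFv ∪ bodyFv c.body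

/-- The variables of a sequence of clauses. -/
def Program.fv (P : Program L Var) : Set Var := {x | ∃ c ∈ P, x ∈ c.fv}

/-- The free variables of a goal stack element. -/
def StackElt.fv : StackElt L Var → Set Var
  | .fml F => F.fv
  | .using _ s γ => (⋃ i, fvTm (s i)) ∪ Program.fv γ
  | .body η => bodyFv η

/-- The free variables of a goal stack. -/
def Stack.fv (α : Stack L Var) : Set Var := {x | ∃ e ∈ α, x ∈ e.fv}

end Occurrences

/-- The domain of a substitution. -/
def Subst.dom (θ : Subst L Var) : Set Var := {x | θ x ≠ (fvar x : Tm L Var 0)}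

/-- The variables that occur in a substitution, in its domain or in one of its values there. -/
def Subst.vars [DecidableEq Var] (θ : Subst L Var) : Set Var :=
  θ.dom ∪ {x | ∃ y ∈ θ.dom, x ∈ fvTm (θ y)}

/-- The predicate symbols of a formula. -/
def Formula.preds {k : ℕ} : Formula L Var k → Set (Σ n, L.Relations n)
  | .eq _ _ => ∅
  | .atom p _ => {⟨_, p⟩}
  | .conj B C => B.preds ∪ C.preds
  | .disj B C => B.preds ∪ C.preds
  | .neg B => B.preds
  | .ex B => B.preds
  | .ifthen _ B C => B.preds ∪ C.preds

/-- The predicate symbols of a body element. -/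
def BodyElt.preds : BodyElt L Var → Set (Σ n, L.Relations n)
  | .fml F => F.preds
  | .cut => ∅

/-- The predicate that a clause defines. -/
def Clause.symb (c : Clause L Var) : Σ n, L.Relations n := ⟨c.arity, c.pred⟩

/-- The predicate symbols of a clause. -/
def Clause.preds (c : Clause L Var) : Set (Σ n, L.Relations n) :=
  {c.symb} ∪ {p | ∃ e ∈ c.body, p ∈ e.preds}

/-- The predicate symbols of a program. -/
def Program.preds (P : Program L Var) : Set (Σ n, L.Relations n) := {p | ∃ c ∈ P, p ∈ c.preds}

/-- The predicate symbols of a goal stack element. -/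
def StackElt.preds : StackElt L Var → Set (Σ n, L.Relations n)
  | .fml F => F.preds
  | .using p _ γ => {⟨_, p⟩} ∪ Program.preds γ
  | .body η => {p | ∃ e ∈ η, p ∈ e.preds}

/-- The predicate symbols of a goal stack. -/
def Stack.preds (α : Stack L Var) : Set (Σ n, L.Relations n) := {p | ∃ e ∈ α, p ∈ e.preds}

open Classical in
/-- `clauses(p, P)`, the sequence of the clauses of `P` that define `p`. -/
noncomputable def clausesOf {n : ℕ} (p : L.Relations n) (P : Program L Var) :
    List (Clause L Var) :=
  P.filter (fun c => decide (c.symb = ⟨n, p⟩))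

/-! ### Unification -/

/-- `σ` unifies `s` and `t`. -/
def IsUnifier (σ : Subst L Var) (s t : Tm L Var 0) : Prop := substTm σ s = substTm σ t

/-- `σ` is an (idempotent) most general unifier of `s` and `t`. -/
def IsMGU (σ : Subst L Var) (s t : Tm L Var 0) : Prop :=
  IsUnifier σ s t ∧ (∀ τ : Subst L Var, IsUnifier τ s t → ∃ δ : Subst L Var, τ = σ.comp δ) ∧
    σ.comp σ = σ

/-! ### The liberal general operational semantics -/

section Semantics

variable [DecidableEq Var]

/-- A sequence of body elements without cuts, as a sequence of goal stack elements. -/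
def goals (η : List (Formula L Var 0)) : Stack L Var := η.map StackElt.fml

/-- A sequence of formulas, as a clause body without cuts. -/
def noCuts (η : List (Formula L Var 0)) : List (BodyElt L Var) := η.map BodyElt.fml

/-- The goals `s₁ = t₁, …, sₙ = tₙ`. -/
def eqGoals {n : ℕ} (s t : Fin n → Tm L Var 0) : Stack L Var :=
  List.ofFn (fun i => StackElt.fml (Formula.eq (s i) (t i)))

/-- The variables in use at a judgement `θ : α ⇒ ρ`, when `V` are those of the judgements below
it. -/
def inUse (V : Set Var) (θ : Subst L Var) (α : Stack L Var) : Set Var := V ∪ θ.vars ∪ α.fv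

/-- `Comp P V θ α ρ`: there is a computation of `θ : α ⇒ ρ` with respect to `P`, in which the
variables introduced by renaming apart are new: they do not occur on the left-hand side of the
judgement at which they are introduced, nor on that of a judgement below it in the computation
tree, nor in `V`.  (Computation trees are written root-down; `V` collects the variables of the
judgements that have been passed on the way up.) -/
inductive Comp (P : Program L Var) : Set Var → Subst L Var → Stack L Var → Result L Var → Prop
  -- the basic connectives
  | unif_succ {V θ α ρ} {s t : Tm L Var 0} {σ : Subst L Var} :
      IsMGU σ s t →
      Comp P (inUse V θ (.fml (.eq s t) :: α)) (θ.comp σ) (Stack.subst σ α) ρ →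
      Comp P V θ (.fml (.eq s t) :: α) ρ
  | unif_fail {V θ α} {s t : Tm L Var 0} :
      (¬ ∃ σ : Subst L Var, IsUnifier σ s t) →
      Comp P V θ (.fml (.eq s t) :: α) .fail
  | success {V θ} : Comp P V θ [] (.subst θ)
  | conj {V θ α ρ} {B C : Formula L Var 0} :
      Comp P (inUse V θ (.fml (.conj B C) :: α)) θ (.fml B :: .fml C :: α) ρ →
      Comp P V θ (.fml (.conj B C) :: α) ρ
  | disj_nofail {V θ α ρ} {B C : Formula L Var 0} :
      ρ ≠ .fail →
      Comp P (inUse V θ (.fml (.disj B C) :: α)) θ (.fml B :: α) ρ →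
      Comp P V θ (.fml (.disj B C) :: α) ρ
  | disj_fail {V θ α ρ} {B C : Formula L Var 0} :
      Comp P (inUse V θ (.fml (.disj B C) :: α)) θ (.fml B :: α) .fail →
      Comp P (inUse V θ (.fml (.disj B C) :: α)) θ (.fml C :: α) ρ →
      Comp P V θ (.fml (.disj B C) :: α) ρ
  | exists_ {V θ α ρ} {B : Formula L Var (0 + 1)} {x' : Var} :
      x' ∉ inUse V θ (.fml (.ex B) :: α) →
      Comp P (inUse V θ (.fml (.ex B) :: α)) θ (.fml (B.inst (fun _ => x')) :: α) ρ →
      Comp P V θ (.fml (.ex B) :: α) ρ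
  -- negation and if
  | not_succ {V θ α} {B : Formula L Var 0} {θ' : Subst L Var} :
      Comp P (inUse V θ (.fml (.neg B) :: α)) θ [.fml B] (.subst θ') →
      Comp P V θ (.fml (.neg B) :: α) .fail
  | not_fail {V θ α ρ} {B : Formula L Var 0} :
      Comp P (inUse V θ (.fml (.neg B) :: α)) θ [.fml B] .fail →
      Comp P (inUse V θ (.fml (.neg B) :: α)) θ α ρ →
      Comp P V θ (.fml (.neg B) :: α) ρ
  | if_succ {V θ α ρ} {n : ℕ} {B C : Formula L Var (0 + n)} {xs : Fin n → Var}
      {θ' : Subst L Var} :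
      Function.Injective xs →
      (∀ i, xs i ∉ inUse V θ (.fml (.ifthen n B C) :: α)) →
      Comp P (inUse V θ (.fml (.ifthen n B C) :: α) ∪ Set.range xs) θ [.fml (B.inst xs)]
        (.subst θ') →
      Comp P (inUse V θ (.fml (.ifthen n B C) :: α) ∪ Set.range xs) θ'
        (.fml ((C.inst xs).subst θ') :: Stack.subst θ' α) ρ →
      Comp P V θ (.fml (.ifthen n B C) :: α) ρ
  | if_fail {V θ α} {n : ℕ} {B C : Formula L Var (0 + n)} {xs : Fin n → Var} :
      Function.Injective xs →
      (∀ i, xs i ∉ inUse V θ (.fml (.ifthen n B C) :: α)) →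
      Comp P (inUse V θ (.fml (.ifthen n B C) :: α) ∪ Set.range xs) θ [.fml (B.inst xs)] .fail →
      Comp P V θ (.fml (.ifthen n B C) :: α) .fail
  -- predicate calls: the clauses are renamed apart by a permutation `π` of the variables
  | pred {V θ α ρ} {n : ℕ} {p : L.Relations n} {s : Fin n → Tm L Var 0} {π : Equiv.Perm Var} :
      Disjoint (Program.fv ((clausesOf p P).map (Clause.subst (renameBy π))))
        (inUse V θ (.fml (.atom p s) :: α)) →
      Comp P (inUse V θ (.fml (.atom p s) :: α)) θ
        (.using p s ((clausesOf p P).map (Clause.subst (renameBy π))) :: α) ρ →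
      Comp P V θ (.fml (.atom p s) :: α) ρ
  | using_cut_succ {V θ α ρ} {n : ℕ} {p : L.Relations n} {s t : Fin n → Tm L Var 0}
      {η₁ : List (Formula L Var 0)} {η₂ : List (BodyElt L Var)} {γ : List (Clause L Var)}
      {θ' : Subst L Var} :
      Comp P (inUse V θ (.using p s (⟨p, t, noCuts η₁ ++ .cut :: η₂⟩ :: γ) :: α)) θ
        (eqGoals s t ++ goals η₁) (.subst θ') →
      Comp P (inUse V θ (.using p s (⟨p, t, noCuts η₁ ++ .cut :: η₂⟩ :: γ) :: α)) θ'
        (.body (η₂.map (BodyElt.subst θ')) :: Stack.subst θ' α) ρ →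
      Comp P V θ (.using p s (⟨p, t, noCuts η₁ ++ .cut :: η₂⟩ :: γ) :: α) ρ
  | using_cut_fail {V θ α ρ} {n : ℕ} {p : L.Relations n} {s t : Fin n → Tm L Var 0}
      {η₁ : List (Formula L Var 0)} {η₂ : List (BodyElt L Var)} {γ : List (Clause L Var)} :
      Comp P (inUse V θ (.using p s (⟨p, t, noCuts η₁ ++ .cut :: η₂⟩ :: γ) :: α)) θ
        (eqGoals s t ++ goals η₁) .fail →
      Comp P (inUse V θ (.using p s (⟨p, t, noCuts η₁ ++ .cut :: η₂⟩ :: γ) :: α)) θ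
        (.using p s γ :: α) ρ →
      Comp P V θ (.using p s (⟨p, t, noCuts η₁ ++ .cut :: η₂⟩ :: γ) :: α) ρ
  | using_nocut_succ {V θ α} {n : ℕ} {p : L.Relations n} {s t : Fin n → Tm L Var 0}
      {η : List (Formula L Var 0)} {γ : List (Clause L Var)} {θ' : Subst L Var} :
      Comp P (inUse V θ (.using p s (⟨p, t, noCuts η⟩ :: γ) :: α)) θ
        (eqGoals s t ++ goals η ++ α) (.subst θ') →
      Comp P V θ (.using p s (⟨p, t, noCuts η⟩ :: γ) :: α) (.subst θ')
  | using_nocut_fail {V θ α ρ} {n : ℕ} {p : L.Relations n} {s t : Fin n → Tm L Var 0}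
      {η : List (Formula L Var 0)} {γ : List (Clause L Var)} :
      Comp P (inUse V θ (.using p s (⟨p, t, noCuts η⟩ :: γ) :: α)) θ
        (eqGoals s t ++ goals η ++ α) .fail →
      Comp P (inUse V θ (.using p s (⟨p, t, noCuts η⟩ :: γ) :: α)) θ (.using p s γ :: α) ρ →
      Comp P V θ (.using p s (⟨p, t, noCuts η⟩ :: γ) :: α) ρ
  | using_empty {V θ α} {n : ℕ} {p : L.Relations n} {s : Fin n → Tm L Var 0} :
      Comp P V θ (.using p s [] :: α) .fail
  | body_cut_succ {V θ α ρ} {η₁ : List (Formula L Var 0)} {η₂ : List (BodyElt L Var)}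
      {θ' : Subst L Var} :
      Comp P (inUse V θ (.body (noCuts η₁ ++ .cut :: η₂) :: α)) θ (goals η₁) (.subst θ') →
      Comp P (inUse V θ (.body (noCuts η₁ ++ .cut :: η₂) :: α)) θ'
        (.body (η₂.map (BodyElt.subst θ')) :: Stack.subst θ' α) ρ →
      Comp P V θ (.body (noCuts η₁ ++ .cut :: η₂) :: α) ρ
  | body_cut_fail {V θ α} {η₁ : List (Formula L Var 0)} {η₂ : List (BodyElt L Var)} :
      Comp P (inUse V θ (.body (noCuts η₁ ++ .cut :: η₂) :: α)) θ (goals η₁) .fail →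
      Comp P V θ (.body (noCuts η₁ ++ .cut :: η₂) :: α) .fail
  | body_nocut {V θ α ρ} {η : List (Formula L Var 0)} :
      Comp P (inUse V θ (.body (noCuts η) :: α)) θ (goals η ++ α) ρ →
      Comp P V θ (.body (noCuts η) :: α) ρ

/-- Two results are the same on the variables in `W`: either they are the same symbol, or they are
substitutions which on `W` differ only by a renaming (a permutation) of the variables in their
values. -/
inductive Result.SameOn (W : Set Var) : Result L Var → Result L Var → Prop
  | fail : Result.SameOn W .fail .fail
  | flounder : Result.SameOn W .flounder .flounder
  | diverge : Result.SameOn W .diverge .diverge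
  | subst {θ₁ θ₂ : Subst L Var} (π : Equiv.Perm Var)
      (h : ∀ x ∈ W, substTm (renameBy π) (θ₁ x) = θ₂ x) :
      Result.SameOn W (.subst θ₁) (.subst θ₂)

/-- `θ : α ⇒_P ρ` in the liberal general semantics.  A result is read as an answer for the
variables of `θ` and `α`: the bindings of auxiliary variables introduced by renaming apart, and
the names chosen for these, are immaterial. -/
def Goes (P : Program L Var) (θ : Subst L Var) (α : Stack L Var) (ρ : Result L Var) : Prop :=
  ∃ ρ', Comp P ∅ θ α ρ' ∧ Result.SameOn (θ.vars ∪ α.fv) ρ' ρ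

end Semantics

/-! ### The completion algorithm -/

section Completion

variable [DecidableEq Var]

/-- The formula `true`, that is `0 = 0`. -/
def trueF (zero : L.Term Empty) : Formula L Var 0 :=
  .eq (zero.relabel Empty.elim) (zero.relabel Empty.elim)

/-- Replace one clause of a program, as allowed by `r`. -/
inductive ReplaceClause (r : Clause L Var → Clause L Var → Prop) :
    Program L Var → Program L Var → Prop
  | mk {P₁ P₂ : Program L Var} {c c' : Clause L Var} : r c c' →
      ReplaceClause r (P₁ ++ c :: P₂) (P₁ ++ c' :: P₂)

/-- Iterate `step` until `done` holds. -/
def Loop (step : Program L Var → Program L Var → Prop) (done : Program L Var → Prop)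
    (P P' : Program L Var) : Prop :=
  Relation.ReflTransGen step P P' ∧ done P'

/-- Step 2 (standard heads) on one clause; `k` is the last position whose argument is not yet
`xₖ`. -/
inductive HeadStep (x : ℕ → Var) : Clause L Var → Clause L Var → Prop
  | rename {n : ℕ} {p : L.Relations n} {t : Fin n → Tm L Var 0} {η : List (BodyElt L Var)}
      {k : Fin n} {y : Var} :
      (∀ j, k < j → t j = fvar (x j)) → t k ≠ fvar (x k) →
      t k = fvar y → (∀ j : Fin n, y ≠ x j) →
      HeadStep x ⟨p, t, η⟩ (Clause.subst (single y (fvar (x k))) ⟨p, t, η⟩)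
  | equate {n : ℕ} {p : L.Relations n} {t : Fin n → Tm L Var 0} {η : List (BodyElt L Var)}
      {k : Fin n} :
      (∀ j, k < j → t j = fvar (x j)) → t k ≠ fvar (x k) →
      (¬ ∃ y, t k = fvar y ∧ ∀ j : Fin n, y ≠ x j) →
      HeadStep x ⟨p, t, η⟩
        ⟨p, Function.update t k (fvar (x k)), .fml (.eq (fvar (x k)) (t k)) :: η⟩

/-- The head of the clause is `p(x₁,…,xₙ)`. -/
def StandardHead (x : ℕ → Var) (c : Clause L Var) : Prop :=
  ∀ i : Fin c.arity, c.args i = fvar (x i)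

/-- Step 3: conjoin two consecutive formulas. -/
inductive ConjStep : List (BodyElt L Var) → List (BodyElt L Var) → Prop
  | mk {η₁ η₂ : List (BodyElt L Var)} {F G : Formula L Var 0} :
      ConjStep (η₁ ++ .fml F :: .fml G :: η₂) (η₁ ++ .fml (.conj F G) :: η₂)

/-- Step 4: replace an empty body by `true`. -/
inductive EmptyStep (zero : L.Term Empty) : List (BodyElt L Var) → List (BodyElt L Var) → Prop
  | mk : EmptyStep zero [] [.fml (trueF zero)]

/-- Step 5: merge two consecutive cuts. -/
inductive CutCutStep : List (BodyElt L Var) → List (BodyElt L Var) → Prop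
  | mk {η₁ η₂ : List (BodyElt L Var)} :
      CutCutStep (η₁ ++ .cut :: .cut :: η₂) (η₁ ++ .cut :: η₂)

/-- Step 6: insert `true` before an initial cut. -/
inductive InitialCutStep (zero : L.Term Empty) :
    List (BodyElt L Var) → List (BodyElt L Var) → Prop
  | mk {η : List (BodyElt L Var)} :
      InitialCutStep zero (.cut :: η) (.fml (trueF zero) :: .cut :: η)

/-- Step 7: insert `true` after a final cut. -/
inductive FinalCutStep (zero : L.Term Empty) :
    List (BodyElt L Var) → List (BodyElt L Var) → Prop
  | mk {η : List (BodyElt L Var)} :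
      FinalCutStep zero (η ++ [.cut]) (η ++ [.cut, .fml (trueF zero)])

/-- Rewrite clause bodies by `r`, one at a time, for as long as possible. -/
def BodyLoop (r : List (BodyElt L Var) → List (BodyElt L Var) → Prop) :
    Program L Var → Program L Var → Prop :=
  Loop (ReplaceClause (fun c c' => ∃ η', r c.body η' ∧ c' = { c with body := η' }))
    (fun P => ∀ c ∈ P, ¬ ∃ η', r c.body η')

/-- `ys` lists the elements of `S` without repetition. -/
def Lists (ys : List Var) (S : Set Var) : Prop := ys.Nodup ∧ ∀ y, y ∈ ys ↔ y ∈ S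

/-- Step 8: move the part of a body after its last cut but one to a new predicate. -/
inductive SplitStep : Program L Var → Program L Var → Prop
  | mk {P₁ P₂ : Program L Var} {n : ℕ} {p : L.Relations n} {t : Fin n → Tm L Var 0}
      {η : List (BodyElt L Var)} {F G : Formula L Var 0} {ys : List Var}
      {q : L.Relations ys.length} :
      Lists ys (F.fv ∪ G.fv) →
      (⟨_, q⟩ : Σ n, L.Relations n) ∉
        Program.preds (P₁ ++ ⟨p, t, η ++ [.cut, .fml F, .cut, .fml G]⟩ :: P₂) →
      SplitStep (P₁ ++ ⟨p, t, η ++ [.cut, .fml F, .cut, .fml G]⟩ :: P₂)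
        (P₁ ++ ⟨p, t, η ++ [.cut, .fml (.atom q (fun i => fvar (ys.get i)))]⟩ :: P₂ ++
          [⟨q, fun i => fvar (ys.get i), [.fml F, .cut, .fml G]⟩])

/-- No clause body ends in `!, F, !, G`. -/
def SplitDone (P : Program L Var) : Prop :=
  ∀ c ∈ P, ¬ ∃ η F G, c.body = η ++ [.cut, .fml F, .cut, .fml G]

/-- The body of the clause is a single formula, whose free variables occur in the head. -/
def Clause.IsScoped (c : Clause L Var) : Prop :=
  ∃ G : Formula L Var 0, c.body = [.fml G] ∧ G.fv ⊆ c.headFv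

/-- Step 9 on one clause: bind the variables of the body that do not occur in the head. -/
inductive ScopeClause : Clause L Var → Clause L Var → Prop
  | nocut {n : ℕ} {p : L.Relations n} {t : Fin n → Tm L Var 0} {G : Formula L Var 0}
      {ys : List Var} :
      Lists ys (G.fv \ ⋃ i, fvTm (t i)) →
      ScopeClause ⟨p, t, [.fml G]⟩ ⟨p, t, [.fml (exs ys G)]⟩
  | cut {n : ℕ} {p : L.Relations n} {t : Fin n → Tm L Var 0} {F G : Formula L Var 0}
      {ys : List Var} :
      Lists ys ((F.fv ∪ G.fv) \ ⋃ i, fvTm (t i)) →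
      ScopeClause ⟨p, t, [.fml F, .cut, .fml G]⟩ ⟨p, t, [.fml (ifs ys F G)]⟩

/-- Step 9: treat the last clause of a predicate, if its body is not yet a scoped formula. -/
inductive ScopeStep : Program L Var → Program L Var → Prop
  | mk {P₁ P₂ : Program L Var} {c c' : Clause L Var} :
      (∀ d ∈ P₂, d.symb ≠ c.symb) → ¬ c.IsScoped → ScopeClause c c' →
      ScopeStep (P₁ ++ c :: P₂) (P₁ ++ c' :: P₂)

/-- The last clause of every predicate has a scoped formula as its body. -/
def ScopeDone (P : Program L Var) : Prop :=
  ∀ P₁ P₂ c, P = P₁ ++ c :: P₂ → (∀ d ∈ P₂, d.symb ≠ c.symb) → c.IsScoped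

/-- Step 10 on the last two clauses of a predicate: the body of the clause that replaces
`p(t) :- η` and `p(t) :- H`, where `t` are the arguments in the two heads. -/
inductive MergeBody {n : ℕ} (t : Fin n → Tm L Var 0) (H : Formula L Var 0) :
    List (BodyElt L Var) → Formula L Var 0 → Prop
  | nocut {G : Formula L Var 0} {ys : List Var} :
      Lists ys (G.fv \ ⋃ i, fvTm (t i)) →
      MergeBody t H [.fml G] (.disj (exs ys G) H)
  | cut {F G : Formula L Var 0} {ys : List Var} :
      Lists ys ((F.fv ∪ G.fv) \ ⋃ i, fvTm (t i)) →
      MergeBody t H [.fml F, .cut, .fml G]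
        (.disj (ifs ys F G) (.conj (.neg (exs ys F)) H))

/-- Step 10: replace the last two clauses of a predicate by a single one. -/
inductive MergeStep : Program L Var → Program L Var → Prop
  | mk {P₁ P₂ P₃ : Program L Var} {n : ℕ} {p : L.Relations n} {t : Fin n → Tm L Var 0}
      {η : List (BodyElt L Var)} {H K : Formula L Var 0} :
      (∀ d ∈ P₂, d.symb ≠ ⟨n, p⟩) → (∀ d ∈ P₃, d.symb ≠ ⟨n, p⟩) → MergeBody t H η K →
      MergeStep (P₁ ++ ⟨p, t, η⟩ :: P₂ ++ ⟨p, t, [.fml H]⟩ :: P₃)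
        (P₁ ++ ⟨p, t, [.fml K]⟩ :: P₂ ++ P₃)

/-- Every predicate is defined by at most one clause. -/
def MergeDone (P : Program L Var) : Prop := P.Pairwise (fun c d => c.symb ≠ d.symb)

/-- `P'` is the augmented Clark completion of `P`: the outcome of some run of the completion
algorithm on `P`, for an arbitrary choice of the variables `x₁, x₂, …`, of the clauses to be
treated and of the new predicate names. -/
def IsCompletion (zero : L.Term Empty) (P P' : Program L Var) : Prop :=
  ∃ x : ℕ → Var, Function.Injective x ∧ (∀ i, x i ∉ P.fv) ∧
  ∃ P₂ P₃ P₄ P₅ P₆ P₇ P₈ P₉ : Program L Var,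
    Loop (ReplaceClause (HeadStep x)) (fun Q => ∀ c ∈ Q, StandardHead x c) P P₂ ∧
    BodyLoop ConjStep P₂ P₃ ∧
    BodyLoop (EmptyStep zero) P₃ P₄ ∧
    BodyLoop CutCutStep P₄ P₅ ∧
    BodyLoop (InitialCutStep zero) P₅ P₆ ∧
    BodyLoop (FinalCutStep zero) P₆ P₇ ∧
    Loop SplitStep SplitDone P₇ P₈ ∧
    Loop ScopeStep ScopeDone P₈ P₉ ∧
    Loop MergeStep MergeDone P₉ P'

end Completion

end CutLP

/-!
The completion algorithm preserves results because all its steps preserve a denotational semantics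
of programs that agrees with computations.

**The semantics.** The variables of a goal denote terms; a *world* fixes their values, and the state
of a computation is the set of worlds that are still possible. Solving an equation discards the
worlds in which it is false and fails when none is left (`Goal.constrain`). A goal is interpreted in
continuation-passing style (`Goal`): it takes a state and a continuation and yields a result, which
is failure or an answer. Continuations are needed because a disjunction backtracks into its second
part when what *follows* the first part fails, whereas negation, `if` and cuts run a goal up to its
first answer, which is to run it with the final continuation `Goal.ret`. Existential quantifiers,
`if` and the renaming of clauses add variables to the worlds and forget them afterwards
(`Goal.hide`); no fresh names are involved. A program `P` defines the step function `stepInterp P`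
on interpretations of the predicate symbols, and `sem P` is its least fixed point. Goals under
`sem P` have at most one result (`sem_det`), and they are invariant under relations between worlds
that preserve the values of the free variables (`sem_sim`).

**Agreement with computations.** By induction on computations, a goal stack whose computation ends
in failure denotes failure, and if it ends in the substitution `θσ`, then the answer of its
denotation consists of the instances of `σ` (`Comp.outcome`); the step for equations is the fact
that the unifiers of two terms are the instances of an idempotent most general one. Conversely,
whatever the denotation yields is the result of some computation (`exists_comp`). To prove this,
goals are matched with goal stacks (`Realizes`), and a fixed point induction shows that calls are
realized (`sem_callReal`); fresh variables exist since only finitely many are in use at any time.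
Two substitutions with the same set of instances are instances of each other, hence equal up to a
permutation of the variables (`exists_renaming`). So programs whose semantics agree on the
predicates of a goal stack have the same results for it (`goes_of_agreeOn`).

**The steps of the algorithm.** Two programs have the same semantics as soon as their step functions
agree on invariant and deterministic interpretations (`sem_eq`). For the steps that rewrite bodies
this is immediate (`BodyEquiv`). Making a head standard introduces a variable that does not occur in
the clause (`HeadInv`), so the worlds of the old and of the new clause correspond
(`sameCalls_rename`, `sameCalls_equate`). Binding the local variables of a clause changes nothing,
because the state in which its body starts does not restrict them (`exs_iff`, `ifs_iff`). Two last
clauses may be merged into a disjunction; if the first one contains a cut, this uses determinism: a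
guard that has succeeded does not fail, so that the negation in the second part excludes it
(`sameCalls_merge_cut`). The step that splits a body introduces a predicate `q`, and the semantics
of the other predicates does not change: each of the two least fixed points, corrected at `q`, is a
prefixed point of the other step function (`agreeOn_splitStep`).
-/

namespace CutLP

universe u v w z

variable {L : FirstOrder.Language.{u, v}} {Var : Type w}

/-! ### Substitution in terms and formulas -/

theorem term_subst_subst {α β γ : Type*} (t : L.Term α) (f : α → L.Term β) (g : β → L.Term γ) :
    (t.subst f).subst g = t.subst (fun z => (f z).subst g) := by
  induction t with
  | var => rfl
  | func _ _ ih => simp [FirstOrder.Language.Term.subst, ih]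

theorem term_subst_relabel {α β γ : Type*} (t : L.Term α) (f : α → β) (g : β → L.Term γ) :
    (t.relabel f).subst g = t.subst (g ∘ f) := by
  induction t with
  | var => rfl
  | func _ _ ih => simp [FirstOrder.Language.Term.subst, ih]

theorem term_relabel_subst {α β γ : Type*} (t : L.Term α) (f : α → L.Term β) (g : β → γ) :
    (t.subst f).relabel g = t.subst (fun z => (f z).relabel g) := by
  induction t with
  | var => rfl
  | func _ _ ih => simp [FirstOrder.Language.Term.subst, ih]

theorem term_subst_var {α : Type*} (t : L.Term α) : t.subst FirstOrder.Language.Term.var = t := by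
  induction t with
  | var => rfl
  | func _ _ ih => simp [FirstOrder.Language.Term.subst, ih]

/-- The environment in which the free variables are interpreted by `σ` and there are no bound
ones. -/
def Subst.env (σ : Subst L Var) : Var ⊕ Fin 0 → Tm L Var 0 := Sum.elim σ (fun i => i.elim0)

@[simp] theorem Subst.env_inl (σ : Subst L Var) (x : Var) : σ.env (Sum.inl x) = σ x := rfl

theorem substTm_eq (σ : Subst L Var) (t : Tm L Var 0) : substTm σ t = t.subst σ.env := rfl

theorem Formula.subst_eq (σ : Subst L Var) (F : Formula L Var 0) : F.subst σ = F.bind σ.env := rfl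

@[simp] theorem substTm_fvar (σ : Subst L Var) (x : Var) : substTm σ (fvar x) = σ x := rfl

theorem substTm_func (σ : Subst L Var) {n : ℕ} (f : L.Functions n) (ts : Fin n → Tm L Var 0) :
    substTm σ (.func f ts) = .func f (fun i => substTm σ (ts i)) := rfl

/-- Case analysis and induction for terms without bound variables. -/
theorem tm_induction {p : Tm L Var 0 → Prop} (hv : ∀ x : Var, p (fvar x))
    (hf : ∀ {n : ℕ} (f : L.Functions n) (ts : Fin n → Tm L Var 0), (∀ i, p (ts i)) →
      p (.func f ts)) (t : Tm L Var 0) : p t := by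
  induction t with
  | var z =>
    rcases z with x | i
    · exact hv x
    · exact i.elim0
  | func f ts ih => exact hf f ts ih

theorem substTm_substTm (σ τ : Subst L Var) (t : Tm L Var 0) :
    substTm τ (substTm σ t) = substTm (σ.comp τ) t := by
  rw [substTm_eq, substTm_eq, substTm_eq, term_subst_subst]
  congr 1
  funext z
  rcases z with x | i
  · rfl
  · exact i.elim0

@[simp] theorem env_fvar :
    Subst.env (fvar : Subst L Var) = FirstOrder.Language.Term.var := by
  funext z
  rcases z with x | i
  · rfl
  · exact i.elim0

@[simp] theorem substTm_id (t : Tm L Var 0) : substTm fvar t = t := by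
  rw [substTm_eq, env_fvar, term_subst_var]

theorem Subst.comp_apply (σ τ : Subst L Var) (x : Var) : σ.comp τ x = substTm τ (σ x) := rfl

theorem Subst.comp_assoc (σ τ υ : Subst L Var) : (σ.comp τ).comp υ = σ.comp (τ.comp υ) := by
  funext x
  simp only [Subst.comp_apply, substTm_substTm]

@[simp] theorem Subst.comp_fvar (σ : Subst L Var) : σ.comp fvar = σ := by
  funext x
  simp [Subst.comp_apply]

/-- The environment under `n` further binders, whose variables have the values `ts`. -/
def extEnv {k n : ℕ} {T : Type*} (e : Var ⊕ Fin k → T) (ts : Fin n → T) : Var ⊕ Fin (k + n) → T :=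
  Sum.elim (fun x => e (Sum.inl x)) (Fin.addCases (fun j => e (Sum.inr j)) ts)

@[simp] theorem extEnv_inl {k n : ℕ} {T : Type*} (e : Var ⊕ Fin k → T) (ts : Fin n → T) (x : Var) :
    extEnv e ts (Sum.inl x) = e (Sum.inl x) := rfl

@[simp] theorem extEnv_castAdd {k n : ℕ} {T : Type*} (e : Var ⊕ Fin k → T) (ts : Fin n → T)
    (j : Fin k) : extEnv e ts (Sum.inr (Fin.castAdd n j)) = e (Sum.inr j) := by
  simp [extEnv]

@[simp] theorem extEnv_natAdd {k n : ℕ} {T : Type*} (e : Var ⊕ Fin k → T) (ts : Fin n → T)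
    (j : Fin n) : extEnv e ts (Sum.inr (Fin.natAdd k j)) = ts j := by
  simp [extEnv]

theorem underBinders_inl {k m : ℕ} (n : ℕ) (f : Var ⊕ Fin k → Tm L Var m) (x : Var) :
    underBinders n f (Sum.inl x) = (f (Sum.inl x)).relabel (Sum.map id (Fin.castAdd n)) := rfl

theorem underBinders_castAdd {k m : ℕ} (n : ℕ) (f : Var ⊕ Fin k → Tm L Var m) (j : Fin k) :
    underBinders n f (Sum.inr (Fin.castAdd n j)) =
      (f (Sum.inr j)).relabel (Sum.map id (Fin.castAdd n)) := by
  simp [underBinders]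

theorem underBinders_natAdd {k m : ℕ} (n : ℕ) (f : Var ⊕ Fin k → Tm L Var m) (j : Fin n) :
    underBinders n f (Sum.inr (Fin.natAdd k j)) = bvar (Fin.natAdd m j) := by
  simp [underBinders]

/-- Lifting `f` under binders and then giving the values `ts` to the newly bound variables is the
same as extending the composition with `ts`. -/
theorem underBinders_subst {k m n : ℕ} (f : Var ⊕ Fin k → Tm L Var m) {α : Type*}
    (g : Var ⊕ Fin m → L.Term α) (ts : Fin n → L.Term α) :
    (fun z => (underBinders n f z).subst (extEnv g ts)) =
      extEnv (fun z => (f z).subst g) ts := by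
  have h : extEnv g ts ∘ Sum.map id (Fin.castAdd n) = g := by
    funext z
    rcases z with x | i <;> simp
  funext z
  rcases z with x | i
  · rw [underBinders_inl, term_subst_relabel, h, extEnv_inl]
  · refine Fin.addCases (fun j => ?_) (fun j => ?_) i
    · rw [underBinders_castAdd, term_subst_relabel, h, extEnv_castAdd]
    · simp [underBinders_natAdd, bvar, FirstOrder.Language.Term.subst]

theorem underBinders_underBinders {k m l : ℕ} (n : ℕ) (f : Var ⊕ Fin k → Tm L Var m)
    (g : Var ⊕ Fin m → Tm L Var l) :
    (fun z => (underBinders n f z).subst (underBinders n g)) =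
      underBinders n (fun z => (f z).subst g) := by
  have h : underBinders n g ∘ Sum.map id (Fin.castAdd n) =
      fun z => (g z).relabel (Sum.map id (Fin.castAdd n)) := by
    funext z
    rcases z with x | i
    · rfl
    · exact underBinders_castAdd n g i
  funext z
  rcases z with x | i
  · rw [underBinders_inl, term_subst_relabel, h, underBinders_inl, term_relabel_subst]
  · refine Fin.addCases (fun j => ?_) (fun j => ?_) i
    · rw [underBinders_castAdd, term_subst_relabel, h, underBinders_castAdd, term_relabel_subst]
    · simp [underBinders_natAdd, bvar, FirstOrder.Language.Term.subst]

theorem Formula.bind_bind {k : ℕ} (B : Formula L Var k) {m l : ℕ} (f : Var ⊕ Fin k → Tm L Var m)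
    (g : Var ⊕ Fin m → Tm L Var l) : (B.bind f).bind g = B.bind (fun z => (f z).subst g) := by
  induction B generalizing m l with
  | eq s t => simp [Formula.bind, term_subst_subst]
  | atom p ts => simp [Formula.bind, term_subst_subst]
  | conj B C ihB ihC => simp [Formula.bind, ihB, ihC]
  | disj B C ihB ihC => simp [Formula.bind, ihB, ihC]
  | neg B ihB => simp [Formula.bind, ihB]
  | ex B ihB => simp [Formula.bind, ihB, underBinders_underBinders]
  | ifthen n B C ihB ihC => simp [Formula.bind, ihB, ihC, underBinders_underBinders]

theorem underBinders_var {k : ℕ} (n : ℕ) :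
    underBinders n (FirstOrder.Language.Term.var : Var ⊕ Fin k → Tm L Var k) =
      FirstOrder.Language.Term.var := by
  funext z
  rcases z with x | i
  · rfl
  · refine Fin.addCases (fun j => ?_) (fun j => ?_) i <;> simp [underBinders, bvar]

theorem Formula.bind_var {k : ℕ} (B : Formula L Var k) :
    B.bind FirstOrder.Language.Term.var = B := by
  induction B with
  | eq s t => simp [Formula.bind, term_subst_var]
  | atom p ts => simp [Formula.bind, term_subst_var]
  | conj B C ihB ihC => simp [Formula.bind, ihB, ihC]
  | disj B C ihB ihC => simp [Formula.bind, ihB, ihC]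
  | neg B ihB => simp [Formula.bind, ihB]
  | ex B ihB => simp [Formula.bind, ihB, underBinders_var]
  | ifthen n B C ihB ihC => simp [Formula.bind, ihB, ihC, underBinders_var]

theorem Formula.inst_eq {n : ℕ} (xs : Fin n → Var) (B : Formula L Var (0 + n)) :
    B.inst xs = B.bind (extEnv (Subst.env fvar) (fun i => fvar (xs i))) := by
  unfold Formula.inst
  congr 1

/-- Instantiating the bound variables after a substitution under the binder. -/
theorem Formula.inst_bind {k n : ℕ} (xs : Fin n → Var) (B : Formula L Var (k + n))
    (f : Var ⊕ Fin k → Tm L Var 0) :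
    (B.bind (underBinders n f)).inst xs = B.bind (extEnv f (fun i => fvar (xs i))) := by
  rw [Formula.inst_eq, Formula.bind_bind, underBinders_subst, env_fvar]
  simp only [term_subst_var]

theorem comp_env (σ τ : Subst L Var) : (fun z => (σ.env z).subst τ.env) = (σ.comp τ).env := by
  funext z
  rcases z with x | i
  · rfl
  · exact i.elim0

theorem Formula.subst_subst (σ τ : Subst L Var) (F : Formula L Var 0) :
    (F.subst σ).subst τ = F.subst (σ.comp τ) := by
  rw [Formula.subst_eq, Formula.subst_eq, Formula.subst_eq, Formula.bind_bind, comp_env]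

@[simp] theorem Formula.subst_id (F : Formula L Var 0) : F.subst fvar = F := by
  rw [Formula.subst_eq, env_fvar, Formula.bind_var]

@[simp] theorem BodyElt.subst_id (b : BodyElt L Var) : b.subst fvar = b := by
  cases b <;> simp [BodyElt.subst]

theorem BodyElt.subst_subst (σ τ : Subst L Var) (b : BodyElt L Var) :
    (b.subst σ).subst τ = b.subst (σ.comp τ) := by
  cases b <;> simp [BodyElt.subst, Formula.subst_subst]

theorem bodySubst_subst (σ τ : Subst L Var) (η : List (BodyElt L Var)) :
    (η.map (BodyElt.subst σ)).map (BodyElt.subst τ) = η.map (BodyElt.subst (σ.comp τ)) := by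
  simp [BodyElt.subst_subst]

theorem map_bodySubst_id (η : List (BodyElt L Var)) : η.map (BodyElt.subst fvar) = η := by
  rw [show BodyElt.subst (fvar : Subst L Var) = id from funext BodyElt.subst_id, List.map_id]

@[simp] theorem Clause.subst_id (c : Clause L Var) : c.subst fvar = c := by
  simp [Clause.subst, map_bodySubst_id]

theorem Clause.subst_subst (σ τ : Subst L Var) (c : Clause L Var) :
    (c.subst σ).subst τ = c.subst (σ.comp τ) := by
  simp only [Clause.subst, substTm_substTm, bodySubst_subst]

theorem programSubst_subst (σ τ : Subst L Var) (γ : List (Clause L Var)) :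
    (γ.map (Clause.subst σ)).map (Clause.subst τ) = γ.map (Clause.subst (σ.comp τ)) := by
  simp [Clause.subst_subst]

theorem map_clauseSubst_id (γ : List (Clause L Var)) : γ.map (Clause.subst fvar) = γ := by
  rw [show Clause.subst (fvar : Subst L Var) = id from funext Clause.subst_id, List.map_id]

@[simp] theorem StackElt.subst_id (b : StackElt L Var) : b.subst fvar = b := by
  cases b <;> simp [StackElt.subst, map_clauseSubst_id, map_bodySubst_id]

theorem StackElt.subst_subst (σ τ : Subst L Var) (b : StackElt L Var) :
    (b.subst σ).subst τ = b.subst (σ.comp τ) := by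
  cases b <;> simp [StackElt.subst, Formula.subst_subst, substTm_substTm, Clause.subst_subst,
    BodyElt.subst_subst]

@[simp] theorem Stack.subst_id (α : Stack L Var) : Stack.subst fvar α = α := by
  rw [Stack.subst, show StackElt.subst (fvar : Subst L Var) = id from funext StackElt.subst_id,
    List.map_id]

theorem Stack.subst_subst (σ τ : Subst L Var) (α : Stack L Var) :
    Stack.subst τ (Stack.subst σ α) = Stack.subst (σ.comp τ) α := by
  simp [Stack.subst, StackElt.subst_subst]

@[simp] theorem Stack.subst_cons (σ : Subst L Var) (e : StackElt L Var) (α : Stack L Var) :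
    Stack.subst σ (e :: α) = e.subst σ :: Stack.subst σ α := rfl

@[simp] theorem Stack.subst_append (σ : Subst L Var) (α β : Stack L Var) :
    Stack.subst σ (α ++ β) = Stack.subst σ α ++ Stack.subst σ β := List.map_append

theorem Stack.subst_goals (σ : Subst L Var) (η : List (Formula L Var 0)) :
    Stack.subst σ (goals η) = goals (η.map (Formula.subst σ)) := by
  simp [Stack.subst, goals, StackElt.subst]

theorem map_subst_noCuts (σ : Subst L Var) (η : List (Formula L Var 0)) :
    (noCuts η).map (BodyElt.subst σ) = noCuts (η.map (Formula.subst σ)) := by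
  simp [noCuts, BodyElt.subst]

theorem Stack.subst_eqGoals (σ : Subst L Var) {n : ℕ} (s t : Fin n → Tm L Var 0) :
    Stack.subst σ (eqGoals s t) =
      eqGoals (fun i => substTm σ (s i)) (fun i => substTm σ (t i)) := by
  simp [Stack.subst, eqGoals, List.map_ofFn]
  rfl

/-- Every clause body without cuts is a sequence of formulas; otherwise it can be divided at its
first cut. -/
theorem body_cases (η : List (BodyElt L Var)) :
    (∃ η₁, η = noCuts η₁) ∨ ∃ η₁ η₂, η = noCuts η₁ ++ .cut :: η₂ := by
  induction η with
  | nil => exact .inl ⟨[], rfl⟩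
  | cons b η ih =>
    cases b with
    | cut => exact .inr ⟨[], η, rfl⟩
    | fml F =>
      rcases ih with ⟨η₁, rfl⟩ | ⟨η₁, η₂, rfl⟩
      · exact .inl ⟨F :: η₁, rfl⟩
      · exact .inr ⟨F :: η₁, η₂, rfl⟩

/-! ### Free variables -/

section Fv

variable [DecidableEq Var]

theorem fvTm_fvar {k : ℕ} (x : Var) : fvTm (fvar x : Tm L Var k) = {x} := by
  simp [fvTm, fvar, FirstOrder.Language.Term.varFinsetLeft]

theorem mem_fvTm_func {k n : ℕ} (f : L.Functions n) (ts : Fin n → Tm L Var k) (x : Var) :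
    x ∈ fvTm (FirstOrder.Language.Term.func f ts) ↔ ∃ i, x ∈ fvTm (ts i) := by
  simp [fvTm, FirstOrder.Language.Term.varFinsetLeft]

theorem fvTm_finite {k : ℕ} (t : Tm L Var k) : (fvTm t).Finite := Finset.finite_toSet _

/-- Substitution depends only on the values at the variables that occur. -/
theorem term_subst_congr {k : ℕ} {α : Type*} (t : Tm L Var k) {f g : Var ⊕ Fin k → L.Term α}
    (h : ∀ x ∈ fvTm t, f (Sum.inl x) = g (Sum.inl x)) (h' : ∀ j, f (Sum.inr j) = g (Sum.inr j)) :
    t.subst f = t.subst g := by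
  induction t with
  | var z =>
    rcases z with x | i
    · exact h x (by simp [fvTm])
    · exact h' i
  | func F ts ih =>
    simp only [FirstOrder.Language.Term.subst]
    congr 1
    funext i
    exact ih i (fun x hx => h x ((mem_fvTm_func F ts x).2 ⟨i, hx⟩))

theorem substTm_congr (t : Tm L Var 0) {σ τ : Subst L Var} (h : ∀ x ∈ fvTm t, σ x = τ x) :
    substTm σ t = substTm τ t :=
  term_subst_congr t h (fun j => j.elim0)

theorem substTm_eq_iff (t : Tm L Var 0) {σ τ : Subst L Var} :
    substTm σ t = substTm τ t ↔ ∀ x ∈ fvTm t, σ x = τ x := by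
  refine ⟨fun h => ?_, substTm_congr t⟩
  induction t using tm_induction with
  | hv x => simpa [fvTm_fvar] using h
  | hf f ts ih =>
    intro x hx
    obtain ⟨i, hi⟩ := (mem_fvTm_func f ts x).1 hx
    simp only [substTm_func, FirstOrder.Language.Term.func.injEq, heq_eq_eq, true_and] at h
    exact ih i (congrFun h i) x hi

theorem mem_fv_term_subst {k m : ℕ} (t : Tm L Var k) (f : Var ⊕ Fin k → Tm L Var m) {y : Var}
    (h : y ∈ fvTm (t.subst f)) :
    (∃ x ∈ fvTm t, y ∈ fvTm (f (Sum.inl x))) ∨ ∃ j, y ∈ fvTm (f (Sum.inr j)) := by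
  induction t with
  | var z =>
    rcases z with x | i
    · exact .inl ⟨x, by simp [fvTm], h⟩
    · exact .inr ⟨i, h⟩
  | func F ts ih =>
    simp only [FirstOrder.Language.Term.subst, mem_fvTm_func] at h
    obtain ⟨i, hi⟩ := h
    rcases ih i hi with ⟨x, hx, hy⟩ | h
    · exact .inl ⟨x, (mem_fvTm_func F ts x).2 ⟨i, hx⟩, hy⟩
    · exact .inr h

theorem mem_fvTm_substTm (σ : Subst L Var) (t : Tm L Var 0) (y : Var) :
    y ∈ fvTm (substTm σ t) ↔ ∃ x ∈ fvTm t, y ∈ fvTm (σ x) := by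
  constructor
  · intro h
    rcases mem_fv_term_subst t _ h with h | ⟨j, _⟩
    · exact h
    · exact j.elim0
  · rintro ⟨x, hx, hy⟩
    induction t using tm_induction with
    | hv z =>
      rw [fvTm_fvar, Set.mem_singleton_iff] at hx
      exact hx ▸ hy
    | hf f ts ih =>
      obtain ⟨i, hi⟩ := (mem_fvTm_func f ts x).1 hx
      exact (mem_fvTm_func _ _ _).2 ⟨i, ih i hi⟩

theorem fvTm_relabel_castAdd {k : ℕ} (n : ℕ) (t : Tm L Var k) :
    fvTm (t.relabel (Sum.map id (Fin.castAdd n)) : Tm L Var (k + n)) = fvTm t := by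
  induction t with
  | var z => rcases z with x | i <;> simp [fvTm]
  | func F ts ih =>
    ext x
    simp only [FirstOrder.Language.Term.relabel, mem_fvTm_func, ih]

theorem Formula.fv_finite {k : ℕ} (B : Formula L Var k) : B.fv.Finite := by
  induction B with
  | eq s t => exact (fvTm_finite s).union (fvTm_finite t)
  | atom p ts => exact Set.finite_iUnion fun i => fvTm_finite _
  | conj B C ihB ihC => exact ihB.union ihC
  | disj B C ihB ihC => exact ihB.union ihC
  | neg B ihB => exact ihB
  | ex B ihB => exact ihB
  | ifthen n B C ihB ihC => exact ihB.union ihC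

theorem mem_fv_underBinders {k m : ℕ} (n : ℕ) (f : Var ⊕ Fin k → Tm L Var m) {y : Var}
    {j : Fin (k + n)} (h : y ∈ fvTm (underBinders n f (Sum.inr j))) :
    ∃ j, y ∈ fvTm (f (Sum.inr j)) := by
  induction j using Fin.addCases with
  | left j =>
    refine ⟨j, ?_⟩
    simpa [underBinders, fvTm_relabel_castAdd] using h
  | right j => simp [underBinders, fvTm, bvar] at h

theorem Formula.mem_fv_bind {k : ℕ} (B : Formula L Var k) {m : ℕ} (f : Var ⊕ Fin k → Tm L Var m)
    {y : Var} (h : y ∈ (B.bind f).fv) :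
    (∃ x ∈ B.fv, y ∈ fvTm (f (Sum.inl x))) ∨ ∃ j, y ∈ fvTm (f (Sum.inr j)) := by
  have up : ∀ {k m : ℕ} (n : ℕ) (S : Set Var) (f : Var ⊕ Fin k → Tm L Var m),
      ((∃ x ∈ S, y ∈ fvTm (underBinders n f (Sum.inl x))) ∨
        ∃ j, y ∈ fvTm (underBinders n f (Sum.inr j))) →
      ((∃ x ∈ S, y ∈ fvTm (f (Sum.inl x))) ∨ ∃ j, y ∈ fvTm (f (Sum.inr j))) := by
    rintro k m n S f (⟨x, hx, hy⟩ | ⟨j, hj⟩)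
    · exact .inl ⟨x, hx, by simpa [underBinders, fvTm_relabel_castAdd] using hy⟩
    · exact .inr (mem_fv_underBinders n f hj)
  induction B generalizing m with
  | eq s t =>
    rcases h with h | h
    · exact (mem_fv_term_subst _ _ h).imp_left fun ⟨x, hx, hy⟩ => ⟨x, .inl hx, hy⟩
    · exact (mem_fv_term_subst _ _ h).imp_left fun ⟨x, hx, hy⟩ => ⟨x, .inr hx, hy⟩
  | atom p ts =>
    obtain ⟨i, hi⟩ := Set.mem_iUnion.1 h
    exact (mem_fv_term_subst _ _ hi).imp_left
      fun ⟨x, hx, hy⟩ => ⟨x, Set.mem_iUnion.2 ⟨i, hx⟩, hy⟩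
  | conj B C ihB ihC =>
    rcases h with h | h
    · exact (ihB _ h).imp_left fun ⟨x, hx, hy⟩ => ⟨x, .inl hx, hy⟩
    · exact (ihC _ h).imp_left fun ⟨x, hx, hy⟩ => ⟨x, .inr hx, hy⟩
  | disj B C ihB ihC =>
    rcases h with h | h
    · exact (ihB _ h).imp_left fun ⟨x, hx, hy⟩ => ⟨x, .inl hx, hy⟩
    · exact (ihC _ h).imp_left fun ⟨x, hx, hy⟩ => ⟨x, .inr hx, hy⟩
  | neg B ihB => exact ihB _ h
  | ex B ihB => exact up 1 _ f (ihB _ h)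
  | ifthen n B C ihB ihC =>
    rcases h with h | h
    · exact (up n _ f (ihB _ h)).imp_left fun ⟨x, hx, hy⟩ => ⟨x, .inl hx, hy⟩
    · exact (up n _ f (ihC _ h)).imp_left fun ⟨x, hx, hy⟩ => ⟨x, .inr hx, hy⟩

theorem Formula.mem_fv_subst (σ : Subst L Var) (F : Formula L Var 0) {y : Var}
    (h : y ∈ (F.subst σ).fv) : ∃ x ∈ F.fv, y ∈ fvTm (σ x) := by
  rcases Formula.mem_fv_bind _ _ h with h | ⟨j, _⟩
  · exact h
  · exact j.elim0

theorem Formula.mem_fv_inst {n : ℕ} (xs : Fin n → Var) (B : Formula L Var (0 + n)) {y : Var}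
    (h : y ∈ (B.inst xs).fv) : y ∈ B.fv ∨ ∃ i, y = xs i := by
  rw [Formula.inst_eq] at h
  rcases Formula.mem_fv_bind _ _ h with ⟨x, hx, hy⟩ | ⟨j, hj⟩
  · simp only [extEnv, Sum.elim_inl, Subst.env_inl, fvTm_fvar, Set.mem_singleton_iff] at hy
    exact .inl (hy ▸ hx)
  · refine .inr ?_
    induction j using Fin.addCases with
    | left j => exact j.elim0
    | right j =>
      rw [extEnv_natAdd, fvTm_fvar] at hj
      exact ⟨j, hj⟩

theorem Formula.bind_congr {k : ℕ} (B : Formula L Var k) {m : ℕ} {f g : Var ⊕ Fin k → Tm L Var m}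
    (h : ∀ x ∈ B.fv, f (Sum.inl x) = g (Sum.inl x)) (h' : ∀ j, f (Sum.inr j) = g (Sum.inr j)) :
    B.bind f = B.bind g := by
  have up : ∀ {k m : ℕ} (n : ℕ) {f g : Var ⊕ Fin k → Tm L Var m},
      (∀ j, f (Sum.inr j) = g (Sum.inr j)) → ∀ j, underBinders n f (Sum.inr j) =
        underBinders n g (Sum.inr j) := by
    intro k m n f g h j
    induction j using Fin.addCases <;> simp [underBinders, h]
  induction B generalizing m with
  | eq s t =>
    simp only [Formula.bind]
    rw [term_subst_congr s (fun x hx => h x (.inl hx)) h',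
      term_subst_congr t (fun x hx => h x (.inr hx)) h']
  | atom p ts =>
    simp only [Formula.bind]
    congr 1
    funext i
    exact term_subst_congr _ (fun x hx => h x (Set.mem_iUnion.2 ⟨i, hx⟩)) h'
  | conj B C ihB ihC =>
    simp only [Formula.bind]
    rw [ihB (fun x hx => h x (.inl hx)) h', ihC (fun x hx => h x (.inr hx)) h']
  | disj B C ihB ihC =>
    simp only [Formula.bind]
    rw [ihB (fun x hx => h x (.inl hx)) h', ihC (fun x hx => h x (.inr hx)) h']
  | neg B ihB =>
    simp only [Formula.bind]
    rw [ihB h h']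
  | ex B ihB =>
    simp only [Formula.bind]
    rw [ihB (fun x hx => by simp [underBinders, h x hx]) (up 1 h')]
  | ifthen n B C ihB ihC =>
    simp only [Formula.bind]
    rw [ihB (fun x hx => by simp [underBinders, h x (.inl hx)]) (up n h'),
      ihC (fun x hx => by simp [underBinders, h x (.inr hx)]) (up n h')]

theorem Formula.subst_congr (F : Formula L Var 0) {σ τ : Subst L Var}
    (h : ∀ x ∈ F.fv, σ x = τ x) : F.subst σ = F.subst τ :=
  Formula.bind_congr F h (fun j => j.elim0)

theorem BodyElt.subst_congr (b : BodyElt L Var) {σ τ : Subst L Var}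
    (h : ∀ x ∈ b.fv, σ x = τ x) : b.subst σ = b.subst τ := by
  cases b with
  | fml F => exact congrArg _ (Formula.subst_congr F h)
  | cut => rfl

theorem bodySubst_congr (η : List (BodyElt L Var)) {σ τ : Subst L Var}
    (h : ∀ x ∈ bodyFv η, σ x = τ x) :
    η.map (BodyElt.subst σ) = η.map (BodyElt.subst τ) :=
  List.map_congr_left fun b hb => BodyElt.subst_congr b fun x hx => h x ⟨b, hb, hx⟩

theorem Clause.subst_congr (c : Clause L Var) {σ τ : Subst L Var}
    (h : ∀ x ∈ c.fv, σ x = τ x) : c.subst σ = c.subst τ := by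
  simp only [Clause.subst]
  congr 1
  · funext i
    exact substTm_congr _ fun x hx => h x (.inl (Set.mem_iUnion.2 ⟨i, hx⟩))
  · exact bodySubst_congr _ fun x hx => h x (.inr hx)

theorem programSubst_congr (γ : List (Clause L Var)) {σ τ : Subst L Var}
    (h : ∀ x ∈ Program.fv γ, σ x = τ x) :
    γ.map (Clause.subst σ) = γ.map (Clause.subst τ) :=
  List.map_congr_left fun c hc => Clause.subst_congr c fun x hx => h x ⟨c, hc, hx⟩

theorem StackElt.subst_congr (e : StackElt L Var) {σ τ : Subst L Var}
    (h : ∀ x ∈ e.fv, σ x = τ x) : e.subst σ = e.subst τ := by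
  rcases e with F | ⟨p, s, γ⟩ | η
  · exact congrArg _ (Formula.subst_congr F h)
  · simp only [StackElt.subst]
    congr 1
    · funext i
      exact substTm_congr _ fun x hx => h x (.inl (Set.mem_iUnion.2 ⟨i, hx⟩))
    · exact programSubst_congr _ fun x hx => h x (.inr hx)
  · exact congrArg _ (bodySubst_congr η h)

theorem Stack.subst_congr (α : Stack L Var) {σ τ : Subst L Var}
    (h : ∀ x ∈ Stack.fv α, σ x = τ x) : Stack.subst σ α = Stack.subst τ α :=
  List.map_congr_left fun e he => StackElt.subst_congr e fun x hx => h x ⟨e, he, hx⟩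

theorem mem_bodyFv_subst (σ : Subst L Var) (η : List (BodyElt L Var)) {y : Var}
    (h : y ∈ bodyFv (η.map (BodyElt.subst σ))) : ∃ x ∈ bodyFv η, y ∈ fvTm (σ x) := by
  obtain ⟨e, he, hy⟩ := h
  obtain ⟨b, hb, rfl⟩ := List.mem_map.1 he
  cases b with
  | cut => exact hy.elim
  | fml F =>
    obtain ⟨x, hx, hy⟩ := Formula.mem_fv_subst σ F hy
    exact ⟨x, ⟨_, hb, hx⟩, hy⟩

theorem mem_iUnion_fv_subst {n : ℕ} (σ : Subst L Var) (s : Fin n → Tm L Var 0) {y : Var}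
    (h : y ∈ ⋃ i, fvTm (substTm σ (s i))) : ∃ x ∈ ⋃ i, fvTm (s i), y ∈ fvTm (σ x) := by
  obtain ⟨i, hi⟩ := Set.mem_iUnion.1 h
  obtain ⟨x, hx, hy⟩ := (mem_fvTm_substTm _ _ _).1 hi
  exact ⟨x, Set.mem_iUnion.2 ⟨i, hx⟩, hy⟩

theorem mem_programFv_subst (σ : Subst L Var) (γ : List (Clause L Var)) {y : Var}
    (h : y ∈ Program.fv (γ.map (Clause.subst σ))) : ∃ x ∈ Program.fv γ, y ∈ fvTm (σ x) := by
  obtain ⟨e, he, hy⟩ := h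
  obtain ⟨c, hc, rfl⟩ := List.mem_map.1 he
  rcases hy with hy | hy
  · obtain ⟨x, hx, hy⟩ := mem_iUnion_fv_subst σ c.args hy
    exact ⟨x, ⟨c, hc, .inl hx⟩, hy⟩
  · obtain ⟨x, hx, hy⟩ := mem_bodyFv_subst σ c.body hy
    exact ⟨x, ⟨c, hc, .inr hx⟩, hy⟩

theorem Stack.mem_fv_subst (σ : Subst L Var) (α : Stack L Var) {y : Var}
    (h : y ∈ Stack.fv (Stack.subst σ α)) : ∃ x ∈ Stack.fv α, y ∈ fvTm (σ x) := by
  obtain ⟨e, he, hy⟩ := h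
  obtain ⟨b, hb, rfl⟩ := List.mem_map.1 he
  have key : ∃ x ∈ b.fv, y ∈ fvTm (σ x) := by
    rcases b with F | ⟨p, s, γ⟩ | η
    · exact Formula.mem_fv_subst σ F hy
    · rcases hy with hy | hy
      · exact (mem_iUnion_fv_subst σ s hy).imp fun x h => ⟨.inl h.1, h.2⟩
      · exact (mem_programFv_subst σ γ hy).imp fun x h => ⟨.inr h.1, h.2⟩
    · exact mem_bodyFv_subst σ η hy
  obtain ⟨x, hx, hy⟩ := key
  exact ⟨x, ⟨b, hb, hx⟩, hy⟩

theorem BodyElt.fv_finite (b : BodyElt L Var) : b.fv.Finite := by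
  cases b with
  | fml F => exact F.fv_finite
  | cut => exact Set.finite_empty

omit [DecidableEq Var] in
theorem finite_exists_mem {ι : Type*} (l : List ι) (f : ι → Set Var) (h : ∀ i ∈ l, (f i).Finite) :
    {x | ∃ i ∈ l, x ∈ f i}.Finite := by
  have : {x | ∃ i ∈ l, x ∈ f i} = ⋃ i ∈ {i | i ∈ l}, f i := by ext; simp
  rw [this]
  exact (List.finite_toSet l).biUnion h

theorem bodyFv_finite (η : List (BodyElt L Var)) : (bodyFv η).Finite :=
  finite_exists_mem η _ fun b _ => b.fv_finite

theorem Clause.fv_finite (c : Clause L Var) : c.fv.Finite :=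
  (Set.finite_iUnion fun i => fvTm_finite (c.args i)).union (bodyFv_finite _)

theorem programFv_finite (γ : List (Clause L Var)) : (Program.fv γ).Finite :=
  finite_exists_mem γ _ fun c _ => c.fv_finite

theorem StackElt.fv_finite (e : StackElt L Var) : e.fv.Finite := by
  rcases e with F | ⟨p, s, γ⟩ | η
  · exact F.fv_finite
  · exact (Set.finite_iUnion fun i => fvTm_finite (s i)).union (programFv_finite γ)
  · exact bodyFv_finite η

theorem Stack.fv_finite (α : Stack L Var) : (Stack.fv α).Finite :=
  finite_exists_mem α _ fun e _ => e.fv_finite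

@[simp] theorem Stack.fv_cons (e : StackElt L Var) (α : Stack L Var) :
    Stack.fv (e :: α) = e.fv ∪ Stack.fv α := by
  ext x
  simp [Stack.fv]

@[simp] theorem Stack.fv_append (α β : Stack L Var) :
    Stack.fv (α ++ β) = Stack.fv α ∪ Stack.fv β := by
  ext x
  simp only [Stack.fv, List.mem_append, Set.mem_ofPred_eq, Set.mem_union]
  constructor
  · rintro ⟨e, h | h, hx⟩
    · exact .inl ⟨e, h, hx⟩
    · exact .inr ⟨e, h, hx⟩
  · rintro (⟨e, h, hx⟩ | ⟨e, h, hx⟩)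
    · exact ⟨e, .inl h, hx⟩
    · exact ⟨e, .inr h, hx⟩

@[simp] theorem Stack.fv_nil : Stack.fv ([] : Stack L Var) = ∅ := by
  ext x
  simp [Stack.fv]

theorem Subst.vars_finite {θ : Subst L Var} (h : θ.dom.Finite) : θ.vars.Finite := by
  have : {x | ∃ y ∈ θ.dom, x ∈ fvTm (θ y)} = ⋃ y ∈ θ.dom, fvTm (θ y) := by ext; simp
  refine h.union ?_
  rw [this]
  exact h.biUnion fun y _ => fvTm_finite _

theorem inUse_finite {V : Set Var} {θ : Subst L Var} (hV : V.Finite) (hθ : θ.dom.Finite)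
    (α : Stack L Var) : (inUse V θ α).Finite :=
  (hV.union (Subst.vars_finite hθ)).union (Stack.fv_finite α)

omit [DecidableEq Var] in
theorem Subst.dom_comp_finite {θ σ : Subst L Var} (hθ : θ.dom.Finite) (hσ : σ.dom.Finite) :
    (θ.comp σ).dom.Finite := by
  refine (hθ.union hσ).subset fun x hx => ?_
  by_contra h
  simp only [Set.mem_union, not_or, Subst.dom, Set.mem_ofPred_eq, not_not] at h
  exact hx (by rw [Subst.comp_apply, h.1, substTm_fvar, h.2])

end Fv

/-! ### Unification -/

section Unification

variable [DecidableEq Var]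

/-- An idempotent most general unifier leaves all variables but those of its problem alone: the
unifier that agrees with `σ` on `s`, `t` and is the identity elsewhere factors through `σ`. -/
theorem IsMGU.eq_fvar {σ : Subst L Var} {s t : Tm L Var 0} (h : IsMGU σ s t) {z : Var}
    (hz : z ∉ fvTm s ∪ fvTm t) : σ z = fvar z := by
  classical
  obtain ⟨hu, hmg, hid⟩ := h
  let τ : Subst L Var := fun x => if x ∈ fvTm s ∪ fvTm t then σ x else fvar x
  have hτ : IsUnifier τ s t := by
    have hs : substTm τ s = substTm σ s := substTm_congr _ fun x hx => if_pos (.inl hx)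
    have ht : substTm τ t = substTm σ t := substTm_congr _ fun x hx => if_pos (.inr hx)
    rw [IsUnifier, hs, ht]
    exact hu
  obtain ⟨δ, hδ⟩ := hmg τ hτ
  have hz' : fvar z = substTm δ (σ z) := by
    rw [← Subst.comp_apply, ← hδ]
    exact (if_neg hz).symm
  obtain ⟨y, hy⟩ : ∃ y, σ z = fvar y := by
    generalize σ z = r at hz'
    induction r using tm_induction with
    | hv y => exact ⟨y, rfl⟩
    | hf f ts _ => cases hz'
  have hyy : σ y = fvar y := by
    have := congrFun hid z
    rwa [Subst.comp_apply, hy, substTm_fvar] at this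
  have hτy : τ y = fvar z := by
    rw [hδ, Subst.comp_apply, hyy, hz', hy]
  by_cases hm : y ∈ fvTm s ∪ fvTm t
  · have h1 : τ y = σ y := if_pos hm
    rw [h1, hyy] at hτy
    have : y = z := by simpa [fvar] using hτy
    exact absurd (this ▸ hm) hz
  · have h1 : τ y = fvar y := if_neg hm
    rw [h1] at hτy
    rw [hy, hτy]

theorem IsMGU.dom_subset {σ : Subst L Var} {s t : Tm L Var 0} (h : IsMGU σ s t) :
    σ.dom ⊆ fvTm s ∪ fvTm t := fun z hz => by
  by_contra hz'
  exact hz (h.eq_fvar hz')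

/-- An idempotent most general unifier introduces no variables: a variable `z` outside of the
problem could otherwise be replaced by another one. -/
theorem IsMGU.fv_subset [Infinite Var] {σ : Subst L Var} {s t : Tm L Var 0} (h : IsMGU σ s t)
    {x z : Var} (hx : x ∈ fvTm s ∪ fvTm t) (hz : z ∈ fvTm (σ x)) : z ∈ fvTm s ∪ fvTm t := by
  classical
  by_contra hzn
  have hσz := h.eq_fvar hzn
  obtain ⟨y, hy⟩ := Set.Infinite.nonempty
    (((fvTm_finite s).union (fvTm_finite t)).union (Set.finite_singleton z)).infinite_compl
  have hyz : y ≠ z := fun e => hy (.inr e)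
  let τ : Subst L Var := fun v =>
    if v ∈ fvTm s ∪ fvTm t then substTm (single z (fvar y)) (σ v) else fvar v
  have hτ : IsUnifier τ s t := by
    have hs : substTm τ s = substTm (σ.comp (single z (fvar y))) s :=
      substTm_congr _ fun x hx => if_pos (.inl hx)
    have ht : substTm τ t = substTm (σ.comp (single z (fvar y))) t :=
      substTm_congr _ fun x hx => if_pos (.inr hx)
    rw [IsUnifier, hs, ht, ← substTm_substTm, ← substTm_substTm, h.1]
  obtain ⟨δ, hδ⟩ := h.2.1 τ hτ
  have hδz : δ z = fvar z := by
    have h1 : τ z = fvar z := if_neg hzn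
    rw [hδ, Subst.comp_apply, hσz, substTm_fvar] at h1
    exact h1
  have h1 : substTm (single z (fvar y)) (σ x) = substTm δ (σ x) := by
    have h1 : τ x = substTm (single z (fvar y)) (σ x) := if_pos hx
    rw [← h1, hδ, Subst.comp_apply]
  have h2 := (substTm_eq_iff _).1 h1 z hz
  rw [hδz, single, Function.update_self] at h2
  exact hyz (by simpa [fvar] using h2)

/-- The number of function symbols in a term. -/
def tmSize {α : Type*} : L.Term α → ℕ
  | .var _ => 0
  | .func _ ts => 1 + ∑ i, tmSize (ts i)

theorem tmSize_le (τ : Subst L Var) {x : Var} (t : Tm L Var 0) (hx : x ∈ fvTm t) :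
    tmSize (τ x) ≤ tmSize (substTm τ t) := by
  induction t using tm_induction with
  | hv y =>
    rw [fvTm_fvar, Set.mem_singleton_iff] at hx
    rw [hx, substTm_fvar]
  | hf f ts ih =>
    obtain ⟨i, hi⟩ := (mem_fvTm_func f ts x).1 hx
    rw [substTm_func, tmSize]
    have := Finset.single_le_sum (f := fun i => tmSize (substTm τ (ts i)))
      (fun _ _ => Nat.zero_le _) (Finset.mem_univ i)
    have := ih i hi
    omega

/-- The occurs check. -/
theorem notMem_fvTm_of_eq {τ : Subst L Var} {x : Var} {t : Tm L Var 0} (hne : t ≠ fvar x)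
    (h : τ x = substTm τ t) : x ∉ fvTm t := by
  intro hx
  induction t using tm_induction with
  | hv y =>
    rw [fvTm_fvar, Set.mem_singleton_iff] at hx
    exact hne (by rw [hx])
  | hf f ts _ =>
    obtain ⟨i, hi⟩ := (mem_fvTm_func f ts x).1 hx
    have h1 := tmSize_le τ (ts i) hi
    have h2 := Finset.single_le_sum (f := fun i => tmSize (substTm τ (ts i)))
      (fun _ _ => Nat.zero_le _) (Finset.mem_univ i)
    rw [h, substTm_func, tmSize] at h1
    omega

/-- Two distinct unifiable terms differ at a place at which one of them has a variable. -/
theorem exists_disagreement (s t : Tm L Var 0) (hne : s ≠ t) {τ : Subst L Var}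
    (hτ : IsUnifier τ s t) :
    ∃ (x : Var) (r : Tm L Var 0), r ≠ fvar x ∧ x ∈ fvTm s ∪ fvTm t ∧ fvTm r ⊆ fvTm s ∪ fvTm t ∧
      ∀ υ : Subst L Var, IsUnifier υ s t → υ x = substTm υ r := by
  induction s using tm_induction generalizing t with
  | hv x =>
    exact ⟨x, t, hne.symm, .inl (by simp [fvTm_fvar]), Set.subset_union_right, fun υ h => h⟩
  | hf f ts ih =>
    induction t using tm_induction with
    | hv y =>
      exact ⟨y, _, hne, .inr (by simp [fvTm_fvar]), Set.subset_union_left, fun υ h => h.symm⟩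
    | @hf m g ss _ =>
      have hτ' := hτ
      rw [IsUnifier, substTm_func, substTm_func] at hτ'
      injection hτ' with hn hfg hts
      subst hn
      obtain rfl := eq_of_heq hfg
      have hts := eq_of_heq hts
      obtain ⟨i, hi⟩ : ∃ i, ts i ≠ ss i := by
        by_contra! hc
        exact hne (by rw [funext hc])
      obtain ⟨x, r, h1, h2, h3, h4⟩ := ih i (ss i) hi (congrFun hts i)
      have hsub : fvTm (ts i) ∪ fvTm (ss i) ⊆
          fvTm (FirstOrder.Language.Term.func f ts : Tm L Var 0) ∪
            fvTm (FirstOrder.Language.Term.func f ss : Tm L Var 0) := by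
        rintro z (hz | hz)
        · exact .inl ((mem_fvTm_func _ _ _).2 ⟨i, hz⟩)
        · exact .inr ((mem_fvTm_func _ _ _).2 ⟨i, hz⟩)
      refine ⟨x, r, h1, hsub h2, h3.trans hsub, fun υ hυ => h4 υ ?_⟩
      rw [IsUnifier, substTm_func, substTm_func] at hυ
      injection hυ with _ _ hυ
      exact congrFun hυ i

theorem single_comp {τ : Subst L Var} {x : Var} {r : Tm L Var 0} (h : τ x = substTm τ r) :
    (single x r).comp τ = τ := by
  funext z
  rw [Subst.comp_apply, single]
  by_cases hz : z = x
  · subst hz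
    rw [Function.update_self, h]
  · rw [Function.update_of_ne hz, substTm_fvar]

theorem single_of_ne {x z : Var} (r : Tm L Var 0) (h : z ≠ x) : single x r z = fvar z :=
  Function.update_of_ne h _ _

theorem single_self (x : Var) (r : Tm L Var 0) : single x r x = r := Function.update_self _ _ _

/-- Substituting `r` for `x` removes `x` and introduces only variables of `r`. -/
theorem mem_fvTm_single {x : Var} {r t : Tm L Var 0} (hx : x ∉ fvTm r) {y : Var}
    (hy : y ∈ fvTm (substTm (single x r) t)) : y ≠ x ∧ (y ∈ fvTm t ∨ y ∈ fvTm r) := by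
  obtain ⟨z, hz, hy⟩ := (mem_fvTm_substTm _ _ _).1 hy
  by_cases hzx : z = x
  · subst hzx
    rw [single_self] at hy
    exact ⟨fun e => hx (e ▸ hy), .inr hy⟩
  · rw [single_of_ne r hzx, fvTm_fvar, Set.mem_singleton_iff] at hy
    subst hy
    exact ⟨hzx, .inl hz⟩

/-- The unification theorem: unifiable terms have an idempotent most general unifier. -/
theorem exists_isMGU [Infinite Var] (s t : Tm L Var 0) (h : ∃ τ : Subst L Var, IsUnifier τ s t) :
    ∃ σ : Subst L Var, IsMGU σ s t := by
  obtain ⟨n, hn⟩ : ∃ n, (fvTm s ∪ fvTm t).ncard = n := ⟨_, rfl⟩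
  induction n using Nat.strong_induction_on generalizing s t with
  | _ n ih =>
    obtain ⟨τ, hτ⟩ := h
    by_cases hne : s = t
    · exact ⟨fvar, by rw [IsUnifier, hne], fun τ _ => ⟨τ, rfl⟩, rfl⟩
    -- eliminate `x` by substituting `r` for it; every unifier factors through this substitution
    obtain ⟨x, r, hrx, hx, hr, hall⟩ := exists_disagreement s t hne hτ
    have hxr : x ∉ fvTm r := notMem_fvTm_of_eq hrx (hall τ hτ)
    have key : ∀ υ : Subst L Var, IsUnifier υ s t →
        IsUnifier υ (substTm (single x r) s) (substTm (single x r) t) := by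
      intro υ hυ
      rw [IsUnifier, substTm_substTm, substTm_substTm, single_comp (hall υ hυ)]
      exact hυ
    have hsub : ∀ y ∈ fvTm (substTm (single x r) s) ∪ fvTm (substTm (single x r) t),
        y ≠ x ∧ y ∈ fvTm s ∪ fvTm t := by
      rintro y (hy | hy)
      · exact ⟨(mem_fvTm_single hxr hy).1, (mem_fvTm_single hxr hy).2.elim .inl (fun h => hr h)⟩
      · exact ⟨(mem_fvTm_single hxr hy).1, (mem_fvTm_single hxr hy).2.elim .inr (fun h => hr h)⟩
    have hlt : (fvTm (substTm (single x r) s) ∪ fvTm (substTm (single x r) t)).ncard < n := by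
      rw [← hn]
      refine Set.ncard_lt_ncard ?_ ((fvTm_finite s).union (fvTm_finite t))
      exact ⟨fun y hy => (hsub y hy).2, fun hc => (hsub x (hc hx)).1 rfl⟩
    obtain ⟨σ, hσ⟩ := ih _ hlt _ _ ⟨τ, key τ hτ⟩ rfl
    have hσx : σ x = fvar x := hσ.eq_fvar fun hc => (hsub x hc).1 rfl
    have hσfv : ∀ z ≠ x, x ∉ fvTm (σ z) := by
      intro z hz hxz
      by_cases hzm : z ∈ fvTm (substTm (single x r) s) ∪ fvTm (substTm (single x r) t)
      · exact (hsub x (hσ.fv_subset hzm hxz)).1 rfl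
      · rw [hσ.eq_fvar hzm, fvTm_fvar, Set.mem_singleton_iff] at hxz
        exact hz hxz.symm
    refine ⟨(single x r).comp σ, ?_, fun υ hυ => ?_, ?_⟩
    · rw [IsUnifier, ← substTm_substTm, ← substTm_substTm]
      exact hσ.1
    · obtain ⟨δ, hδ⟩ := hσ.2.1 υ (key υ hυ)
      exact ⟨δ, by rw [Subst.comp_assoc, ← hδ, single_comp (hall υ hυ)]⟩
    · have hfix : ∀ z, x ∉ fvTm ((single x r).comp σ z) := by
        intro z hz
        obtain ⟨y, hy, hxy⟩ := (mem_fvTm_substTm _ _ _).1 hz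
        refine hσfv y ?_ hxy
        rintro rfl
        by_cases hzy : z = y
        · subst hzy
          rw [single_self] at hy
          exact hxr hy
        · rw [single_of_ne r hzy, fvTm_fvar, Set.mem_singleton_iff] at hy
          exact hzy hy.symm
      funext z
      have h1 : substTm ((single x r).comp σ) ((single x r).comp σ z) =
          substTm σ ((single x r).comp σ z) := by
        refine substTm_congr _ fun y hy => ?_
        have hyx : y ≠ x := fun e => hfix z (e ▸ hy)
        rw [Subst.comp_apply, single_of_ne r hyx, substTm_fvar]
      rw [Subst.comp_apply, h1, Subst.comp_apply, substTm_substTm, hσ.2.2]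

end Unification

/-! ### Denotations of goals -/

/-- The denotation of a goal in continuation-passing style.  The state of a computation is a set of
worlds, in each of which the variables have values; solving an equation discards the worlds in
which it is false.  A goal is run from a state with a continuation, which relates states to results;
`none` is failure and `some` is success with an answer of an arbitrary type `R`. -/
abbrev Goal (W : Type z) : Type (z + 1) :=
  ∀ R : Type z, (Set W → Option R → Prop) → Set W → Option R → Prop

namespace Goal

variable {W W' : Type z}

/-- The final continuation, which returns the state as the answer. -/
def ret (A : Set W) (r : Option (Set W)) : Prop := r = some A

/-- The goal that succeeds without doing anything. -/
def skip : Goal W := fun _ K => K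

/-- The goal that fails. -/
def fail : Goal W := fun _ _ _ r => r = none

/-- First `g`, then `h`. -/
def seq (g h : Goal W) : Goal W := fun R K => g R (h R K)

/-- Restrict the state to `X`, and fail if this makes it empty. -/
def constrain (X : Set W) : Goal W := fun _ K A r =>
  (A ∩ X = ∅ ∧ A ≠ ∅ ∧ r = none) ∨ ((A ∩ X = ∅ → A = ∅) ∧ K (A ∩ X) r)

/-- Commit to the first answer of `g`; continue with `h` if there is one, and with `alt` from the
original state if `g` fails. -/
def cutThen (g h alt : Goal W) : Goal W := fun R K A r =>
  (∃ A', g (Set W) ret A (some A') ∧ h R K A' r) ∨ (g (Set W) ret A none ∧ alt R K A r)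

/-- Commit to the first answer of `g`. -/
def once (g : Goal W) : Goal W := cutThen g skip fail

/-- Try `g`, with the continuation, and then `h`. -/
def orElse (g h : Goal W) : Goal W := fun R K A r =>
  ((∃ x, r = some x) ∧ g R K A r) ∨ (g R K A none ∧ h R K A r)

/-- Negation as failure. -/
def naf (g : Goal W) : Goal W := cutThen g fail skip

/-- Run `g` in the larger worlds `W'`, which have additional variables, and forget their values
afterwards. -/
def hide (pr : W' → W) (g : Goal W') : Goal W := fun R K A =>
  g R (fun A' => K (pr '' A')) (pr ⁻¹' A)

theorem skip_seq (g : Goal W) : skip.seq g = g := rfl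

theorem seq_skip (g : Goal W) : g.seq skip = g := rfl

theorem constrain_univ : constrain (Set.univ : Set W) = skip := by
  funext R K A r
  apply propext
  simp only [constrain, Set.inter_univ, skip]
  tauto

theorem constrain_seq_constrain (X Y : Set W) :
    (constrain X).seq (constrain Y) = constrain (X ∩ Y) := by
  funext R K A r
  apply propext
  have h : A ∩ X = ∅ → A ∩ (X ∩ Y) = ∅ := fun h => by rw [← Set.inter_assoc, h, Set.empty_inter]
  have h' : A = ∅ → A ∩ X = ∅ := fun h => by rw [h, Set.empty_inter]
  simp only [constrain, seq, Set.inter_assoc, ne_eq]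
  tauto

theorem once_skip : once (skip : Goal W) = skip := by
  funext R K A r
  apply propext
  simp [once, cutThen, skip, ret]

theorem orElse_fail (g : Goal W) : g.orElse fail = g := by
  funext R K A r
  apply propext
  cases r <;> simp [orElse, fail]

theorem cutThen_fail (g h : Goal W) : g.cutThen h fail = g.once.seq h := by
  funext R K A r
  apply propext
  simp [once, cutThen, skip, seq, fail]

theorem cutThen_seq (g h k s : Goal W) :
    (g.cutThen h k).seq s = g.cutThen (h.seq s) (k.seq s) := rfl

theorem orElse_seq (g h s : Goal W) : (g.orElse h).seq s = (g.seq s).orElse (h.seq s) := rfl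

theorem naf_seq (g h : Goal W) : g.naf.seq h = g.cutThen fail h := rfl

theorem constrain_seq_apply (X : Set W) (g : Goal W) (R : Type z) (K : Set W → Option R → Prop)
    (A : Set W) (r : Option R) : (constrain X).seq g R K A r ↔
      (A ∩ X = ∅ ∧ A ≠ ∅ ∧ r = none) ∨ ((A ∩ X = ∅ → A = ∅) ∧ g R K (A ∩ X) r) := Iff.rfl

theorem constrain_seq_apply_iff {X A : Set W} (h : A ∩ X = ∅ → A = ∅) (g : Goal W) {R : Type z}
    {K : Set W → Option R → Prop} {r : Option R} :
    (constrain X).seq g R K A r ↔ g R K (A ∩ X) r := by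
  rw [constrain_seq_apply]
  constructor
  · rintro (⟨h1, h2, -⟩ | ⟨-, h⟩)
    · exact absurd (h h1) h2
    · exact h
  · exact fun hg => .inr ⟨h, hg⟩

/-- A test that comes before both a guard and its alternative can be made before the choice. -/
theorem constrain_seq_cutThen (X : Set W) (g h k : Goal W) :
    ((constrain X).seq g).cutThen h ((constrain X).seq k) = (constrain X).seq (g.cutThen h k) := by
  funext R K A r
  apply propext
  by_cases hX : A ∩ X = ∅ → A = ∅
  · simp only [cutThen, constrain_seq_apply_iff hX]
  · simp only [Classical.not_imp] at hX
    simp [cutThen, constrain_seq_apply, hX]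

theorem constrain_seq_orElse (X : Set W) (g h : Goal W) :
    ((constrain X).seq g).orElse ((constrain X).seq h) = (constrain X).seq (g.orElse h) := by
  funext R K A r
  apply propext
  by_cases hX : A ∩ X = ∅ → A = ∅
  · simp only [orElse, constrain_seq_apply_iff hX]
  · simp only [Classical.not_imp] at hX
    cases r <;> simp [orElse, constrain_seq_apply, hX]

theorem constrain_seq_fail (X : Set W) : (constrain X).seq fail = fail := by
  funext R K A r
  apply propext
  simp only [constrain_seq_apply, fail, ne_eq]
  tauto

end Goal

open Goal

/-! ### Monotonicity, determinism and invariance of goals -/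

section Relations

variable {W W₁ W₂ W₁' W₂' : Type z}

/-- `h` has all the results that `g` has, also with a larger continuation. -/
def Goal.Le (g h : Goal W) : Prop :=
  ∀ ⦃R : Type z⦄ ⦃K K' : Set W → Option R → Prop⦄, (∀ A r, K A r → K' A r) →
    ∀ A r, g R K A r → h R K' A r

theorem Goal.Le.seq {g g' h h' : Goal W} (hg : g.Le g') (hh : h.Le h') :
    (g.seq h).Le (g'.seq h') := fun _ _ _ hK => hg (hh hK)

theorem Goal.Le.cutThen {g g' h h' k k' : Goal W} (hg : g.Le g') (hh : h.Le h') (hk : k.Le k') :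
    (g.cutThen h k).Le (g'.cutThen h' k') := by
  rintro R K K' hK A r (⟨A', h1, h2⟩ | ⟨h1, h2⟩)
  · exact .inl ⟨A', hg (fun _ _ h => h) _ _ h1, hh hK _ _ h2⟩
  · exact .inr ⟨hg (fun _ _ h => h) _ _ h1, hk hK _ _ h2⟩

theorem Goal.Le.skip : (skip : Goal W).Le skip := fun _ _ _ hK => hK

theorem Goal.Le.fail : (fail : Goal W).Le fail := fun _ _ _ _ _ _ h => h

theorem Goal.Le.orElse {g g' h h' : Goal W} (hg : g.Le g') (hh : h.Le h') :
    (g.orElse h).Le (g'.orElse h') := by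
  rintro R K K' hK A r (⟨h1, h2⟩ | ⟨h1, h2⟩)
  · exact .inl ⟨h1, hg hK _ _ h2⟩
  · exact .inr ⟨hg hK _ _ h1, hh hK _ _ h2⟩

theorem Goal.Le.hide {pr : W' → W} {g g' : Goal W'} (hg : g.Le g') :
    (g.hide pr).Le (g'.hide pr) := fun _ _ _ hK _ _ h => hg (fun _ _ h => hK _ _ h) _ _ h

theorem Goal.Le.constrain (X : Set W) : (constrain X).Le (constrain X) :=
  fun _ _ _ hK _ _ h => h.imp_right fun h => ⟨h.1, hK _ _ h.2⟩

/-- Results of `g` and `h` agree if those of their continuations do. -/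
def Goal.Det (g h : Goal W) : Prop :=
  ∀ ⦃R : Type z⦄ ⦃K K' : Set W → Option R → Prop⦄, (∀ A r r', K A r → K' A r' → r = r') →
    ∀ A r r', g R K A r → h R K' A r' → r = r'

theorem Goal.Det.seq {g g' h h' : Goal W} (hg : g.Det g') (hh : h.Det h') :
    (g.seq h).Det (g'.seq h') := fun _ _ _ hK => hg (hh hK)

theorem Goal.det_ret (A : Set W) (r r' : Option (Set W)) (h : ret A r) (h' : ret A r') :
    r = r' := by
  rw [ret] at h h'
  rw [h, h']

theorem Goal.Det.cutThen {g g' h h' k k' : Goal W} (hg : g.Det g') (hh : h.Det h')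
    (hk : k.Det k') : (g.cutThen h k).Det (g'.cutThen h' k') := by
  rintro R K K' hK A r r' (⟨A₁, h1, h2⟩ | ⟨h1, h2⟩) (⟨A₂, h3, h4⟩ | ⟨h3, h4⟩)
  · have := hg Goal.det_ret _ _ _ h1 h3
    rw [Option.some_inj] at this
    subst this
    exact hh hK _ _ _ h2 h4
  · cases hg Goal.det_ret _ _ _ h1 h3
  · cases hg Goal.det_ret _ _ _ h1 h3
  · exact hk hK _ _ _ h2 h4

theorem Goal.Det.skip : (skip : Goal W).Det skip := fun _ _ _ hK => hK

theorem Goal.Det.fail : (fail : Goal W).Det fail := fun _ _ _ _ _ _ _ h h' => h.trans h'.symm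

theorem Goal.Det.orElse {g g' h h' : Goal W} (hg : g.Det g') (hh : h.Det h') :
    (g.orElse h).Det (g'.orElse h') := by
  rintro R K K' hK A r r' (⟨⟨x, rfl⟩, h2⟩ | ⟨h1, h2⟩) (⟨⟨x', rfl⟩, h4⟩ | ⟨h3, h4⟩)
  · exact hg hK _ _ _ h2 h4
  · cases hg hK _ _ _ h2 h3
  · cases hg hK _ _ _ h1 h4
  · exact hh hK _ _ _ h2 h4

theorem Goal.Det.hide {pr : W' → W} {g g' : Goal W'} (hg : g.Det g') :
    (g.hide pr).Det (g'.hide pr) :=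
  fun _ _ _ hK A r r' h h' =>
    hg (fun A _ _ h h' => hK (pr '' A) _ _ h h') (pr ⁻¹' A) r r' h h'

theorem Goal.Det.constrain (X : Set W) : (constrain X).Det (constrain X) := by
  rintro R K K' hK A r r' (⟨h1, h2, h3⟩ | ⟨h1, h2⟩) (⟨h4, h5, h6⟩ | ⟨h4, h5⟩)
  · rw [h3, h6]
  · exact absurd (h4 h1) h2
  · exact absurd (h1 h4) h5
  · exact hK _ _ _ h2 h5

/-- The relation between sets that a relation between their elements induces. -/
def LiftRel {W₁ W₂ : Type*} (S : W₁ → W₂ → Prop) (A₁ : Set W₁) (A₂ : Set W₂) : Prop :=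
  (∀ w₁ ∈ A₁, ∃ w₂ ∈ A₂, S w₁ w₂) ∧ ∀ w₂ ∈ A₂, ∃ w₁ ∈ A₁, S w₁ w₂

theorem LiftRel.mono {S S' : W₁ → W₂ → Prop} {A₁ : Set W₁} {A₂ : Set W₂} (h : LiftRel S A₁ A₂)
    (hS : ∀ w₁ w₂, S w₁ w₂ → S' w₁ w₂) : LiftRel S' A₁ A₂ :=
  ⟨fun w₁ h₁ => (h.1 w₁ h₁).imp fun _ h => ⟨h.1, hS _ _ h.2⟩,
    fun w₂ h₂ => (h.2 w₂ h₂).imp fun _ h => ⟨h.1, hS _ _ h.2⟩⟩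

theorem LiftRel.eq_empty_iff {S : W₁ → W₂ → Prop} {A₁ : Set W₁} {A₂ : Set W₂}
    (h : LiftRel S A₁ A₂) : A₁ = ∅ ↔ A₂ = ∅ := by
  constructor
  · rintro rfl
    refine Set.eq_empty_of_forall_notMem fun w₂ hw => ?_
    obtain ⟨_, h, _⟩ := h.2 w₂ hw
    exact h
  · rintro rfl
    refine Set.eq_empty_of_forall_notMem fun w₁ hw => ?_
    obtain ⟨_, h, _⟩ := h.1 w₁ hw
    exact h

theorem LiftRel.inter {S : W₁ → W₂ → Prop} {A₁ X₁ : Set W₁} {A₂ X₂ : Set W₂}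
    (h : LiftRel S A₁ A₂) (hX : ∀ w₁ w₂, S w₁ w₂ → (w₁ ∈ X₁ ↔ w₂ ∈ X₂)) :
    LiftRel S (A₁ ∩ X₁) (A₂ ∩ X₂) := by
  refine ⟨fun w₁ hw => ?_, fun w₂ hw => ?_⟩
  · obtain ⟨w₂, h₂, hS⟩ := h.1 w₁ hw.1
    exact ⟨w₂, ⟨h₂, (hX _ _ hS).1 hw.2⟩, hS⟩
  · obtain ⟨w₁, h₁, hS⟩ := h.2 w₂ hw.1
    exact ⟨w₁, ⟨h₁, (hX _ _ hS).2 hw.2⟩, hS⟩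

theorem LiftRel.image {W₁ W₂ W₁' W₂' : Type*} {S' : W₁' → W₂' → Prop} {S : W₁ → W₂ → Prop}
    {A₁ : Set W₁'} {A₂ : Set W₂'} {f₁ : W₁' → W₁} {f₂ : W₂' → W₂} (h : LiftRel S' A₁ A₂)
    (hf : ∀ w₁ w₂, S' w₁ w₂ → S (f₁ w₁) (f₂ w₂)) : LiftRel S (f₁ '' A₁) (f₂ '' A₂) := by
  constructor
  · rintro _ ⟨w₁, h₁, rfl⟩
    obtain ⟨w₂, h₂, hS⟩ := h.1 w₁ h₁
    exact ⟨_, ⟨w₂, h₂, rfl⟩, hf _ _ hS⟩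
  · rintro _ ⟨w₂, h₂, rfl⟩
    obtain ⟨w₁, h₁, hS⟩ := h.2 w₂ h₂
    exact ⟨_, ⟨w₁, h₁, rfl⟩, hf _ _ hS⟩

theorem liftRel_eq {A₁ A₂ : Set W} : LiftRel Eq A₁ A₂ ↔ A₁ = A₂ := by
  constructor
  · rintro ⟨h1, h2⟩
    ext w
    constructor
    · intro h
      obtain ⟨_, h', rfl⟩ := h1 w h
      exact h'
    · intro h
      obtain ⟨_, h', rfl⟩ := h2 w h
      exact h'
  · rintro rfl
    exact ⟨fun w h => ⟨w, h, rfl⟩, fun w h => ⟨w, h, rfl⟩⟩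

/-- Every result allowed by `p₁` is related to one allowed by `p₂`. -/
def ResSim {R₁ R₂ : Type z} (Q : R₁ → R₂ → Prop) (p₁ : Option R₁ → Prop) (p₂ : Option R₂ → Prop) :
    Prop := ∀ r₁, p₁ r₁ → ∃ r₂, Option.Rel Q r₁ r₂ ∧ p₂ r₂

/-- Started from related states, `K₂` simulates `K₁`. -/
def KSim {R₁ R₂ : Type z} (S : W₁ → W₂ → Prop) (Q : R₁ → R₂ → Prop)
    (K₁ : Set W₁ → Option R₁ → Prop) (K₂ : Set W₂ → Option R₂ → Prop) : Prop :=
  ∀ ⦃A₁ A₂⦄, LiftRel S A₁ A₂ → ResSim Q (K₁ A₁) (K₂ A₂)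

/-- Started from `A₁` and `A₂`, the goal `g₂` simulates `g₁`. -/
def GSimAt (S : W₁ → W₂ → Prop) (A₁ : Set W₁) (A₂ : Set W₂) (g₁ : Goal W₁) (g₂ : Goal W₂) : Prop :=
  ∀ ⦃R₁ R₂ : Type z⦄ ⦃Q : R₁ → R₂ → Prop⦄ ⦃K₁ K₂⦄, KSim S Q K₁ K₂ →
    ResSim Q (g₁ R₁ K₁ A₁) (g₂ R₂ K₂ A₂)

/-- The goal `g₂` simulates `g₁` from all related states. -/
def GSim (S : W₁ → W₂ → Prop) (g₁ : Goal W₁) (g₂ : Goal W₂) : Prop :=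
  ∀ ⦃A₁ A₂⦄, LiftRel S A₁ A₂ → GSimAt S A₁ A₂ g₁ g₂

variable {S : W₁ → W₂ → Prop} {A₁ : Set W₁} {A₂ : Set W₂}

theorem ResSim.some {R₁ R₂ : Type z} {Q : R₁ → R₂ → Prop} {p₁ : Option R₁ → Prop}
    {p₂ : Option R₂ → Prop} (h : ResSim Q p₁ p₂) {x : R₁} (hx : p₁ (some x)) :
    ∃ y, Q x y ∧ p₂ (some y) := by
  obtain ⟨r, hr, h2⟩ := h _ hx
  cases hr with
  | some hQ => exact ⟨_, hQ, h2⟩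

theorem ResSim.none {R₁ R₂ : Type z} {Q : R₁ → R₂ → Prop} {p₁ : Option R₁ → Prop}
    {p₂ : Option R₂ → Prop} (h : ResSim Q p₁ p₂) (hx : p₁ none) : p₂ none := by
  obtain ⟨r, hr, h2⟩ := h _ hx
  cases hr
  exact h2

/-- Running two goals with the final continuation relates their answers. -/
theorem kSim_ret : KSim S (LiftRel S) ret ret := by
  rintro A₁ A₂ h r rfl
  exact ⟨_, .some h, rfl⟩

theorem GSimAt.seq {g₁ h₁ : Goal W₁} {g₂ h₂ : Goal W₂} (hg : GSimAt S A₁ A₂ g₁ g₂)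
    (hh : GSim S h₁ h₂) : GSimAt S A₁ A₂ (g₁.seq h₁) (g₂.seq h₂) :=
  fun _ _ _ _ _ hK => hg fun _ _ hA => hh hA hK

theorem GSim.seq {g₁ h₁ : Goal W₁} {g₂ h₂ : Goal W₂} (hg : GSim S g₁ g₂)
    (hh : GSim S h₁ h₂) : GSim S (g₁.seq h₁) (g₂.seq h₂) :=
  fun _ _ hA => (hg hA).seq hh

theorem GSim.skip : GSim S skip skip := fun _ _ hA _ _ _ _ _ hK => hK hA

theorem GSimAt.fail : GSimAt S A₁ A₂ fail fail := by
  rintro R₁ R₂ Q K₁ K₂ - r rfl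
  exact ⟨_, .none, rfl⟩

theorem GSim.fail : GSim S fail fail := fun _ _ _ => .fail

theorem GSimAt.cutThen {g₁ h₁ k₁ : Goal W₁} {g₂ h₂ k₂ : Goal W₂} (hg : GSimAt S A₁ A₂ g₁ g₂)
    (hh : GSim S h₁ h₂) (hk : GSimAt S A₁ A₂ k₁ k₂) :
    GSimAt S A₁ A₂ (g₁.cutThen h₁ k₁) (g₂.cutThen h₂ k₂) := by
  rintro R₁ R₂ Q K₁ K₂ hK r (⟨A', h1, h2⟩ | ⟨h1, h2⟩)
  · obtain ⟨A'', hA, h3⟩ := (hg kSim_ret).some h1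
    obtain ⟨r', hr, h4⟩ := hh hA hK _ h2
    exact ⟨r', hr, .inl ⟨A'', h3, h4⟩⟩
  · obtain ⟨r', hr, h4⟩ := hk hK _ h2
    exact ⟨r', hr, .inr ⟨(hg kSim_ret).none h1, h4⟩⟩

theorem GSim.cutThen {g₁ h₁ k₁ : Goal W₁} {g₂ h₂ k₂ : Goal W₂} (hg : GSim S g₁ g₂)
    (hh : GSim S h₁ h₂) (hk : GSim S k₁ k₂) : GSim S (g₁.cutThen h₁ k₁) (g₂.cutThen h₂ k₂) :=
  fun _ _ hA => (hg hA).cutThen hh (hk hA)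

theorem GSim.once {g₁ : Goal W₁} {g₂ : Goal W₂} (hg : GSim S g₁ g₂) : GSim S g₁.once g₂.once :=
  hg.cutThen .skip .fail

theorem GSimAt.orElse {g₁ h₁ : Goal W₁} {g₂ h₂ : Goal W₂} (hg : GSimAt S A₁ A₂ g₁ g₂)
    (hh : GSimAt S A₁ A₂ h₁ h₂) : GSimAt S A₁ A₂ (g₁.orElse h₁) (g₂.orElse h₂) := by
  rintro R₁ R₂ Q K₁ K₂ hK r (⟨⟨x, rfl⟩, h2⟩ | ⟨h1, h2⟩)
  · obtain ⟨y, hQ, h3⟩ := (hg hK).some h2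
    exact ⟨_, .some hQ, .inl ⟨⟨y, rfl⟩, h3⟩⟩
  · obtain ⟨r', hr, h4⟩ := hh hK _ h2
    exact ⟨r', hr, .inr ⟨(hg hK).none h1, h4⟩⟩

theorem GSim.orElse {g₁ h₁ : Goal W₁} {g₂ h₂ : Goal W₂} (hg : GSim S g₁ g₂)
    (hh : GSim S h₁ h₂) : GSim S (g₁.orElse h₁) (g₂.orElse h₂) :=
  fun _ _ hA => (hg hA).orElse (hh hA)

theorem GSim.constrain {X₁ : Set W₁} {X₂ : Set W₂}
    (hX : ∀ w₁ w₂, S w₁ w₂ → (w₁ ∈ X₁ ↔ w₂ ∈ X₂)) : GSim S (constrain X₁) (constrain X₂) := by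
  rintro A₁ A₂ hA R₁ R₂ Q K₁ K₂ hK r h
  have hAX := hA.inter hX
  rcases h with ⟨h1, h2, rfl⟩ | ⟨h1, h2⟩
  · exact ⟨_, .none, .inl ⟨hAX.eq_empty_iff.1 h1, fun h => h2 (hA.eq_empty_iff.2 h), rfl⟩⟩
  · obtain ⟨r', hr, h3⟩ := hK hAX _ h2
    exact ⟨r', hr, .inr ⟨fun h => hA.eq_empty_iff.1 (h1 (hAX.eq_empty_iff.2 h)), h3⟩⟩

/-- Constraining by two sets of worlds that are matched only within the current states. -/
theorem GSimAt.constrain {S' : W₁ → W₂ → Prop} {X₁ : Set W₁} {X₂ : Set W₂}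
    (hA : LiftRel S' A₁ A₂) (hX : LiftRel S (A₁ ∩ X₁) (A₂ ∩ X₂)) :
    GSimAt S A₁ A₂ (Goal.constrain X₁) (Goal.constrain X₂) := by
  rintro R₁ R₂ Q K₁ K₂ hK r h
  rcases h with ⟨h1, h2, rfl⟩ | ⟨h1, h2⟩
  · exact ⟨_, .none, .inl ⟨hX.eq_empty_iff.1 h1, fun h => h2 (hA.eq_empty_iff.2 h), rfl⟩⟩
  · obtain ⟨r', hr, h3⟩ := hK hX _ h2
    exact ⟨r', hr, .inr ⟨fun h => hA.eq_empty_iff.1 (h1 (hX.eq_empty_iff.2 h)), h3⟩⟩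

/-- Hiding variables preserves simulation if related worlds can be extended by related values of the
hidden variables. -/
theorem GSim.hide {S' : W₁' → W₂' → Prop} {pr₁ : W₁' → W₁} {pr₂ : W₂' → W₂} {g₁ : Goal W₁'}
    {g₂ : Goal W₂'} (hg : GSim S' g₁ g₂) (hS : ∀ w₁ w₂, S' w₁ w₂ → S (pr₁ w₁) (pr₂ w₂))
    (h₁ : ∀ w₁ w₂, S (pr₁ w₁) w₂ → ∃ w₂', pr₂ w₂' = w₂ ∧ S' w₁ w₂')
    (h₂ : ∀ w₁ w₂, S w₁ (pr₂ w₂) → ∃ w₁', pr₁ w₁' = w₁ ∧ S' w₁' w₂) :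
    GSim S (g₁.hide pr₁) (g₂.hide pr₂) := by
  intro A₁ A₂ hA R₁ R₂ Q K₁ K₂ hK
  refine hg ⟨fun w₁ hw => ?_, fun w₂ hw => ?_⟩ fun B₁ B₂ hB => hK (hB.image hS)
  · obtain ⟨w₂, h3, h4⟩ := hA.1 _ hw
    obtain ⟨w₂', rfl, h5⟩ := h₁ _ _ h4
    exact ⟨w₂', h3, h5⟩
  · obtain ⟨w₁, h3, h4⟩ := hA.2 _ hw
    obtain ⟨w₁', rfl, h5⟩ := h₂ _ _ h4
    exact ⟨w₁', h3, h5⟩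

/-- Additional variables that have the same values on both sides. -/
theorem GSim.hide_fst {E : Type z} {g₁ : Goal (W₁ × E)} {g₂ : Goal (W₂ × E)}
    (hg : GSim (fun v₁ v₂ => S v₁.1 v₂.1 ∧ v₁.2 = v₂.2) g₁ g₂) :
    GSim S (g₁.hide Prod.fst) (g₂.hide Prod.fst) :=
  hg.hide (fun _ _ h => h.1) (fun w₁ w₂ h => ⟨(w₂, w₁.2), rfl, h, rfl⟩)
    (fun w₁ w₂ h => ⟨(w₁, w₂.2), rfl, h, rfl⟩)

end Relations

/-! ### The denotational semantics -/

/-- An interpretation of the predicate symbols: the denotation of a call with the given values of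
the arguments. -/
abbrev Interp (L : FirstOrder.Language.{u, v}) (Var : Type w) :=
  ∀ n : ℕ, L.Relations n → ∀ W : Type (max u w), (W → Fin n → Tm L Var 0) → Goal W

variable {W : Type (max u w)}

/-- A call of `p`.  Continuations are enlarged, so that calls are monotone in the continuation
under every interpretation. -/
def call (I : Interp L Var) {n : ℕ} (p : L.Relations n) (a : W → Fin n → Tm L Var 0) : Goal W :=
  fun R K A r => ∃ K', (∀ A' r', K' A' r' → K A' r') ∧ I n p W a R K' A r

/-- The denotation of a formula, when the variables have the values `e w` in the world `w`. -/
def den (I : Interp L Var) : {k : ℕ} → Formula L Var k → {W : Type (max u w)} →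
    (W → Var ⊕ Fin k → Tm L Var 0) → Goal W
  | _, .eq s t, _, e => constrain {w | s.subst (e w) = t.subst (e w)}
  | _, .atom p ts, _, e => call I p (fun w i => (ts i).subst (e w))
  | _, .conj B C, _, e => (den I B e).seq (den I C e)
  | _, .disj B C, _, e => (den I B e).orElse (den I C e)
  | _, .neg B, _, e => (den I B e).naf
  | _, .ex B, W, e =>
      (den I B (fun v : W × (Fin 1 → Tm L Var 0) => extEnv (e v.1) v.2)).hide Prod.fst
  | _, .ifthen n B C, W, e =>
      ((den I B (fun v : W × (Fin n → Tm L Var 0) => extEnv (e v.1) v.2)).once.seq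
        (den I C (fun v : W × (Fin n → Tm L Var 0) => extEnv (e v.1) v.2))).hide Prod.fst

/-- The denotation of a formula without dangling bound variables. -/
def denF (I : Interp L Var) (F : Formula L Var 0) (e : W → Subst L Var) : Goal W :=
  den I F (fun w => (e w).env)

/-- The denotation of `pre` followed by a clause body, in which a cut commits to the choices made
up to it. -/
def denBody (I : Interp L Var) (e : W → Subst L Var) : Goal W → List (BodyElt L Var) → Goal W
  | pre, [] => pre
  | pre, .fml F :: η => denBody I e (pre.seq (denF I F e)) η
  | pre, .cut :: η => pre.once.seq (denBody I e skip η)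

/-- The denotation of a clause with body `η` and of the alternatives `alt` to this clause: a cut
discards the alternatives.  The goal `pre` comes before the body. -/
def denClause (I : Interp L Var) (e : W → Subst L Var) (alt : Goal W) :
    Goal W → List (BodyElt L Var) → Goal W
  | pre, [] => pre.orElse alt
  | pre, .fml F :: η => denClause I e alt (pre.seq (denF I F e)) η
  | pre, .cut :: η => pre.cutThen (denBody I e skip η) alt

/-- The worlds in which the arguments `a` of a call match those in the head of the clause `c`. -/
def headSet {n : ℕ} (a : W → Fin n → Tm L Var 0) (e : W → Subst L Var) (c : Clause L Var) : Set W :=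
  {w | ∀ (i : Fin n) (j : Fin c.arity), (i : ℕ) = j → a w i = substTm (e w) (c.args j)}

/-- The denotation of a call of `p` with arguments `a` by means of the given clauses. -/
def denUsing (I : Interp L Var) {n : ℕ} (p : L.Relations n) (a : W → Fin n → Tm L Var 0)
    (e : W → Subst L Var) : List (Clause L Var) → Goal W
  | [] => Goal.fail
  | c :: γ => fun R K A r => c.symb = ⟨n, p⟩ ∧
      denClause I e (denUsing I p a e γ) (constrain (headSet a e c)) c.body R K A r

/-- The denotation of a goal stack element. -/
def denElt (I : Interp L Var) (e : W → Subst L Var) : StackElt L Var → Goal W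
  | .fml F => denF I F e
  | .using p s γ => denUsing I p (fun w i => substTm (e w) (s i)) e γ
  | .body η => denBody I e skip η

/-- The denotation of a goal stack. -/
def denStack (I : Interp L Var) (e : W → Subst L Var) : Stack L Var → Goal W
  | [] => skip
  | b :: α => (denElt I e b).seq (denStack I e α)

/-- The interpretation in which predicates are defined by the clauses of `P`, whose bodies are
interpreted by `I`.  The variables of the clauses are new: they are added to the worlds. -/
def stepInterp (P : Program L Var) (I : Interp L Var) : Interp L Var := fun _ p W a =>
  (denUsing I p (fun v : W × Subst L Var => a v.1) (fun v => v.2) (clausesOf p P)).hide Prod.fst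

section Mono

variable {I J : Interp L Var}

theorem call_le (h : I ≤ J) {n : ℕ} (p : L.Relations n) (a : W → Fin n → Tm L Var 0) :
    (call I p a).Le (call J p a) := by
  rintro R K K' hK A r ⟨K₀, h1, h2⟩
  exact ⟨K₀, fun _ _ h => hK _ _ (h1 _ _ h), h _ _ _ _ _ _ _ _ h2⟩

theorem den_le (h : I ≤ J) {k : ℕ} (B : Formula L Var k) {W : Type (max u w)}
    (e : W → Var ⊕ Fin k → Tm L Var 0) : (den I B e).Le (den J B e) := by
  induction B generalizing W with
  | eq s t => exact .constrain _
  | atom p ts => exact call_le h _ _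
  | conj B C ihB ihC => exact (ihB e).seq (ihC e)
  | disj B C ihB ihC => exact (ihB e).orElse (ihC e)
  | neg B ihB => exact (ihB e).cutThen .fail .skip
  | ex B ihB => exact (ihB _).hide
  | ifthen n B C ihB ihC => exact (((ihB _).cutThen .skip .fail).seq (ihC _)).hide

theorem denBody_le (h : I ≤ J) (e : W → Subst L Var) (η : List (BodyElt L Var)) {g g' : Goal W}
    (hg : g.Le g') : (denBody I e g η).Le (denBody J e g' η) := by
  induction η generalizing g g' with
  | nil => exact hg
  | cons b η ih =>
    cases b with
    | fml F => exact ih (hg.seq (den_le h F _))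
    | cut => exact (hg.cutThen .skip .fail).seq (ih .skip)

theorem denClause_le (h : I ≤ J) (e : W → Subst L Var) (η : List (BodyElt L Var))
    {g g' k k' : Goal W} (hk : k.Le k') (hg : g.Le g') :
    (denClause I e k g η).Le (denClause J e k' g' η) := by
  induction η generalizing g g' with
  | nil => exact hg.orElse hk
  | cons b η ih =>
    cases b with
    | fml F => exact ih (hg.seq (den_le h F _))
    | cut => exact hg.cutThen (denBody_le h e η .skip) hk

theorem denUsing_le (h : I ≤ J) {n : ℕ} (p : L.Relations n) (a : W → Fin n → Tm L Var 0)
    (e : W → Subst L Var) (γ : List (Clause L Var)) :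
    (denUsing I p a e γ).Le (denUsing J p a e γ) := by
  induction γ with
  | nil => exact .fail
  | cons c γ ih =>
    exact fun R K K' hK A r hr => ⟨hr.1, denClause_le h e _ ih (.constrain _) hK _ _ hr.2⟩

theorem stepInterp_mono (P : Program L Var) : Monotone (stepInterp P) :=
  fun _ _ h _ _ _ _ _ _ _ _ hr => (denUsing_le h _ _ _ _).hide (fun _ _ h => h) _ _ hr

end Mono

/-- The interpretation of the predicate symbols that is defined by `P`: the least fixed point of
`stepInterp P`. -/
def sem (P : Program L Var) : Interp L Var := OrderHom.lfp ⟨stepInterp P, stepInterp_mono P⟩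

theorem stepInterp_sem (P : Program L Var) : stepInterp P (sem P) = sem P :=
  OrderHom.map_lfp ⟨stepInterp P, stepInterp_mono P⟩

theorem sem_apply (P : Program L Var) {n : ℕ} (p : L.Relations n) (a : W → Fin n → Tm L Var 0) :
    sem P n p W a = (denUsing (sem P) p (fun v : W × Subst L Var => a v.1) (fun v => v.2)
      (clausesOf p P)).hide Prod.fst := by
  conv_lhs => rw [← stepInterp_sem]
  rfl

theorem sem_le {P : Program L Var} {I : Interp L Var} (h : stepInterp P I ≤ I) : sem P ≤ I :=
  OrderHom.lfp_le ⟨stepInterp P, stepInterp_mono P⟩ h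

section Det

/-- Calls have at most one result, in the sense of `Goal.Det`. -/
def InterpDet (I J : Interp L Var) : Prop :=
  ∀ (n : ℕ) (p : L.Relations n) (W : Type (max u w)) (a : W → Fin n → Tm L Var 0),
    Goal.Det (I n p W a) (J n p W a)

variable {I J : Interp L Var}

theorem call_det (h : InterpDet I J) {n : ℕ} (p : L.Relations n) (a : W → Fin n → Tm L Var 0) :
    (call I p a).Det (call J p a) := by
  rintro R K K' hK A r r' ⟨K₁, h1, h2⟩ ⟨K₂, h3, h4⟩
  exact h n p W a (fun A r r' h h' => hK A r r' (h1 A r h) (h3 A r' h')) A r r' h2 h4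

theorem den_det (h : InterpDet I J) {k : ℕ} (B : Formula L Var k) {W : Type (max u w)}
    (e : W → Var ⊕ Fin k → Tm L Var 0) : (den I B e).Det (den J B e) := by
  induction B generalizing W with
  | eq s t => exact .constrain _
  | atom p ts => exact call_det h _ _
  | conj B C ihB ihC => exact (ihB e).seq (ihC e)
  | disj B C ihB ihC => exact (ihB e).orElse (ihC e)
  | neg B ihB => exact (ihB e).cutThen .fail .skip
  | ex B ihB => exact (ihB _).hide
  | ifthen n B C ihB ihC => exact (((ihB _).cutThen .skip .fail).seq (ihC _)).hide

theorem denBody_det (h : InterpDet I J) (e : W → Subst L Var) (η : List (BodyElt L Var))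
    {g g' : Goal W} (hg : g.Det g') : (denBody I e g η).Det (denBody J e g' η) := by
  induction η generalizing g g' with
  | nil => exact hg
  | cons b η ih =>
    cases b with
    | fml F => exact ih (hg.seq (den_det h F _))
    | cut => exact (hg.cutThen .skip .fail).seq (ih .skip)

theorem denClause_det (h : InterpDet I J) (e : W → Subst L Var) (η : List (BodyElt L Var))
    {g g' k k' : Goal W} (hk : k.Det k') (hg : g.Det g') :
    (denClause I e k g η).Det (denClause J e k' g' η) := by
  induction η generalizing g g' with
  | nil => exact hg.orElse hk
  | cons b η ih =>
    cases b with
    | fml F => exact ih (hg.seq (den_det h F _))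
    | cut => exact hg.cutThen (denBody_det h e η .skip) hk

theorem denUsing_det (h : InterpDet I J) {n : ℕ} (p : L.Relations n) (a : W → Fin n → Tm L Var 0)
    (e : W → Subst L Var) (γ : List (Clause L Var)) :
    (denUsing I p a e γ).Det (denUsing J p a e γ) := by
  induction γ with
  | nil => exact .fail
  | cons c γ ih =>
    exact fun R K K' hK A r r' hr hr' => denClause_det h e _ ih (.constrain _) hK _ _ _ hr.2 hr'.2

theorem stepInterp_det (P : Program L Var) (h : InterpDet I J) :
    InterpDet (stepInterp P I) (stepInterp P J) :=
  fun _ _ _ _ => (denUsing_det h _ _ _ _).hide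

/-- By fixed point induction: the interpretation `J` whose results are those that agree with every
result of `sem P` is a prefixed point. -/
theorem sem_det (P : Program L Var) : InterpDet (sem P) (sem P) := by
  let J : Interp L Var := fun n p W a R K A r =>
    ∀ K' r', (∀ A r r', K A r → K' A r' → r = r') → sem P n p W a R K' A r' → r = r'
  have hJ : InterpDet J (sem P) := fun n p W a R K K' hK A r r' h h' => h K' r' hK h'
  have hle : sem P ≤ J := sem_le fun n p W a R K A r h K' r' hK h' => by
    have := stepInterp_det P hJ
    rw [stepInterp_sem] at this
    exact this n p W a hK A r r' h h'
  exact fun n p W a R K K' hK A r r' h h' => hle n p W a R K A r h K' r' hK h'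

end Det

section Sim

/-- Calls under `J` simulate those under `I`. -/
def InterpSim (I J : Interp L Var) : Prop :=
  ∀ (n : ℕ) (p : L.Relations n) (W₁ W₂ : Type (max u w)) (a₁ : W₁ → Fin n → Tm L Var 0)
    (a₂ : W₂ → Fin n → Tm L Var 0) (S : W₁ → W₂ → Prop), (∀ w₁ w₂, S w₁ w₂ → a₁ w₁ = a₂ w₂) →
    GSim S (I n p W₁ a₁) (J n p W₂ a₂)

variable [DecidableEq Var] {I J : Interp L Var} {W₁ W₂ : Type (max u w)} {S : W₁ → W₂ → Prop}

omit [DecidableEq Var] in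
theorem call_sim (h : InterpSim I J) {n : ℕ} (p : L.Relations n) {a₁ : W₁ → Fin n → Tm L Var 0}
    {a₂ : W₂ → Fin n → Tm L Var 0} (ha : ∀ w₁ w₂, S w₁ w₂ → a₁ w₁ = a₂ w₂) :
    GSim S (call I p a₁) (call J p a₂) := by
  rintro A₁ A₂ hA R₁ R₂ Q K₁ K₂ hK r ⟨K, h1, h2⟩
  obtain ⟨r', hr, h3⟩ := h n p W₁ W₂ a₁ a₂ S ha hA (K₁ := K) (K₂ := K₂)
    (fun _ _ hA _ hr => hK hA _ (h1 _ _ hr)) r h2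
  exact ⟨r', hr, K₂, fun _ _ h => h, h3⟩

/-- The denotation of a formula depends only on the values of its variables, and is invariant under
relations between worlds that preserve these values. -/
theorem den_sim (h : InterpSim I J) {k : ℕ} (B : Formula L Var k) {W₁ W₂ : Type (max u w)}
    {S : W₁ → W₂ → Prop} {e₁ : W₁ → Var ⊕ Fin k → Tm L Var 0} {e₂ : W₂ → Var ⊕ Fin k → Tm L Var 0}
    (he : ∀ w₁ w₂, S w₁ w₂ → (∀ x ∈ B.fv, e₁ w₁ (Sum.inl x) = e₂ w₂ (Sum.inl x)) ∧
      ∀ j, e₁ w₁ (Sum.inr j) = e₂ w₂ (Sum.inr j)) :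
    GSim S (den I B e₁) (den J B e₂) := by
  have ext : ∀ {k n : ℕ} {X : Set Var} {W₁ W₂ : Type (max u w)} {S : W₁ → W₂ → Prop}
      {e₁ : W₁ → Var ⊕ Fin k → Tm L Var 0} {e₂ : W₂ → Var ⊕ Fin k → Tm L Var 0},
      (∀ w₁ w₂, S w₁ w₂ → (∀ x ∈ X, e₁ w₁ (Sum.inl x) = e₂ w₂ (Sum.inl x)) ∧
        ∀ j, e₁ w₁ (Sum.inr j) = e₂ w₂ (Sum.inr j)) →
      ∀ (v₁ : W₁ × (Fin n → Tm L Var 0)) (v₂ : W₂ × (Fin n → Tm L Var 0)),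
        (S v₁.1 v₂.1 ∧ v₁.2 = v₂.2) →
        (∀ x ∈ X, extEnv (e₁ v₁.1) v₁.2 (Sum.inl x) = extEnv (e₂ v₂.1) v₂.2 (Sum.inl x)) ∧
        ∀ j, extEnv (e₁ v₁.1) v₁.2 (Sum.inr j) = extEnv (e₂ v₂.1) v₂.2 (Sum.inr j) := by
    rintro k n X W₁ W₂ S e₁ e₂ he ⟨w₁, ts⟩ ⟨w₂, _⟩ ⟨hS, rfl⟩
    refine ⟨fun x hx => (he _ _ hS).1 x hx, fun j => ?_⟩
    induction j using Fin.addCases with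
    | left j => simpa using (he _ _ hS).2 j
    | right j => simp
  induction B generalizing W₁ W₂ with
  | eq s t =>
    refine .constrain fun w₁ w₂ hS => ?_
    obtain ⟨h1, h2⟩ := he _ _ hS
    rw [Set.mem_ofPred_eq, Set.mem_ofPred_eq, term_subst_congr s (fun x hx => h1 x (.inl hx)) h2,
      term_subst_congr t (fun x hx => h1 x (.inr hx)) h2]
  | atom p ts =>
    refine call_sim h _ fun w₁ w₂ hS => ?_
    obtain ⟨h1, h2⟩ := he _ _ hS
    funext i
    exact term_subst_congr _ (fun x hx => h1 x (Set.mem_iUnion.2 ⟨i, hx⟩)) h2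
  | conj B C ihB ihC =>
    exact (ihB fun w₁ w₂ hS => ⟨fun x hx => (he w₁ w₂ hS).1 x (.inl hx), (he w₁ w₂ hS).2⟩).seq
      (ihC fun w₁ w₂ hS => ⟨fun x hx => (he w₁ w₂ hS).1 x (.inr hx), (he w₁ w₂ hS).2⟩)
  | disj B C ihB ihC =>
    exact (ihB fun w₁ w₂ hS => ⟨fun x hx => (he w₁ w₂ hS).1 x (.inl hx), (he w₁ w₂ hS).2⟩).orElse
      (ihC fun w₁ w₂ hS => ⟨fun x hx => (he w₁ w₂ hS).1 x (.inr hx), (he w₁ w₂ hS).2⟩)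
  | neg B ihB => exact (ihB he).cutThen .fail .skip
  | ex B ihB => exact (ihB (ext he)).hide_fst
  | ifthen n B C ihB ihC =>
    have hB := ihB (ext (n := n) (X := B.fv) fun w₁ w₂ hS =>
      ⟨fun x hx => (he w₁ w₂ hS).1 x (.inl hx), (he w₁ w₂ hS).2⟩)
    have hC := ihC (ext (n := n) (X := C.fv) fun w₁ w₂ hS =>
      ⟨fun x hx => (he w₁ w₂ hS).1 x (.inr hx), (he w₁ w₂ hS).2⟩)
    exact (hB.once.seq hC).hide_fst

theorem denF_sim (h : InterpSim I J) (F : Formula L Var 0) {e₁ : W₁ → Subst L Var}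
    {e₂ : W₂ → Subst L Var} (he : ∀ w₁ w₂, S w₁ w₂ → ∀ x ∈ F.fv, e₁ w₁ x = e₂ w₂ x) :
    GSim S (denF I F e₁) (denF J F e₂) :=
  den_sim h F fun _ _ hS => ⟨he _ _ hS, fun j => j.elim0⟩

theorem denBody_sim (h : InterpSim I J) (η : List (BodyElt L Var)) {e₁ : W₁ → Subst L Var}
    {e₂ : W₂ → Subst L Var} (he : ∀ w₁ w₂, S w₁ w₂ → ∀ x ∈ bodyFv η, e₁ w₁ x = e₂ w₂ x)
    {A₁ : Set W₁} {A₂ : Set W₂} {g₁ : Goal W₁} {g₂ : Goal W₂} (hg : GSimAt S A₁ A₂ g₁ g₂) :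
    GSimAt S A₁ A₂ (denBody I e₁ g₁ η) (denBody J e₂ g₂ η) := by
  induction η generalizing g₁ g₂ A₁ A₂ with
  | nil => exact hg
  | cons b η ih =>
    have he' := fun w₁ w₂ hS x (hx : x ∈ bodyFv η) =>
      he w₁ w₂ hS x (hx.imp fun _ h => ⟨List.mem_cons_of_mem _ h.1, h.2⟩)
    cases b with
    | fml F =>
      exact ih he' (hg.seq (denF_sim h F fun w₁ w₂ hS x hx =>
        he w₁ w₂ hS x ⟨_, List.mem_cons_self, hx⟩))
    | cut =>
      exact (hg.cutThen .skip .fail).seq fun _ _ hA => ih he' (GSim.skip hA)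

theorem denClause_sim (h : InterpSim I J) (η : List (BodyElt L Var)) {e₁ : W₁ → Subst L Var}
    {e₂ : W₂ → Subst L Var} (he : ∀ w₁ w₂, S w₁ w₂ → ∀ x ∈ bodyFv η, e₁ w₁ x = e₂ w₂ x)
    {A₁ : Set W₁} {A₂ : Set W₂} {g₁ k₁ : Goal W₁} {g₂ k₂ : Goal W₂} (hk : GSimAt S A₁ A₂ k₁ k₂)
    (hg : GSimAt S A₁ A₂ g₁ g₂) :
    GSimAt S A₁ A₂ (denClause I e₁ k₁ g₁ η) (denClause J e₂ k₂ g₂ η) := by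
  induction η generalizing g₁ g₂ with
  | nil => exact hg.orElse hk
  | cons b η ih =>
    have he' := fun w₁ w₂ hS x (hx : x ∈ bodyFv η) =>
      he w₁ w₂ hS x (hx.imp fun _ h => ⟨List.mem_cons_of_mem _ h.1, h.2⟩)
    cases b with
    | fml F =>
      exact ih he' (hg.seq (denF_sim h F fun w₁ w₂ hS x hx =>
        he w₁ w₂ hS x ⟨_, List.mem_cons_self, hx⟩))
    | cut => exact hg.cutThen (fun _ _ hA => denBody_sim h η he' (GSim.skip hA)) hk

theorem denUsing_sim (h : InterpSim I J) {n : ℕ} (p : L.Relations n) (γ : List (Clause L Var))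
    {a₁ : W₁ → Fin n → Tm L Var 0} {a₂ : W₂ → Fin n → Tm L Var 0} {e₁ : W₁ → Subst L Var}
    {e₂ : W₂ → Subst L Var} (ha : ∀ w₁ w₂, S w₁ w₂ → a₁ w₁ = a₂ w₂)
    (he : ∀ w₁ w₂, S w₁ w₂ → ∀ x ∈ Program.fv γ, e₁ w₁ x = e₂ w₂ x) :
    GSim S (denUsing I p a₁ e₁ γ) (denUsing J p a₂ e₂ γ) := by
  intro A₁ A₂ hA
  induction γ with
  | nil => exact GSim.fail hA
  | cons c γ ih =>
    have he' := fun w₁ w₂ hS x (hx : x ∈ Program.fv γ) =>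
      he w₁ w₂ hS x (hx.imp fun _ h => ⟨List.mem_cons_of_mem _ h.1, h.2⟩)
    have hc := fun w₁ w₂ hS x (hx : x ∈ c.fv) => he w₁ w₂ hS x ⟨c, List.mem_cons_self, hx⟩
    have hhead : GSim S (constrain (headSet a₁ e₁ c)) (constrain (headSet a₂ e₂ c)) := by
      refine .constrain fun w₁ w₂ hS => ?_
      have h1 : ∀ j, substTm (e₁ w₁) (c.args j) = substTm (e₂ w₂) (c.args j) := fun j =>
        substTm_congr _ fun x hx => hc _ _ hS x (.inl (Set.mem_iUnion.2 ⟨j, hx⟩))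
      simp only [headSet, Set.mem_ofPred_eq, ha _ _ hS, h1]
    intro R₁ R₂ Q K₁ K₂ hK r ⟨hr, hr'⟩
    have hbody : ∀ w₁ w₂, S w₁ w₂ → ∀ x ∈ bodyFv c.body, e₁ w₁ x = e₂ w₂ x :=
      fun w₁ w₂ hS x hx => hc w₁ w₂ hS x (.inr hx)
    obtain ⟨r', h1, h2⟩ := denClause_sim h c.body hbody (ih he') (hhead hA) hK r hr'
    exact ⟨r', h1, hr, h2⟩

theorem denElt_sim (h : InterpSim I J) (b : StackElt L Var) {e₁ : W₁ → Subst L Var}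
    {e₂ : W₂ → Subst L Var} (he : ∀ w₁ w₂, S w₁ w₂ → ∀ x ∈ b.fv, e₁ w₁ x = e₂ w₂ x) :
    GSim S (denElt I e₁ b) (denElt J e₂ b) := by
  rcases b with F | ⟨p, s, γ⟩ | η
  · exact denF_sim h F he
  · refine denUsing_sim h p γ (fun w₁ w₂ hS => ?_) fun w₁ w₂ hS x hx => he w₁ w₂ hS x (.inr hx)
    funext i
    exact substTm_congr _ fun x hx => he w₁ w₂ hS x (.inl (Set.mem_iUnion.2 ⟨i, hx⟩))
  · exact fun _ _ hA => denBody_sim h η he (GSim.skip hA)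

theorem denStack_sim (h : InterpSim I J) (α : Stack L Var) {e₁ : W₁ → Subst L Var}
    {e₂ : W₂ → Subst L Var} (he : ∀ w₁ w₂, S w₁ w₂ → ∀ x ∈ Stack.fv α, e₁ w₁ x = e₂ w₂ x) :
    GSim S (denStack I e₁ α) (denStack J e₂ α) := by
  induction α with
  | nil => exact .skip
  | cons b α ih =>
    exact (denElt_sim h b fun w₁ w₂ hS x hx => he w₁ w₂ hS x (by simp [hx])).seq
      (ih fun w₁ w₂ hS x hx => he w₁ w₂ hS x (by simp [hx]))

theorem stepInterp_sim (P : Program L Var) (h : InterpSim I J) :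
    InterpSim (stepInterp P I) (stepInterp P J) :=
  fun _ _ _ _ _ _ _ ha => (denUsing_sim h _ _ (fun _ _ hS => ha _ _ hS.1)
    (fun _ _ hS _ _ => by rw [hS.2])).hide_fst

/-- By fixed point induction: the interpretation `J` whose results are those that `sem P` simulates
from all related states is a prefixed point. -/
theorem sem_sim (P : Program L Var) : InterpSim (sem P) (sem P) := by
  let J : Interp L Var := fun n p W₁ a₁ R₁ K₁ A₁ r₁ =>
    ∀ (W₂ R₂ : Type (max u w)) (a₂ : W₂ → Fin n → Tm L Var 0) (S : W₁ → W₂ → Prop)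
      (Q : R₁ → R₂ → Prop) (A₂ : Set W₂) (K₂ : Set W₂ → Option R₂ → Prop),
      (∀ w₁ w₂, S w₁ w₂ → a₁ w₁ = a₂ w₂) → LiftRel S A₁ A₂ → KSim S Q K₁ K₂ →
      ∃ r₂, Option.Rel Q r₁ r₂ ∧ sem P n p W₂ a₂ R₂ K₂ A₂ r₂
  have hJ : InterpSim J (sem P) := fun n p W₁ W₂ a₁ a₂ S ha A₁ A₂ hA R₁ R₂ Q K₁ K₂ hK r₁ h =>
    h W₂ R₂ a₂ S Q A₂ K₂ ha hA hK
  have hle : sem P ≤ J := sem_le fun n p W₁ a₁ R₁ K₁ A₁ r₁ h W₂ R₂ a₂ S Q A₂ K₂ ha hA hK => by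
    have := stepInterp_sim P hJ
    rw [stepInterp_sem] at this
    exact this n p W₁ W₂ a₁ a₂ S ha hA hK r₁ h
  exact fun n p W₁ W₂ a₁ a₂ S ha A₁ A₂ hA R₁ R₂ Q K₁ K₂ hK r₁ h =>
    hle n p W₁ a₁ R₁ K₁ A₁ r₁ h W₂ R₂ a₂ S Q A₂ K₂ ha hA hK

end Sim

/-! ### Substitution and environments -/

/-- Substituting in a formula is the same as changing the values of its variables. -/
theorem den_bind (I : Interp L Var) {k : ℕ} (B : Formula L Var k) {m : ℕ}
    (f : Var ⊕ Fin k → Tm L Var m) {W : Type (max u w)} (e : W → Var ⊕ Fin m → Tm L Var 0) :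
    den I (B.bind f) e = den I B (fun w z => (f z).subst (e w)) := by
  induction B generalizing m W with
  | eq s t => simp [Formula.bind, den, term_subst_subst]
  | atom p ts => simp [Formula.bind, den, term_subst_subst]
  | conj B C ihB ihC => simp [Formula.bind, den, ihB, ihC]
  | disj B C ihB ihC => simp [Formula.bind, den, ihB, ihC]
  | neg B ihB => simp [Formula.bind, den, ihB]
  | ex B ihB => simp only [Formula.bind, den, ihB, ← underBinders_subst]
  | ifthen n B C ihB ihC => simp only [Formula.bind, den, ihB, ihC, ← underBinders_subst]

theorem denF_subst (I : Interp L Var) (σ : Subst L Var) (F : Formula L Var 0)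
    (e : W → Subst L Var) : denF I (F.subst σ) e = denF I F (fun w => σ.comp (e w)) := by
  rw [denF, Formula.subst_eq, den_bind, denF]
  congr 1
  funext w
  exact comp_env σ (e w)

theorem denBody_subst (I : Interp L Var) (σ : Subst L Var) (η : List (BodyElt L Var))
    (e : W → Subst L Var) (g : Goal W) :
    denBody I e g (η.map (BodyElt.subst σ)) = denBody I (fun w => σ.comp (e w)) g η := by
  induction η generalizing g with
  | nil => rfl
  | cons b η ih =>
    cases b with
    | fml F => simp [denBody, BodyElt.subst, ih, denF_subst]
    | cut => simp [denBody, BodyElt.subst, ih]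

theorem denClause_subst (I : Interp L Var) (σ : Subst L Var) (η : List (BodyElt L Var))
    (e : W → Subst L Var) (g k : Goal W) :
    denClause I e k g (η.map (BodyElt.subst σ)) = denClause I (fun w => σ.comp (e w)) k g η := by
  induction η generalizing g with
  | nil => rfl
  | cons b η ih =>
    cases b with
    | fml F => simp [denClause, BodyElt.subst, ih, denF_subst]
    | cut => simp [denClause, BodyElt.subst, denBody_subst]

theorem headSet_subst {n : ℕ} (a : W → Fin n → Tm L Var 0) (e : W → Subst L Var) (σ : Subst L Var)
    (c : Clause L Var) : headSet a e (c.subst σ) = headSet a (fun w => σ.comp (e w)) c := by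
  simp only [headSet, Clause.subst, substTm_substTm]

theorem denUsing_subst (I : Interp L Var) (σ : Subst L Var) {n : ℕ} (p : L.Relations n)
    (a : W → Fin n → Tm L Var 0) (γ : List (Clause L Var)) (e : W → Subst L Var) :
    denUsing I p a e (γ.map (Clause.subst σ)) =
      denUsing I p a (fun w => σ.comp (e w)) γ := by
  induction γ with
  | nil => rfl
  | cons c γ ih =>
    rw [List.map_cons, denUsing, ih, headSet_subst]
    simp only [Clause.subst, denClause_subst]
    rfl

theorem denStack_subst (I : Interp L Var) (σ : Subst L Var) (α : Stack L Var)
    (e : W → Subst L Var) :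
    denStack I e (Stack.subst σ α) = denStack I (fun w => σ.comp (e w)) α := by
  induction α with
  | nil => rfl
  | cons b α ih =>
    rw [Stack.subst_cons, denStack, ih, denStack]
    congr 1
    rcases b with F | ⟨p, s, γ⟩ | η
    · exact denF_subst I σ F e
    · simp only [StackElt.subst, denElt, denUsing_subst, substTm_substTm]
    · exact denBody_subst I σ η e _

theorem denStack_body (I : Interp L Var) (e : W → Subst L Var) (η : List (BodyElt L Var))
    (α : Stack L Var) :
    denStack I e (.body η :: α) = (denBody I e skip η).seq (denStack I e α) := rfl

theorem denStack_append (I : Interp L Var) (e : W → Subst L Var) (α β : Stack L Var) :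
    denStack I e (α ++ β) = (denStack I e α).seq (denStack I e β) := by
  induction α with
  | nil => rfl
  | cons b α ih =>
    rw [List.cons_append, denStack, ih]
    rfl

theorem denBody_noCuts (I : Interp L Var) (e : W → Subst L Var) (g : Goal W)
    (η₁ : List (Formula L Var 0)) : denBody I e g (noCuts η₁) =
      g.seq (denStack I e (goals η₁)) := by
  induction η₁ generalizing g with
  | nil => rfl
  | cons F η₁ ih => exact ih _

theorem denBody_cut (I : Interp L Var) (e : W → Subst L Var) (g : Goal W)
    (η₁ : List (Formula L Var 0)) (η₂ : List (BodyElt L Var)) :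
    denBody I e g (noCuts η₁ ++ .cut :: η₂) =
      (g.seq (denStack I e (goals η₁))).once.seq (denBody I e skip η₂) := by
  induction η₁ generalizing g with
  | nil => rfl
  | cons F η₁ ih => exact ih _

theorem denClause_noCuts (I : Interp L Var) (e : W → Subst L Var) (g k : Goal W)
    (η₁ : List (Formula L Var 0)) : denClause I e k g (noCuts η₁) =
      (g.seq (denStack I e (goals η₁))).orElse k := by
  induction η₁ generalizing g with
  | nil => rfl
  | cons F η₁ ih => exact ih _

theorem denClause_cut (I : Interp L Var) (e : W → Subst L Var) (g k : Goal W)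
    (η₁ : List (Formula L Var 0)) (η₂ : List (BodyElt L Var)) :
    denClause I e k g (noCuts η₁ ++ .cut :: η₂) =
      (g.seq (denStack I e (goals η₁))).cutThen (denBody I e skip η₂) k := by
  induction η₁ generalizing g with
  | nil => rfl
  | cons F η₁ ih => exact ih _

theorem denStack_eqGoals (I : Interp L Var) (e : W → Subst L Var) {n : ℕ}
    (s t : Fin n → Tm L Var 0) : denStack I e (eqGoals s t) =
      constrain {w | ∀ i, substTm (e w) (s i) = substTm (e w) (t i)} := by
  induction n with
  | zero => simp [eqGoals, denStack, ← constrain_univ, Set.ofPred_true]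
  | succ n ih =>
    have := ih (fun i => s i.succ) (fun i => t i.succ)
    rw [eqGoals] at this
    rw [eqGoals, List.ofFn_succ, denStack, this, denElt, denF, den, constrain_seq_constrain]
    congr 1
    ext w
    simp [Fin.forall_fin_succ, substTm_eq]

theorem headSet_mk {n : ℕ} {p : L.Relations n} (a : W → Fin n → Tm L Var 0) (e : W → Subst L Var)
    (t : Fin n → Tm L Var 0) (η : List (BodyElt L Var)) :
    headSet a e ⟨p, t, η⟩ = {w | ∀ i, a w i = substTm (e w) (t i)} := by
  ext w
  simp only [headSet, Set.mem_ofPred_eq]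
  exact ⟨fun h i => h i i rfl, fun h i j hij => by rw [h, Fin.ext hij]⟩

/-! ### From computations to denotations -/

section Soundness

variable [DecidableEq Var]

/-- `σ` is idempotent and neither changes nor introduces the variables in `D`. -/
def Good (D : Set Var) (σ : Subst L Var) : Prop :=
  σ.comp σ = σ ∧ (∀ x ∈ D, σ x = fvar x) ∧ ∀ x ∉ D, Disjoint (fvTm (σ x)) D

theorem good_fvar (D : Set Var) : Good D (fvar : Subst L Var) := by
  refine ⟨rfl, fun _ _ => rfl, fun x hx => ?_⟩
  rw [fvTm_fvar]
  exact Set.disjoint_singleton_left.2 hx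

theorem IsMGU.good [Infinite Var] {σ : Subst L Var} {s t : Tm L Var 0} (h : IsMGU σ s t)
    {D : Set Var} (hD : Disjoint D (fvTm s ∪ fvTm t)) : Good D σ := by
  refine ⟨h.2.2, fun x hx => h.eq_fvar (Set.disjoint_left.1 hD hx), fun x hx => ?_⟩
  by_cases hx' : x ∈ fvTm s ∪ fvTm t
  · exact Set.disjoint_left.2 fun z hz hzD => Set.disjoint_left.1 hD hzD (h.fv_subset hx' hz)
  · rw [h.eq_fvar hx', fvTm_fvar]
    exact Set.disjoint_singleton_left.2 hx

omit [DecidableEq Var] in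
theorem Subst.eq_fvar_of_notMem_dom {θ : Subst L Var} {x : Var} (h : x ∉ θ.dom) : θ x = fvar x :=
  not_not.1 h

omit [DecidableEq Var] in
theorem Subst.comp_of_notMem_dom {θ : Subst L Var} (σ : Subst L Var) {x : Var} (h : x ∉ θ.dom) :
    θ.comp σ x = σ x := by
  rw [Subst.comp_apply, Subst.eq_fvar_of_notMem_dom h, substTm_fvar]

/-- `σ` fixes the variables that it introduces. -/
theorem Good.fix {D : Set Var} {σ : Subst L Var} (h : Good D σ) {x y : Var} (hy : y ∈ fvTm (σ x)) :
    σ y = fvar y := by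
  have h1 : substTm σ (σ x) = substTm fvar (σ x) := by
    rw [substTm_id]
    exact congrFun h.1 x
  exact (substTm_eq_iff _).1 h1 y hy

theorem Good.fix_dom {θ σ : Subst L Var} (h : Good θ.dom σ) {x y : Var} (hx : x ∉ θ.dom)
    (hy : y ∈ fvTm (σ x)) : y ∉ (θ.comp σ).dom := by
  have hyD : y ∉ θ.dom := Set.disjoint_left.1 (h.2.2 x hx) hy
  rw [Subst.dom, Set.mem_ofPred_eq, not_not, Subst.comp_of_notMem_dom σ hyD, h.fix hy]

theorem Good.dom_subset {θ σ : Subst L Var} (h : Good θ.dom σ) : θ.dom ⊆ (θ.comp σ).dom := by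
  intro x hx hc
  rw [Subst.comp_apply] at hc
  -- `θ x` is a variable that `σ` maps to `x`, which is only possible for `x` itself
  generalize hr : θ x = r at hc
  induction r using tm_induction with
  | hv y =>
    rw [substTm_fvar] at hc
    by_cases hy : y ∈ θ.dom
    · rw [h.2.1 y hy] at hc
      exact hx (hr.trans hc)
    · have := h.2.2 y hy
      rw [hc, fvTm_fvar] at this
      exact Set.disjoint_singleton_left.1 this hx
  | hf f ts _ => cases hc

/-- After `σ`, the variables to be kept are those of the domain of `θσ`, which contains that of `θ`.
-/
theorem Good.comp {θ σ τ : Subst L Var} (h : Good θ.dom σ) (h' : Good (θ.comp σ).dom τ) :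
    Good θ.dom (σ.comp τ) := by
  have hsub := h.dom_subset
  have hdis : ∀ x ∉ θ.dom, Disjoint (fvTm (σ.comp τ x)) (θ.comp σ).dom := by
    intro x hx
    refine Set.disjoint_left.2 fun z hz hzD => ?_
    obtain ⟨y, hy, hzy⟩ := (mem_fvTm_substTm _ _ _).1 hz
    exact Set.disjoint_left.1 (h'.2.2 y (h.fix_dom hx hy)) hzy hzD
  have hfix : ∀ x ∈ θ.dom, σ.comp τ x = fvar x := fun x hx => by
    rw [Subst.comp_apply, h.2.1 x hx, substTm_fvar, h'.2.1 x (hsub hx)]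
  refine ⟨?_, hfix, fun x hx => (hdis x hx).mono_right hsub⟩
  funext x
  by_cases hx : x ∈ θ.dom
  · rw [Subst.comp_apply, hfix x hx, substTm_fvar, hfix x hx]
  · have h1 : substTm (σ.comp τ) (σ.comp τ x) = substTm τ (σ.comp τ x) := by
      refine substTm_congr _ fun y hy => ?_
      have hy1 : y ∉ (θ.comp σ).dom := Set.disjoint_left.1 (hdis x hx) hy
      have hy2 : σ y = fvar y := by
        rw [← Subst.comp_of_notMem_dom σ (fun hc => hy1 (hsub hc))]
        exact Subst.eq_fvar_of_notMem_dom hy1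
      rw [Subst.comp_apply, hy2, substTm_fvar]
    rw [Subst.comp_apply, h1, Subst.comp_apply, substTm_substTm, h'.1]

theorem Stack.subst_comp_of_disjoint {θ : Subst L Var} {α : Stack L Var}
    (h : Disjoint θ.dom (Stack.fv α)) (σ : Subst L Var) :
    Stack.subst (θ.comp σ) α = Stack.subst σ α :=
  Stack.subst_congr α fun _ hx => Subst.comp_of_notMem_dom σ (Set.disjoint_right.1 h hx)

theorem Good.disjoint_subst {θ σ : Subst L Var} (h : Good θ.dom σ) {α : Stack L Var}
    (hα : Disjoint θ.dom (Stack.fv α)) : Disjoint (θ.comp σ).dom (Stack.fv (Stack.subst σ α)) := by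
  refine Set.disjoint_right.2 fun y hy => ?_
  obtain ⟨x, hx, hy⟩ := Stack.mem_fv_subst σ α hy
  exact h.fix_dom (Set.disjoint_right.1 hα hx) hy

/-- The variables of `σ x` are in use when `θσ` and `x` are. -/
theorem Good.fv_subset {θ σ : Subst L Var} (h : Good θ.dom σ) {x y : Var} (hy : y ∈ fvTm (σ x)) :
    y = x ∨ y ∈ (θ.comp σ).vars := by
  by_cases hx : x ∈ θ.dom
  · rw [h.2.1 x hx, fvTm_fvar] at hy
    exact .inl hy
  · rw [← Subst.comp_of_notMem_dom σ hx] at hy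
    by_cases hx' : x ∈ (θ.comp σ).dom
    · exact .inr (.inr ⟨x, hx', hy⟩)
    · rw [Subst.eq_fvar_of_notMem_dom hx', fvTm_fvar] at hy
      exact .inl hy

omit [DecidableEq Var] in
theorem LiftRel.symm {W₁ W₂ : Type z} {S : W₁ → W₂ → Prop} {A₁ : Set W₁} {A₂ : Set W₂}
    (h : LiftRel S A₁ A₂) : LiftRel (fun w₂ w₁ => S w₁ w₂) A₂ A₁ := ⟨h.2, h.1⟩

omit [DecidableEq Var] in
theorem LiftRel.trans {W₁ W₂ W₃ : Type z} {S : W₁ → W₂ → Prop} {S' : W₂ → W₃ → Prop}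
    {S'' : W₁ → W₃ → Prop} {A₁ : Set W₁} {A₂ : Set W₂} {A₃ : Set W₃}
    (h : LiftRel S A₁ A₂) (h' : LiftRel S' A₂ A₃)
    (hS : ∀ w₁ w₂ w₃, S w₁ w₂ → S' w₂ w₃ → S'' w₁ w₃) : LiftRel S'' A₁ A₃ := by
  refine ⟨fun w₁ hw => ?_, fun w₃ hw => ?_⟩
  · obtain ⟨w₂, h2, h3⟩ := h.1 w₁ hw
    obtain ⟨w₃, h4, h5⟩ := h'.1 w₂ h2
    exact ⟨w₃, h4, hS _ _ _ h3 h5⟩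
  · obtain ⟨w₂, h2, h3⟩ := h'.2 w₃ hw
    obtain ⟨w₁, h4, h5⟩ := h.2 w₂ h2
    exact ⟨w₁, h4, hS _ _ _ h5 h3⟩

/-- On the variables in `X`, the substitution `τ` is the instance of `σ` by `δ`. -/
def Inst (X : Set Var) (σ τ δ : Subst L Var) : Prop := ∀ x ∈ X, τ x = substTm δ (σ x)

/-- The goal `g`, run from the set `A` of substitutions, has the result `ρ` of a computation that
starts with the substitution `θ`: it fails if `ρ` is failure; and if `ρ` is a substitution, then
this is `θσ` for some `σ` whose instances are, on the variables in `X`, the answer of `g`. No rule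
derives the other results. -/
def Outcome (X : Set Var) (θ : Subst L Var) (g : Goal (Subst L Var)) (A : Set (Subst L Var)) :
    Result L Var → Prop
  | .subst θ' => ∃ (σ : Subst L Var) (A' : Set (Subst L Var)), θ' = θ.comp σ ∧ Good θ.dom σ ∧
      g _ ret A (some A') ∧ LiftRel (Inst X σ) A' Set.univ
  | .fail => g _ ret A none
  | .flounder => False
  | .diverge => False

variable {X X' : Set Var} {θ : Subst L Var} {g h k : Goal (Subst L Var)} {A A' : Set (Subst L Var)}
  {ρ : Result L Var}

theorem Outcome.mono (hg : Outcome X' θ g A ρ) (hX : X ⊆ X') : Outcome X θ g A ρ := by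
  cases ρ with
  | subst θ' =>
    obtain ⟨σ, A', h1, h2, h3, h4⟩ := hg
    exact ⟨σ, A', h1, h2, h3, h4.mono fun _ _ h x hx => h x (hX hx)⟩
  | fail => exact hg
  | flounder => exact hg
  | diverge => exact hg

theorem Outcome.of_imp (hg : Outcome X θ g A ρ)
    (H : ∀ r, (r = none ↔ ρ = .fail) → g _ ret A r → h _ ret A' r) : Outcome X θ h A' ρ := by
  cases ρ with
  | subst θ' =>
    obtain ⟨σ, A', h1, h2, h3, h4⟩ := hg
    exact ⟨σ, A', h1, h2, H _ (by simp) h3, h4⟩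
  | fail => exact H _ (by simp) hg
  | flounder => exact hg
  | diverge => exact hg

theorem Outcome.cutThen_some (hg : g _ ret A (some A')) (hh : Outcome X θ h A' ρ) :
    Outcome X θ (g.cutThen h k) A ρ :=
  hh.of_imp fun _ _ hr => .inl ⟨A', hg, hr⟩

theorem Outcome.cutThen_none (hg : g _ ret A none) (hh : Outcome X θ k A ρ) :
    Outcome X θ (g.cutThen h k) A ρ :=
  hh.of_imp fun _ _ hr => .inr ⟨hg, hr⟩

theorem Outcome.orElse_left (hρ : ρ ≠ .fail) (hg : Outcome X θ g A ρ) :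
    Outcome X θ (g.orElse h) A ρ :=
  hg.of_imp fun _ h1 hr => .inl ⟨Option.ne_none_iff_exists'.1 fun h => hρ (h1.1 h), hr⟩

theorem Outcome.orElse_right (hg : Outcome X' θ g A .fail) (hh : Outcome X θ h A ρ) :
    Outcome X θ (g.orElse h) A ρ :=
  hh.of_imp fun _ _ hr => .inr ⟨hg, hr⟩

/-- Continue from a state that consists of the instances of `σ`. -/
theorem Outcome.resume {I : Interp L Var} (hI : InterpSim I I) {α : Stack L Var} {σ : Subst L Var}
    (hα : Stack.fv α ⊆ X) (hd : Disjoint θ.dom (Stack.fv α)) (hσ : Good θ.dom σ)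
    (hA : LiftRel (Inst X σ) A Set.univ) (hX : X ∪ (θ.comp σ).vars ⊆ X')
    (h : Disjoint (θ.comp σ).dom (Stack.fv (Stack.subst (θ.comp σ) α)) →
      Outcome X' (θ.comp σ) (denStack I id (Stack.subst (θ.comp σ) α)) Set.univ ρ) :
    Outcome X θ (denStack I id α) A ρ := by
  rw [Stack.subst_comp_of_disjoint hd] at h
  replace h := h (hσ.disjoint_subst hd)
  have hsim : GSim (fun δ τ => Inst X σ τ δ) (denStack I id (Stack.subst σ α))
      (denStack I id α) := by
    rw [denStack_subst]
    exact denStack_sim hI α fun δ τ hS x hx => (hS x (hα hx)).symm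
  cases ρ with
  | subst θ' =>
    obtain ⟨σ', A₂, h1, h2, h3, h4⟩ := h
    obtain ⟨A₃, h5, h6⟩ := (hsim hA.symm kSim_ret).some h3
    refine ⟨σ.comp σ', A₃, by rw [h1, Subst.comp_assoc], hσ.comp h2, h6, ?_⟩
    refine h5.symm.trans h4 fun τ δ δ' hτ hδ x hx => ?_
    rw [hτ x hx, Subst.comp_apply, substTm_substTm]
    refine substTm_congr _ fun y hy => hδ y (hX ?_)
    exact (hσ.fv_subset hy).elim (fun e => .inl (e ▸ hx)) .inr
  | fail => exact (hsim hA.symm kSim_ret).none h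
  | flounder => exact h
  | diverge => exact h

/-- The worlds with additional variables, whose values are given by `v.2`, in relation to the
substitutions in which these variables are named by `f`. -/
def FreshRel {ι : Type*} (X : Set Var) (f : ι → Var) (Y : Set ι) (τ : Subst L Var)
    (v : Subst L Var × (ι → Tm L Var 0)) : Prop :=
  (∀ x ∈ X, τ x = v.1 x) ∧ ∀ i ∈ Y, τ (f i) = v.2 i

omit [DecidableEq Var] in
theorem liftRel_freshRel {ι : Type*} {f : ι → Var} (hf : Function.Injective f) {Y : Set ι}
    (hY : ∀ i ∈ Y, f i ∉ X) :
    LiftRel (FreshRel (L := L) X f Y) Set.univ Set.univ := by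
  classical
  refine ⟨fun τ _ => ⟨(τ, fun i => τ (f i)), trivial, fun _ _ => rfl, fun _ _ => rfl⟩,
    fun v _ => ⟨fun z => if z ∈ X then v.1 z else Function.extend f v.2 v.1 z, trivial,
      fun x hx => if_pos hx, fun i hi => ?_⟩⟩
  exact (if_neg (hY i hi)).trans (hf.extend_apply _ _ _)

/-- A goal that hides additional variables has the outcomes of a goal in which these variables are
named. The relation `S` matches the two kinds of worlds. -/
theorem Outcome.hide {I : Interp L Var} (hI : InterpSim I I) {α : Stack L Var} {E : Type (max u w)}
    {S : Subst L Var → Subst L Var × E → Prop} (hS : ∀ τ v, S τ v → ∀ x ∈ X, τ x = v.1 x)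
    (hS' : LiftRel S Set.univ Set.univ) {g' : Goal (Subst L Var × E)} (hsim : GSim S g g')
    (hX : X ⊆ X') (hα : Stack.fv α ⊆ X)
    (h : Outcome X' θ (g.seq (denStack I id α)) Set.univ ρ) :
    Outcome X θ ((g'.hide Prod.fst).seq (denStack I id α)) Set.univ ρ := by
  have key := hsim hS' (K₁ := denStack I id α _ ret)
    (K₂ := fun A' => denStack I id α _ ret (Prod.fst '' A'))
    (Q := LiftRel fun τ τ' : Subst L Var => ∀ x ∈ X, τ x = τ' x) (fun A₁ A₂ hA => by
      have h1 := hA.image (f₁ := id) (f₂ := Prod.fst)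
        (S := fun τ τ' : Subst L Var => ∀ x ∈ X, τ x = τ' x) hS
      rw [Set.image_id] at h1
      exact denStack_sim hI α (fun w₁ w₂ hS x hx => hS x (hα hx)) h1 kSim_ret)
  cases ρ with
  | subst θ' =>
    obtain ⟨σ, A₁, h1, h2, h3, h4⟩ := h
    obtain ⟨A₂, h5, h6⟩ := key.some h3
    refine ⟨σ, A₂, h1, h2, h6, h5.symm.trans h4 fun τ' τ δ h7 h8 x hx => ?_⟩
    rw [← h7 x hx, h8 x (hX hx)]
  | fail => exact key.none h
  | flounder => exact h
  | diverge => exact h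

/-- A formula whose bound variables are given names is matched by the formula under its binder. -/
theorem denF_inst_sim {I : Interp L Var} (hI : InterpSim I I) {n : ℕ} (B : Formula L Var (0 + n))
    {xs : Fin n → Var} {W : Type (max u w)} {e : W → Subst L Var}
    {S : Subst L Var → W × (Fin n → Tm L Var 0) → Prop}
    (hS : ∀ τ v, S τ v → (∀ x ∈ B.fv, τ x = e v.1 x) ∧ ∀ i, τ (xs i) = v.2 i) :
    GSim S (denF I (B.inst xs) id)
      (den I B (fun v : W × (Fin n → Tm L Var 0) => extEnv (e v.1).env v.2)) := by
  rw [denF, Formula.inst_eq, den_bind]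
  refine den_sim hI B fun τ v h => ⟨fun x hx => (hS τ v h).1 x hx, fun j => ?_⟩
  induction j using Fin.addCases with
  | left j => exact j.elim0
  | right j =>
    rw [extEnv_natAdd, extEnv_natAdd]
    exact (hS τ v h).2 j

omit [DecidableEq Var] in
theorem denUsing_cons (I : Interp L Var) {W : Type (max u w)} {n : ℕ} (p : L.Relations n)
    (a : W → Fin n → Tm L Var 0) (e : W → Subst L Var) (t : Fin n → Tm L Var 0)
    (η : List (BodyElt L Var)) (γ : List (Clause L Var)) :
    denUsing I p a e (⟨p, t, η⟩ :: γ) = denClause I e (denUsing I p a e γ)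
      (constrain {w | ∀ i, a w i = substTm (e w) (t i)}) η := by
  rw [← headSet_mk (p := p) a e t η]
  funext R K A r
  rw [denUsing]
  exact propext ⟨fun h => h.2, fun h => ⟨rfl, h⟩⟩

theorem subset_inUse {V : Set Var} {θ : Subst L Var} {α : Stack L Var} : V ⊆ inUse V θ α :=
  fun _ h => .inl (.inl h)

theorem fv_subset_inUse {V : Set Var} {θ : Subst L Var} {α : Stack L Var} :
    Stack.fv α ⊆ inUse V θ α := fun _ h => .inr h

theorem vars_subset_inUse {V : Set Var} {θ : Subst L Var} {α : Stack L Var} :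
    θ.vars ⊆ inUse V θ α := fun _ h => .inl (.inr h)

theorem programFv_cons (c : Clause L Var) (γ : List (Clause L Var)) :
    Program.fv (c :: γ) = c.fv ∪ Program.fv γ := by
  ext x
  simp [Program.fv]

theorem bodyFv_cons (b : BodyElt L Var) (η : List (BodyElt L Var)) :
    bodyFv (b :: η) = b.fv ∪ bodyFv η := by
  ext x
  simp [bodyFv]

theorem bodyFv_append (η η' : List (BodyElt L Var)) :
    bodyFv (η ++ η') = bodyFv η ∪ bodyFv η' := by
  induction η with
  | nil =>
    ext x
    simp [bodyFv]
  | cons b η ih => rw [List.cons_append, bodyFv_cons, ih, bodyFv_cons, Set.union_assoc]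

theorem fv_goals (η : List (Formula L Var 0)) : Stack.fv (goals η) = bodyFv (noCuts η) := by
  ext x
  simp [Stack.fv, goals, bodyFv, noCuts, StackElt.fv, BodyElt.fv]

theorem fv_eqGoals {n : ℕ} (s t : Fin n → Tm L Var 0) :
    Stack.fv (eqGoals s t) = (⋃ i, fvTm (s i)) ∪ ⋃ i, fvTm (t i) := by
  ext x
  simp [Stack.fv, eqGoals, List.mem_ofFn, StackElt.fv, Formula.fv, exists_or]

theorem fv_using_cons {n : ℕ} {p : L.Relations n} (s t : Fin n → Tm L Var 0)
    (η : List (BodyElt L Var)) (γ : List (Clause L Var)) :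
    StackElt.fv (.using p s (⟨p, t, η⟩ :: γ)) =
      (⋃ i, fvTm (s i)) ∪ ((⋃ i, fvTm (t i)) ∪ bodyFv η ∪ Program.fv γ) := by
  rw [StackElt.fv, programFv_cons]
  rfl

theorem fv_body_cut (η₁ : List (Formula L Var 0)) (η₂ : List (BodyElt L Var)) :
    bodyFv (noCuts η₁ ++ .cut :: η₂) = bodyFv (noCuts η₁) ∪ bodyFv η₂ := by
  rw [bodyFv_append, bodyFv_cons]
  simp [BodyElt.fv]

set_option maxHeartbeats 1000000 in
/-- Computations agree with the denotational semantics. -/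
theorem Comp.outcome [Infinite Var] {P : Program L Var} {V : Set Var} {θ : Subst L Var}
    {α : Stack L Var} {ρ : Result L Var} (h : Comp P V θ α ρ) (hd : Disjoint θ.dom (Stack.fv α)) :
    Outcome (inUse V θ α) θ (denStack (sem P) id α) Set.univ ρ := by
  have hI := sem_sim P
  -- the premise that continues after a committed choice with the answer `θ'`
  have commit : ∀ {V X : Set Var} {θ θ' : Subst L Var} {g : Goal (Subst L Var)} {α' : Stack L Var}
      {ρ : Result L Var}, Outcome X θ g Set.univ (.subst θ') →
      Stack.fv α' ⊆ X → Disjoint θ.dom (Stack.fv α') → X ⊆ V →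
      (Disjoint θ'.dom (Stack.fv (Stack.subst θ' α')) →
        Outcome (inUse V θ' (Stack.subst θ' α')) θ' (denStack (sem P) id (Stack.subst θ' α'))
          Set.univ ρ) →
      ∀ k, Outcome X θ (g.cutThen (denStack (sem P) id α') k) Set.univ ρ := by
    rintro V X θ θ' g α' ρ ⟨σ, A', rfl, h2, h3, h4⟩ hα hd hV h k
    exact Outcome.cutThen_some h3 (Outcome.resume hI hα hd h2 h4
      (Set.union_subset (hV.trans subset_inUse) vars_subset_inUse) h)
  induction h with
  | @unif_succ V θ α ρ s t σ hσ _ ih =>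
    rw [Stack.fv_cons, Set.disjoint_union_right] at hd
    have hg : Good θ.dom σ := hσ.good hd.1
    rw [← Stack.subst_comp_of_disjoint hd.2 σ] at ih
    -- the unifiers of `s` and `t` are the instances of `σ`
    have hA : LiftRel (Inst (inUse V θ (.fml (.eq s t) :: α)) σ)
        (Set.univ ∩ {τ : Subst L Var | substTm τ s = substTm τ t}) Set.univ := by
      refine ⟨fun τ hτ => ⟨τ, trivial, fun x _ => ?_⟩, fun δ _ => ⟨σ.comp δ, ⟨trivial, ?_⟩,
        fun _ _ => rfl⟩⟩
      · obtain ⟨δ, rfl⟩ := hσ.2.1 τ hτ.2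
        rw [← Subst.comp_apply σ, ← Subst.comp_assoc, hσ.2.2]
      · rw [Set.mem_ofPred_eq, ← substTm_substTm, ← substTm_substTm, hσ.1]
    have key := Outcome.resume hI (fun x hx => fv_subset_inUse (by simp [hx])) hd.2 hg hA
      (Set.union_subset subset_inUse vars_subset_inUse) ih
    refine key.of_imp fun r _ hr => .inr ⟨fun h => ?_, hr⟩
    exact absurd h (Set.Nonempty.ne_empty ((hA.2 σ trivial).imp fun _ h => h.1))
  | @unif_fail V θ α s t hn =>
    refine .inl ⟨Set.eq_empty_of_forall_notMem fun τ hτ => hn ⟨τ, hτ.2⟩, ?_, rfl⟩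
    exact (Set.nonempty_of_mem (Set.mem_univ (fvar : Subst L Var))).ne_empty
  | @success V θ =>
    exact ⟨fvar, Set.univ, by simp, good_fvar _, rfl,
      fun τ _ => ⟨τ, trivial, fun _ _ => rfl⟩, fun τ _ => ⟨τ, trivial, fun _ _ => rfl⟩⟩
  | @conj V θ α ρ B C _ ih =>
    refine Outcome.mono (ih ?_) subset_inUse
    simpa [Formula.fv, StackElt.fv, Set.union_assoc] using hd
  | @disj_nofail V θ α ρ B C hρ _ ih =>
    refine (Outcome.orElse_left hρ (ih ?_)).mono subset_inUse
    exact hd.mono_right fun x hx => by simp [StackElt.fv, Formula.fv] at hx ⊢; tauto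
  | @disj_fail V θ α ρ B C _ _ ihB ihC =>
    refine (Outcome.orElse_right (ihB ?_) (ihC ?_)).mono subset_inUse
    all_goals exact hd.mono_right fun x hx => by simp [StackElt.fv, Formula.fv] at hx ⊢; tauto
  | @exists_ V θ α ρ B x' hx' _ ih =>
    have hfr : ∀ i : Fin 1, i ∈ Set.univ → (fun _ : Fin 1 => x') i ∉
        inUse V θ (.fml (.ex B) :: α) := fun _ _ => hx'
    have hα : Stack.fv α ⊆ inUse V θ (.fml (.ex B) :: α) := fun x hx =>
      fv_subset_inUse (by simp [hx])
    have hB : B.fv ⊆ inUse V θ (.fml (.ex B) :: α) := fun x hx =>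
      fv_subset_inUse (by simp [StackElt.fv, Formula.fv, hx])
    refine Outcome.hide hI (fun τ v h => h.1) (liftRel_freshRel
      (Function.injective_of_subsingleton _) hfr)
      (denF_inst_sim hI B fun τ v h => ⟨fun x hx => h.1 x (hB hx), fun i => h.2 i trivial⟩)
      subset_inUse hα (ih ?_)
    refine Set.disjoint_left.2 fun x hx hx2 => ?_
    rw [Stack.fv_cons] at hx2
    rcases hx2 with hx2 | hx2
    · rcases Formula.mem_fv_inst _ _ hx2 with hx2 | ⟨_, rfl⟩
      · exact Set.disjoint_left.1 hd hx (by simp [StackElt.fv, Formula.fv, hx2])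
      · exact hx' (vars_subset_inUse (.inl hx))
    · exact Set.disjoint_left.1 hd hx (by simp [hx2])
  | @not_succ V θ α B θ' _ ih =>
    obtain ⟨σ, A', -, -, h, -⟩ := ih
      (hd.mono_right fun x hx => by simp [StackElt.fv, Formula.fv] at hx ⊢; tauto)
    exact .inl ⟨A', h, rfl⟩
  | @not_fail V θ α ρ B _ _ ihB ih =>
    refine (Outcome.cutThen_none (ihB ?_) (ih ?_)).mono subset_inUse
    all_goals exact hd.mono_right fun x hx => by simp [StackElt.fv, Formula.fv] at hx ⊢; tauto
  | @if_succ V θ α ρ n B C xs θ' hinj hxs _ _ ihB ihC =>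
    have hα : Stack.fv α ⊆ inUse V θ (.fml (.ifthen n B C) :: α) := fun x hx =>
      fv_subset_inUse (by simp [hx])
    have hB : B.fv ⊆ inUse V θ (.fml (.ifthen n B C) :: α) := fun x hx =>
      fv_subset_inUse (by simp [StackElt.fv, Formula.fv, hx])
    have hC : C.fv ⊆ inUse V θ (.fml (.ifthen n B C) :: α) := fun x hx =>
      fv_subset_inUse (by simp [StackElt.fv, Formula.fv, hx])
    have hdC : Disjoint θ.dom (Stack.fv (.fml (C.inst xs) :: α)) := by
      refine Set.disjoint_left.2 fun x hx hx2 => ?_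
      rw [Stack.fv_cons] at hx2
      rcases hx2 with hx2 | hx2
      · rcases Formula.mem_fv_inst _ _ hx2 with hx2 | ⟨i, rfl⟩
        · exact Set.disjoint_left.1 hd hx (by simp [StackElt.fv, Formula.fv, hx2])
        · exact hxs i (vars_subset_inUse (.inl hx))
      · exact Set.disjoint_left.1 hd hx (by simp [hx2])
    have hdB : Disjoint θ.dom (Stack.fv [.fml (B.inst xs)]) := by
      refine Set.disjoint_left.2 fun x hx hx2 => ?_
      rw [Stack.fv_cons, Stack.fv_nil, Set.union_empty] at hx2
      rcases Formula.mem_fv_inst _ _ hx2 with hx2 | ⟨i, rfl⟩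
      · exact Set.disjoint_left.1 hd hx (by simp [StackElt.fv, Formula.fv, hx2])
      · exact hxs i (vars_subset_inUse (.inl hx))
    have hfvC : Stack.fv (.fml (C.inst xs) :: α) ⊆
        inUse V θ (.fml (.ifthen n B C) :: α) ∪ Set.range xs := by
      rw [Stack.fv_cons]
      rintro x (hx | hx)
      · rcases Formula.mem_fv_inst _ _ hx with hx | ⟨i, rfl⟩
        · exact .inl (hC hx)
        · exact .inr ⟨i, rfl⟩
      · exact .inl (hα hx)
    refine Outcome.hide hI (fun τ v h => h.1) (liftRel_freshRel (Y := Set.univ) hinj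
      fun i _ => hxs i)
      ((denF_inst_sim hI B fun τ v h =>
        ⟨fun x hx => h.1 x (hB hx), fun i => h.2 i trivial⟩).once.seq
        (denF_inst_sim hI C fun τ v h => ⟨fun x hx => h.1 x (hC hx), fun i => h.2 i trivial⟩))
      Set.subset_union_left hα
      (commit ((ihB hdB).mono subset_inUse) hfvC hdC subset_rfl ihC .fail)
  | @if_fail V θ α n B C xs hinj hxs _ ih =>
    have hα : Stack.fv α ⊆ inUse V θ (.fml (.ifthen n B C) :: α) := fun x hx =>
      fv_subset_inUse (by simp [hx])
    have hB : B.fv ⊆ inUse V θ (.fml (.ifthen n B C) :: α) := fun x hx =>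
      fv_subset_inUse (by simp [StackElt.fv, Formula.fv, hx])
    have hC : C.fv ⊆ inUse V θ (.fml (.ifthen n B C) :: α) := fun x hx =>
      fv_subset_inUse (by simp [StackElt.fv, Formula.fv, hx])
    refine Outcome.hide hI (fun τ v h => h.1) (liftRel_freshRel (Y := Set.univ) hinj
      fun i _ => hxs i)
      ((denF_inst_sim hI B fun τ v h =>
        ⟨fun x hx => h.1 x (hB hx), fun i => h.2 i trivial⟩).once.seq
        (denF_inst_sim hI C fun τ v h => ⟨fun x hx => h.1 x (hC hx), fun i => h.2 i trivial⟩))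
      (X' := inUse V θ (.fml (.ifthen n B C) :: α) ∪ Set.range xs)
      Set.subset_union_left hα
      (Outcome.cutThen_none (h := (denF (sem P) (C.inst xs) id).seq (denStack (sem P) id α))
        (k := .fail) (ih ?_) rfl)
    refine Set.disjoint_left.2 fun x hx hx2 => ?_
    rw [Stack.fv_cons, Stack.fv_nil, Set.union_empty] at hx2
    rcases Formula.mem_fv_inst _ _ hx2 with hx2 | ⟨i, rfl⟩
    · exact Set.disjoint_left.1 hd hx (by simp [StackElt.fv, Formula.fv, hx2])
    · exact hxs i (vars_subset_inUse (.inl hx))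
  | @pred V θ α ρ n p s π hπ _ ih =>
    have hα : Stack.fv α ⊆ inUse V θ (.fml (.atom p s) :: α) := fun x hx =>
      fv_subset_inUse (by simp [hx])
    have hs : ∀ i, fvTm (s i) ⊆ inUse V θ (.fml (.atom p s) :: α) := fun i x hx =>
      fv_subset_inUse (by rw [Stack.fv_cons]; exact .inl (Set.mem_iUnion.2 ⟨i, hx⟩))
    have hfr : ∀ y ∈ Program.fv (clausesOf p P), π y ∉ inUse V θ (.fml (.atom p s) :: α) := by
      intro y hy
      have h1 : (renameBy π : Subst L Var).comp (renameBy π.symm) = fvar := by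
        funext x
        simp [Subst.comp_apply, renameBy]
      rw [← map_clauseSubst_id (clausesOf p P), ← h1, ← programSubst_subst] at hy
      obtain ⟨z, hz, hy⟩ := mem_programFv_subst _ _ hy
      rw [renameBy, fvTm_fvar, Set.mem_singleton_iff] at hy
      rw [hy, Equiv.apply_symm_apply]
      exact Set.disjoint_left.1 hπ hz
    have hcall : denElt (sem P) id (.fml (.atom p s)) =
        call (sem P) p (fun τ i => substTm τ (s i)) := rfl
    have hsim : GSim (FreshRel (inUse V θ (.fml (.atom p s) :: α)) π (Program.fv (clausesOf p P)))
        (denElt (sem P) id (.using p s ((clausesOf p P).map (Clause.subst (renameBy π)))))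
        (denUsing (sem P) p (fun v i => substTm v.1 (s i)) (fun v => v.2) (clausesOf p P)) := by
      rw [denElt, denUsing_subst]
      refine denUsing_sim hI p _ (fun τ v h => ?_) fun τ v h x hx => h.2 x hx
      funext i
      exact substTm_congr _ fun x hx => h.1 x (hs i hx)
    have key := Outcome.hide hI (fun τ v h => h.1) (liftRel_freshRel π.injective hfr) hsim
      subset_inUse hα (ih ?_)
    · refine key.of_imp fun r _ hr => ?_
      rw [denStack, hcall]
      refine ⟨_, fun _ _ h => h, ?_⟩
      rw [sem_apply]
      exact hr
    · rw [Stack.fv_cons, StackElt.fv, Set.disjoint_union_right, Set.disjoint_union_right]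
      rw [Stack.fv_cons, Set.disjoint_union_right] at hd
      exact ⟨⟨hd.1, Set.disjoint_left.2 fun x hx hx2 =>
        Set.disjoint_left.1 hπ hx2 (vars_subset_inUse (.inl hx))⟩, hd.2⟩
  | @using_cut_succ V θ α ρ n p s t η₁ η₂ γ θ' _ _ ih₁ ih₂ =>
    rw [Stack.fv_cons, fv_using_cons, fv_body_cut] at hd
    rw [denStack, denElt, denUsing_cons, denClause_cut, cutThen_seq, ← denStack_body]
    have h1 := ih₁ (hd.mono_right fun x hx => by
      rw [Stack.fv_append, fv_eqGoals, fv_goals] at hx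
      simp only [Set.mem_union] at hx ⊢
      tauto)
    rw [denStack_append, denStack_eqGoals] at h1
    refine commit (α' := .body η₂ :: α) (h1.mono subset_inUse) ?_ ?_ subset_rfl ih₂ _
    · refine Set.Subset.trans (fun x hx => ?_) fv_subset_inUse
      rw [Stack.fv_cons, fv_using_cons, fv_body_cut]
      simp only [Stack.fv_cons, StackElt.fv, Set.mem_union] at hx ⊢
      tauto
    · refine hd.mono_right fun x hx => ?_
      simp only [Stack.fv_cons, StackElt.fv, Set.mem_union] at hx ⊢
      tauto
  | @using_cut_fail V θ α ρ n p s t η₁ η₂ γ _ _ ih₁ ih₂ =>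
    rw [Stack.fv_cons, fv_using_cons, fv_body_cut] at hd
    rw [denStack, denElt, denUsing_cons, denClause_cut, cutThen_seq, ← denStack_body]
    have h1 := ih₁ (hd.mono_right fun x hx => by
      rw [Stack.fv_append, fv_eqGoals, fv_goals] at hx
      simp only [Set.mem_union] at hx ⊢
      tauto)
    rw [denStack_append, denStack_eqGoals] at h1
    refine Outcome.cutThen_none h1 ((ih₂ ?_).mono subset_inUse)
    refine hd.mono_right fun x hx => ?_
    simp only [Stack.fv_cons, StackElt.fv, Set.mem_union] at hx ⊢
    tauto
  | @using_nocut_succ V θ α n p s t η γ θ' _ ih =>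
    rw [Stack.fv_cons, fv_using_cons] at hd
    rw [denStack, denElt, denUsing_cons, denClause_noCuts, orElse_seq]
    have h1 := ih (hd.mono_right fun x hx => by
      rw [Stack.fv_append, Stack.fv_append, fv_eqGoals, fv_goals] at hx
      simp only [Set.mem_union] at hx ⊢
      tauto)
    rw [denStack_append, denStack_append, denStack_eqGoals] at h1
    exact Outcome.orElse_left (by simp) (h1.mono subset_inUse)
  | @using_nocut_fail V θ α ρ n p s t η γ _ _ ih₁ ih₂ =>
    rw [Stack.fv_cons, fv_using_cons] at hd
    rw [denStack, denElt, denUsing_cons, denClause_noCuts, orElse_seq]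
    have h1 := ih₁ (hd.mono_right fun x hx => by
      rw [Stack.fv_append, Stack.fv_append, fv_eqGoals, fv_goals] at hx
      simp only [Set.mem_union] at hx ⊢
      tauto)
    rw [denStack_append, denStack_append, denStack_eqGoals] at h1
    refine Outcome.orElse_right h1 ((ih₂ ?_).mono subset_inUse)
    refine hd.mono_right fun x hx => ?_
    simp only [Stack.fv_cons, StackElt.fv, Set.mem_union] at hx ⊢
    tauto
  | @using_empty V θ α n p s => exact rfl
  | @body_cut_succ V θ α ρ η₁ η₂ θ' _ _ ih₁ ih₂ =>
    rw [Stack.fv_cons, StackElt.fv, fv_body_cut] at hd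
    rw [denStack, denElt, denBody_cut, ← cutThen_fail]
    have h1 := ih₁ (hd.mono_right fun x hx => by
      rw [fv_goals] at hx
      simp only [Set.mem_union] at hx ⊢
      tauto)
    rw [cutThen_seq, ← denStack_body]
    refine commit (α' := .body η₂ :: α) (h1.mono subset_inUse) ?_ ?_ subset_rfl ih₂ .fail
    · refine Set.Subset.trans (fun x hx => ?_) fv_subset_inUse
      simp only [Stack.fv_cons, StackElt.fv, fv_body_cut, Set.mem_union] at hx ⊢
      tauto
    · refine hd.mono_right fun x hx => ?_
      simp only [Stack.fv_cons, StackElt.fv, Set.mem_union] at hx ⊢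
      tauto
  | @body_cut_fail V θ α η₁ η₂ _ ih =>
    rw [Stack.fv_cons, StackElt.fv, fv_body_cut] at hd
    rw [denStack, denElt, denBody_cut, ← cutThen_fail]
    have h1 := ih (hd.mono_right fun x hx => by
      rw [fv_goals] at hx
      simp only [Set.mem_union] at hx ⊢
      tauto)
    exact .inr ⟨h1, rfl⟩
  | @body_nocut V θ α ρ η _ ih =>
    rw [Stack.fv_cons, StackElt.fv] at hd
    rw [denStack, denElt, denBody_noCuts]
    have h1 := ih (hd.mono_right fun x hx => by
      rw [Stack.fv_append, fv_goals] at hx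
      exact hx)
    rw [denStack_append] at h1
    exact h1.mono subset_inUse

end Soundness

/-! ### From denotations to computations -/

section Completeness

variable [DecidableEq Var]

/-- There is a computation of `θ : α` with the result `r`: a failure if `r` is `none`, and a
substitution that stands for the answer `x` in the sense of `M` if `r` is `some x`. -/
def Run (P : Program L Var) {R : Type z} (M : R → Subst L Var → Prop) (V : Set Var)
    (θ : Subst L Var) (α : Stack L Var) : Option R → Prop
  | none => Comp P V θ α .fail
  | some x => ∃ θ', M x θ' ∧ Comp P V θ α (.subst θ')

theorem Run.map {P : Program L Var} {R : Type z} {M : R → Subst L Var → Prop} {V V' : Set Var}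
    {θ θ' : Subst L Var} {α α' : Stack L Var} {r : Option R} (h : Run P M V θ α r)
    (H : ∀ ρ, Comp P V θ α ρ → Comp P V' θ' α' ρ) : Run P M V' θ' α' r := by
  cases r with
  | none => exact H _ h
  | some x => exact h.imp fun _ h => ⟨h.1, H _ h.2⟩

variable {W : Type (max u w)}

/-- A relation between worlds and substitutions, composed with `σ`: the substitutions are those that
come after `σ`. -/
def after (S : W → Subst L Var → Prop) (σ : Subst L Var) (w : W) (δ : Subst L Var) : Prop :=
  S w (σ.comp δ)

omit [DecidableEq Var] in
theorem after_after (S : W → Subst L Var → Prop) (σ τ : Subst L Var) :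
    after (after S σ) τ = after S (σ.comp τ) := by
  funext w δ
  simp only [after, Subst.comp_assoc]

/-- The continuation `K` is realized by computations of the goal stack `α`, where worlds are related
to substitutions by `S`: whatever `K` yields after a substitution `σ` has been found, so does some
computation of `θσ : ασ`. -/
def KReal (P : Program L Var) {R : Type z} (M : R → Subst L Var → Prop)
    (S : W → Subst L Var → Prop) (θ : Subst L Var) (α : Stack L Var)
    (K : Set W → Option R → Prop) : Prop :=
  ∀ (V : Set Var) (σ : Subst L Var) (A : Set W) (r : Option R), V.Finite → σ.dom.Finite →
    Good θ.dom σ → LiftRel (after S σ) A Set.univ → K A r →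
    Run P M V (θ.comp σ) (Stack.subst σ α) r

/-- The goal `g` is realized by computations of the stack elements `β`. -/
def Realizes (P : Program L Var) (S : W → Subst L Var → Prop) (g : Goal W) (β : Stack L Var) :
    Prop :=
  ∀ (V : Set Var) (σ θ : Subst L Var) (α : Stack L Var) (R : Type (max u w))
    (M : R → Subst L Var → Prop) (K : Set W → Option R → Prop) (A : Set W) (r : Option R),
    V.Finite → σ.dom.Finite → θ.dom.Finite →
    Disjoint θ.dom (Stack.fv (Stack.subst σ β ++ α)) → LiftRel (after S σ) A Set.univ →
    KReal P M (after S σ) θ α K → g R K A r → Run P M V θ (Stack.subst σ β ++ α) r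

variable {P : Program L Var} {S : W → Subst L Var → Prop} {g h k : Goal W} {β β' : Stack L Var}

omit [DecidableEq Var] in
theorem dom_fvar_finite : (Subst.dom (fvar : Subst L Var)).Finite := by
  convert Set.finite_empty
  ext
  simp [Subst.dom]

theorem KReal.start {R : Type z} {M : R → Subst L Var → Prop} {θ : Subst L Var} {α : Stack L Var}
    {K : Set W → Option R → Prop} (hK : KReal P M S θ α K) {V : Set Var} (hV : V.Finite) {A : Set W}
    {r : Option R} (hA : LiftRel S A Set.univ) (hr : K A r) : Run P M V θ α r := by
  simpa using hK V fvar A r hV dom_fvar_finite (good_fvar _) hA hr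

theorem KReal.after {R : Type z} {M : R → Subst L Var → Prop} {θ σ : Subst L Var} {α : Stack L Var}
    {K : Set W → Option R → Prop} (hK : KReal P M S θ α K) (hσ : σ.dom.Finite)
    (hg : Good θ.dom σ) : KReal P M (after S σ) (θ.comp σ) (Stack.subst σ α) K := by
  intro V τ A r hV hτ hg' hA hr
  rw [after_after] at hA
  rw [Stack.subst_subst, Subst.comp_assoc]
  exact hK V _ A r hV (Subst.dom_comp_finite hσ hτ) (hg.comp hg') hA hr

/-- The substitution `θ'` found by a computation that started with `θ` stands for the answer `A`. -/
def Answer (S : W → Subst L Var → Prop) (θ : Subst L Var) (A : Set W) (θ' : Subst L Var) : Prop :=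
  ∃ σ, θ' = θ.comp σ ∧ σ.dom.Finite ∧ Good θ.dom σ ∧ LiftRel (CutLP.after S σ) A Set.univ

theorem kReal_ret (P : Program L Var) (S : W → Subst L Var → Prop) (θ : Subst L Var) :
    KReal P (Answer S θ) S θ [] ret := by
  rintro V σ A r hV hσ hg hA rfl
  exact ⟨θ.comp σ, ⟨σ, rfl, hσ, hg, hA⟩, .success⟩

theorem Realizes.run (hg : Realizes P S g β) {V : Set Var} {σ θ : Subst L Var} {A : Set W}
    {r : Option (Set W)} (hV : V.Finite) (hσ : σ.dom.Finite) (hθ : θ.dom.Finite)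
    (hd : Disjoint θ.dom (Stack.fv (Stack.subst σ β))) (hA : LiftRel (after S σ) A Set.univ)
    (hr : g _ ret A r) : Run P (Answer (after S σ) θ) V θ (Stack.subst σ β) r := by
  have := hg V σ θ [] _ _ _ A r hV hσ hθ (by rwa [List.append_nil]) hA (kReal_ret P _ θ) hr
  rwa [List.append_nil] at this

theorem Realizes.skip : Realizes P S skip [] :=
  fun _ _ _ _ _ _ _ _ _ hV _ _ _ hA hK hr => hK.start hV hA hr

theorem Realizes.seq (hg : Realizes P S g β) (hh : Realizes P S h β') :
    Realizes P S (g.seq h) (β ++ β') := by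
  intro V σ θ α R M K A r hV hσ hθ hd hA hK hr
  rw [Stack.subst_append, List.append_assoc] at hd ⊢
  refine hg V σ θ _ R M (h R K) A r hV hσ hθ hd hA ?_ hr
  intro V' τ A' r' hV' hτ hgood hA' hr'
  rw [Stack.subst_append, Stack.subst_subst]
  refine hh V' (σ.comp τ) (θ.comp τ) _ R M K A' r' hV' (Subst.dom_comp_finite hσ hτ)
    (Subst.dom_comp_finite hθ hτ) ?_ (by rwa [after_after] at hA') ?_ hr'
  · rw [← Stack.subst_subst, ← Stack.subst_append]
    refine hgood.disjoint_subst (hd.mono_right ?_)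
    rw [Stack.fv_append (Stack.subst σ β)]
    exact Set.subset_union_right
  · rw [← after_after]
    exact hK.after hτ hgood

/-- Continue a computation after the substitution `θ'` has been found by a committed choice. -/
theorem Realizes.resume (hh : Realizes P S h β) {V : Set Var} {σ θ θ' : Subst L Var}
    {α : Stack L Var} {R : Type (max u w)} {M : R → Subst L Var → Prop}
    {K : Set W → Option R → Prop} {A : Set W} {r : Option R} (hV : V.Finite) (hσ : σ.dom.Finite)
    (hθ : θ.dom.Finite) (hd : Disjoint θ.dom (Stack.fv (Stack.subst σ β ++ α)))
    (hK : KReal P M (after S σ) θ α K) (hA : Answer (after S σ) θ A θ') (hr : h R K A r) :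
    Run P M V θ' (Stack.subst θ' (Stack.subst σ β ++ α)) r := by
  obtain ⟨τ, rfl, hτ, hgood, hA⟩ := hA
  rw [Stack.subst_comp_of_disjoint hd, Stack.subst_append, Stack.subst_subst]
  refine hh V (σ.comp τ) (θ.comp τ) _ R M K A r hV (Subst.dom_comp_finite hσ hτ)
    (Subst.dom_comp_finite hθ hτ) ?_ (by rwa [after_after] at hA) ?_ hr
  · rw [← Stack.subst_subst, ← Stack.subst_append]
    exact hgood.disjoint_subst hd
  · rw [← after_after]
    exact hK.after hτ hgood

/-- The values of `s` and `t` agree in the worlds related to `δ` if and only if `δ` unifies `s` and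
`t`. -/
theorem Realizes.eq [Infinite Var] {a b : W → Tm L Var 0} {s t : Tm L Var 0}
    (ha : ∀ w δ, S w δ → a w = substTm δ s) (hb : ∀ w δ, S w δ → b w = substTm δ t) :
    Realizes P S (constrain {w | a w = b w}) [.fml (.eq s t)] := by
  intro V σ θ α R M K A r hV hσ hθ hd hA hK hr
  have hmem : ∀ w δ, after S σ w δ →
      (w ∈ {w | a w = b w} ↔ IsUnifier δ (substTm σ s) (substTm σ t)) := by
    intro w δ hS
    rw [Set.mem_ofPred_eq, ha w _ hS, hb w _ hS, IsUnifier, substTm_substTm, substTm_substTm]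
  rcases hr with ⟨hr1, -, rfl⟩ | ⟨hr1, hr2⟩
  · refine Comp.unif_fail ?_
    rintro ⟨δ, hδ⟩
    obtain ⟨w, hw, hS⟩ := hA.2 δ trivial
    exact Set.notMem_empty w (hr1 ▸ ⟨hw, (hmem w δ hS).2 hδ⟩)
  · obtain ⟨μ, hμ⟩ : ∃ μ : Subst L Var, IsMGU μ (substTm σ s) (substTm σ t) := by
      have hne : (A ∩ {w | a w = b w}).Nonempty := by
        rw [Set.nonempty_iff_ne_empty]
        intro he
        obtain ⟨w, hw, -⟩ := hA.2 fvar trivial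
        exact Set.notMem_empty w (hr1 he ▸ hw)
      obtain ⟨w, hw, hw'⟩ := hne
      obtain ⟨δ, -, hS⟩ := hA.1 w hw
      exact exists_isMGU _ _ ⟨δ, (hmem w δ hS).1 hw'⟩
    have hd1 : Disjoint θ.dom (fvTm (substTm σ s) ∪ fvTm (substTm σ t)) :=
      hd.mono_right fun x hx => by
        rw [Stack.fv_append]
        exact .inl ⟨_, List.mem_singleton_self _, hx⟩
    have hfin : μ.dom.Finite := ((fvTm_finite _).union (fvTm_finite _)).subset hμ.dom_subset
    -- the remaining worlds are related to the substitutions that come after `μ`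
    have hA' : LiftRel (after (after S σ) μ) (A ∩ {w | a w = b w}) Set.univ := by
      refine ⟨fun w hw => ?_, fun δ _ => ?_⟩
      · obtain ⟨δ, -, hS⟩ := hA.1 w hw.1
        obtain ⟨δ', rfl⟩ := hμ.2.1 δ ((hmem w δ hS).1 hw.2)
        refine ⟨μ.comp δ', trivial, ?_⟩
        rw [after, ← Subst.comp_assoc, hμ.2.2]
        exact hS
      · obtain ⟨w, hw, hS⟩ := hA.2 (μ.comp δ) trivial
        refine ⟨w, ⟨hw, (hmem w _ hS).2 ?_⟩, hS⟩
        rw [IsUnifier, ← substTm_substTm, ← substTm_substTm, hμ.1]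
    exact (hK _ μ _ r (inUse_finite hV hθ _) hfin (hμ.good hd1) hA' hr2).map
      fun ρ hρ => Comp.unif_succ hμ hρ

theorem Realizes.conj {B C : Formula L Var 0} (hg : Realizes P S g [.fml B])
    (hh : Realizes P S h [.fml C]) : Realizes P S (g.seq h) [.fml (.conj B C)] := by
  intro V σ θ α R M K A r hV hσ hθ hd hA hK hr
  refine (hg.seq hh _ σ θ α R M K A r (inUse_finite hV hθ _) hσ hθ ?_ hA hK hr).map
    fun ρ hρ => Comp.conj hρ
  simpa [StackElt.subst, StackElt.fv, Formula.subst, Formula.bind, Formula.fv, Set.union_assoc]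
    using hd

theorem Realizes.disj {B C : Formula L Var 0} (hg : Realizes P S g [.fml B])
    (hh : Realizes P S h [.fml C]) : Realizes P S (g.orElse h) [.fml (.disj B C)] := by
  intro V σ θ α R M K A r hV hσ hθ hd hA hK hr
  have hdB : Disjoint θ.dom (Stack.fv (Stack.subst σ [.fml B] ++ α)) := hd.mono_right fun x hx => by
    simp [StackElt.subst, StackElt.fv, Formula.subst, Formula.bind, Formula.fv] at hx ⊢
    tauto
  have hdC : Disjoint θ.dom (Stack.fv (Stack.subst σ [.fml C] ++ α)) := hd.mono_right fun x hx => by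
    simp [StackElt.subst, StackElt.fv, Formula.subst, Formula.bind, Formula.fv] at hx ⊢
    tauto
  have hV' := inUse_finite hV hθ (.fml (.disj (B.subst σ) (C.subst σ)) :: α)
  rcases hr with ⟨⟨x, rfl⟩, hr⟩ | ⟨hr1, hr2⟩
  · obtain ⟨θ', h1, h2⟩ := hg _ σ θ α R M K A _ hV' hσ hθ hdB hA hK hr
    exact ⟨θ', h1, Comp.disj_nofail (by simp) h2⟩
  · exact (hh _ σ θ α R M K A _ hV' hσ hθ hdC hA hK hr2).map
      fun ρ hρ => Comp.disj_fail (hg _ σ θ α R M K A _ hV' hσ hθ hdB hA hK hr1) hρ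

theorem Realizes.neg {B : Formula L Var 0} (hg : Realizes P S g [.fml B]) :
    Realizes P S g.naf [.fml (.neg B)] := by
  intro V σ θ α R M K A r hV hσ hθ hd hA hK hr
  have hdB : Disjoint θ.dom (Stack.fv (Stack.subst σ [.fml B])) := hd.mono_right fun x hx => by
    simp [StackElt.subst, StackElt.fv, Formula.subst, Formula.bind, Formula.fv] at hx ⊢
    tauto
  have hV' := inUse_finite hV hθ (.fml (.neg (B.subst σ)) :: α)
  rcases hr with ⟨A', hr, rfl⟩ | ⟨hr1, hr2⟩
  · obtain ⟨θ', -, h2⟩ := hg.run hV' hσ hθ hdB hA hr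
    exact Comp.not_succ h2
  · exact (hK.start hV' hA hr2).map fun ρ hρ =>
      Comp.not_fail (hg.run hV' hσ hθ hdB hA hr1) hρ

/-- Only the values of finitely many variables matter for the relation `S`. -/
def FinSupp (S : W → Subst L Var → Prop) : Prop :=
  ∃ X : Set Var, X.Finite ∧ ∀ w δ δ', (∀ x ∈ X, δ x = δ' x) → S w δ → S w δ'

theorem FinSupp.after (hS : FinSupp S) (σ : Subst L Var) : FinSupp (after S σ) := by
  obtain ⟨X, hX, h⟩ := hS
  refine ⟨⋃ x ∈ X, fvTm (σ x), hX.biUnion fun x _ => fvTm_finite _, fun w δ δ' hδ hS => ?_⟩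
  refine h w _ _ (fun x hx => ?_) hS
  exact substTm_congr _ fun y hy => hδ y (Set.mem_biUnion hx hy)

/-- Extend a relation between worlds and substitutions to worlds with additional variables, which
are named by `f`. -/
def withFresh {ι : Type*} (S : W → Subst L Var → Prop) (f : ι → Var) (Y : Set ι)
    (v : W × (ι → Tm L Var 0)) (δ : Subst L Var) : Prop := S v.1 δ ∧ ∀ i ∈ Y, δ (f i) = v.2 i

omit [DecidableEq Var] in
theorem FinSupp.withFresh {ι : Type*} (hS : FinSupp S) (f : ι → Var) {Y : Set ι} (hY : Y.Finite) :
    ∃ X : Set Var, X.Finite ∧ ∀ w δ δ', (∀ x ∈ X, δ x = δ' x) →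
      withFresh S f Y w δ → withFresh S f Y w δ' := by
  obtain ⟨X, hX, h⟩ := hS
  refine ⟨X ∪ f '' Y, hX.union (hY.image f), fun v δ δ' hδ hS => ?_⟩
  exact ⟨h _ _ _ (fun x hx => hδ x (.inl hx)) hS.1,
    fun i hi => (hδ _ (.inr ⟨i, hi, rfl⟩)).symm.trans (hS.2 i hi)⟩

omit [DecidableEq Var] in
/-- Names outside the finite set `X` can take arbitrary values without affecting the relation `S`.
-/
theorem liftRel_withFresh {ι : Type*} {f : ι → Var} (hf : Function.Injective f) {Y : Set ι}
    {X : Set Var} (hX : ∀ w δ δ', (∀ x ∈ X, δ x = δ' x) → S w δ → S w δ')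
    (hY : ∀ i ∈ Y, f i ∉ X) {A : Set W} (hA : LiftRel S A Set.univ) :
    LiftRel (withFresh S f Y) (Prod.fst ⁻¹' A) Set.univ := by
  classical
  refine ⟨fun v hv => ?_, fun δ _ => ?_⟩
  · obtain ⟨δ, -, hS⟩ := hA.1 _ hv
    refine ⟨fun z => if z ∈ X then δ z else Function.extend f v.2 δ z, trivial,
      hX _ _ _ (fun x hx => (if_pos hx).symm) hS, fun i hi => ?_⟩
    exact (if_neg (hY i hi)).trans (hf.extend_apply _ _ _)
  · obtain ⟨w, hw, hS⟩ := hA.2 δ trivial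
    exact ⟨(w, fun i => δ (f i)), hw, hS, fun _ _ => rfl⟩

/-- A realized continuation remains so when the additional variables are forgotten before it. -/
theorem KReal.withFresh {ι : Type*} {f : ι → Var} {Y : Set ι} {R : Type z}
    {M : R → Subst L Var → Prop} {θ : Subst L Var} {α : Stack L Var} {K : Set W → Option R → Prop}
    (hK : KReal P M S θ α K) (V : Set Var) (σ : Subst L Var)
    (A : Set (W × (ι → Tm L Var 0))) (r : Option R) (hV : V.Finite) (hσ : σ.dom.Finite)
    (hg : Good θ.dom σ) (hA : LiftRel (fun v δ => withFresh S f Y v (σ.comp δ)) A Set.univ)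
    (hr : K (Prod.fst '' A) r) : Run P M V (θ.comp σ) (Stack.subst σ α) r := by
  refine hK V σ _ r hV hσ hg ?_ hr
  have := hA.image (f₁ := Prod.fst) (f₂ := id) (S := CutLP.after S σ)
    fun v δ (h : CutLP.withFresh S f Y v _) => h.1
  rwa [Set.image_id] at this

end Completeness

/-! ### Realizing formulas, clauses and calls -/

section Completeness

variable [DecidableEq Var]

omit [DecidableEq Var] in
theorem exists_fresh [Infinite Var] (n : ℕ) {F : Set Var} (hF : F.Finite) :
    ∃ xs : Fin n → Var, Function.Injective xs ∧ ∀ i, xs i ∉ F := by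
  have : Infinite ↥Fᶜ := hF.infinite_compl.to_subtype
  let f := (Infinite.natEmbedding ↥Fᶜ)
  exact ⟨fun i => f i, fun i j h => Fin.ext (f.injective (Subtype.ext h)), fun i => (f i).2⟩

/-- Clauses can be renamed to avoid any finite set of variables. -/
theorem exists_perm_fresh [Infinite Var] {Y F : Set Var} (hY : Y.Finite) (hF : F.Finite) :
    ∃ π : Equiv.Perm Var, ∀ y ∈ Y, π y ∉ F := by
  induction Y, hY using Set.Finite.induction_on with
  | empty => exact ⟨1, fun _ h => h.elim⟩
  | @insert y Y hy hY ih =>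
    obtain ⟨π, hπ⟩ := ih
    obtain ⟨z, hz⟩ := (hF.union (hY.image π)).infinite_compl.nonempty
    refine ⟨π.trans (Equiv.swap (π y) z), fun y' hy' => ?_⟩
    rw [Equiv.trans_apply]
    rcases hy' with rfl | hy'
    · rw [Equiv.swap_apply_left]
      exact fun h => hz (.inl h)
    · rw [Equiv.swap_apply_of_ne_of_ne]
      · exact hπ y' hy'
      · exact fun h => hy (π.injective h ▸ hy')
      · exact fun h => hz (.inr ⟨y', hy', h⟩)

variable {W : Type (max u w)} {P : Program L Var} {I : Interp L Var}

/-- Calls under the interpretation `I` are realized by computations. -/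
def CallReal (P : Program L Var) (I : Interp L Var) : Prop :=
  ∀ (n : ℕ) (p : L.Relations n) (W : Type (max u w)) (a : W → Fin n → Tm L Var 0)
    (S : W → Subst L Var → Prop) (s : Fin n → Tm L Var 0), FinSupp S →
    (∀ w δ, S w δ → ∀ i, a w i = substTm δ (s i)) → Realizes P S (I n p W a) [.fml (.atom p s)]

theorem CallReal.call (hI : CallReal P I) {n : ℕ} {p : L.Relations n} {a : W → Fin n → Tm L Var 0}
    {S : W → Subst L Var → Prop} {s : Fin n → Tm L Var 0} (hS : FinSupp S)
    (ha : ∀ w δ, S w δ → ∀ i, a w i = substTm δ (s i)) :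
    Realizes P S (call I p a) [.fml (.atom p s)] := by
  rintro V σ θ α R M K A r hV hσ hθ hd hA hK ⟨K', hK', hr⟩
  exact hI n p W a S s hS ha V σ θ α R M K' A r hV hσ hθ hd hA
    (fun V' σ' A' r' h1 h2 h3 h4 h5 => hK V' σ' A' r' h1 h2 h3 h4 (hK' _ _ h5)) hr

/-- The denotation of a formula is realized by the formula, in which the variables have been
replaced by terms that stand for their values. -/
theorem den_realizes [Infinite Var] (hI : CallReal P I) {k : ℕ} (B : Formula L Var k)
    {W : Type (max u w)} {S : W → Subst L Var → Prop} (hS : FinSupp S)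
    {e : W → Var ⊕ Fin k → Tm L Var 0} {f : Var ⊕ Fin k → Tm L Var 0}
    (he : ∀ w δ, S w δ → (∀ x ∈ B.fv, e w (Sum.inl x) = substTm δ (f (Sum.inl x))) ∧
      ∀ j, e w (Sum.inr j) = substTm δ (f (Sum.inr j))) :
    Realizes P S (den I B e) [.fml (B.bind f)] := by
  have tm : ∀ {k : ℕ} (t : Tm L Var k) {g : Var ⊕ Fin k → Tm L Var 0} {f : Var ⊕ Fin k → Tm L Var 0}
      {δ : Subst L Var}, (∀ x ∈ fvTm t, g (Sum.inl x) = substTm δ (f (Sum.inl x))) →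
      (∀ j, g (Sum.inr j) = substTm δ (f (Sum.inr j))) → t.subst g = substTm δ (t.subst f) := by
    intro k t g f δ h1 h2
    rw [substTm_eq, term_subst_subst]
    exact term_subst_congr t h1 h2
  -- the environment of a formula whose bound variables are given the names `xs`
  have ext : ∀ {k n : ℕ} {X : Set Var} {W : Type (max u w)} {S : W → Subst L Var → Prop}
      {e : W → Var ⊕ Fin k → Tm L Var 0} {f : Var ⊕ Fin k → Tm L Var 0} (σ : Subst L Var)
      (xs : Fin n → Var),
      (∀ w δ, S w δ → (∀ x ∈ X, e w (Sum.inl x) = substTm δ (f (Sum.inl x))) ∧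
        ∀ j, e w (Sum.inr j) = substTm δ (f (Sum.inr j))) →
      ∀ (v : W × (Fin n → Tm L Var 0)) (δ : Subst L Var),
        withFresh (after S σ) xs Set.univ v δ →
        (∀ x ∈ X, extEnv (e v.1) v.2 (Sum.inl x) = substTm δ
          (extEnv (fun z => (f z).subst σ.env) (fun i => fvar (xs i)) (Sum.inl x))) ∧
        ∀ j, extEnv (e v.1) v.2 (Sum.inr j) = substTm δ
          (extEnv (fun z => (f z).subst σ.env) (fun i => fvar (xs i)) (Sum.inr j)) := by
    rintro k n X W S e f σ xs he ⟨w, ts⟩ δ ⟨hS, hts⟩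
    refine ⟨fun x hx => ?_, fun j => ?_⟩
    · rw [extEnv_inl, extEnv_inl, ← substTm_eq, substTm_substTm]
      exact (he _ _ hS).1 x hx
    · induction j using Fin.addCases with
      | left j =>
        rw [extEnv_castAdd, extEnv_castAdd, ← substTm_eq, substTm_substTm]
        exact (he _ _ hS).2 j
      | right j =>
        rw [extEnv_natAdd, extEnv_natAdd, substTm_fvar]
        exact (hts j trivial).symm
  induction B generalizing W with
  | eq s t =>
    exact .eq (fun w δ h => tm s (fun x hx => (he w δ h).1 x (.inl hx)) (he w δ h).2)
      (fun w δ h => tm t (fun x hx => (he w δ h).1 x (.inr hx)) (he w δ h).2)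
  | atom p ts =>
    exact hI.call hS fun w δ h i =>
      tm (ts i) (fun x hx => (he w δ h).1 x (Set.mem_iUnion.2 ⟨i, hx⟩)) (he w δ h).2
  | conj B C ihB ihC =>
    exact .conj (ihB hS fun w δ h => ⟨fun x hx => (he w δ h).1 x (.inl hx), (he w δ h).2⟩)
      (ihC hS fun w δ h => ⟨fun x hx => (he w δ h).1 x (.inr hx), (he w δ h).2⟩)
  | disj B C ihB ihC =>
    exact .disj (ihB hS fun w δ h => ⟨fun x hx => (he w δ h).1 x (.inl hx), (he w δ h).2⟩)
      (ihC hS fun w δ h => ⟨fun x hx => (he w δ h).1 x (.inr hx), (he w δ h).2⟩)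
  | neg B ihB => exact .neg (ihB hS he)
  | @ex k B ihB =>
    intro V σ θ α R M K A r hV hσ hθ hd hA hK hr
    obtain ⟨X, hX, hSX⟩ := hS.after σ
    have hform : Stack.subst σ [.fml ((Formula.ex B).bind f)] =
        [.fml (.ex (B.bind (underBinders 1 fun z => (f z).subst σ.env)))] := by
      rw [← underBinders_underBinders, ← Formula.bind_bind]
      rfl
    rw [hform] at hd ⊢
    set f' : Var ⊕ Fin k → Tm L Var 0 := fun z => (f z).subst σ.env with hf'
    obtain ⟨xs, hinj, hxs⟩ := exists_fresh 1 ((inUse_finite hV hθ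
      ([StackElt.fml (.ex (B.bind (underBinders 1 f')))] ++ α)).union hX)
    have hB := ihB (S := withFresh (after S σ) xs Set.univ)
      (FinSupp.withFresh (hS.after σ) xs Set.finite_univ) (ext σ xs he)
    have hxs' : (fun _ => xs 0) = xs := by
      funext i
      rw [Subsingleton.elim i 0]
    have key := hB (inUse V θ ([StackElt.fml (.ex (B.bind (underBinders 1 f')))] ++ α)) fvar θ α R M
      (fun A' => K (Prod.fst '' A')) (Prod.fst ⁻¹' A) r (inUse_finite hV hθ _)
      dom_fvar_finite hθ ?_
      (liftRel_withFresh hinj hSX (fun i _ h => hxs i (.inr h)) hA) hK.withFresh hr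
    · refine key.map fun ρ hρ => Comp.exists_ (x' := xs 0) (fun h => hxs 0 (.inl h)) ?_
      rw [hxs', Formula.inst_bind]
      simpa using hρ
    · rw [Stack.subst_id, ← Formula.inst_bind]
      refine Set.disjoint_left.2 fun x hx hx2 => ?_
      rw [List.singleton_append, Stack.fv_cons] at hx2
      rcases hx2 with hx2 | hx2
      · rcases Formula.mem_fv_inst _ _ hx2 with hx2 | ⟨i, rfl⟩
        · exact Set.disjoint_left.1 hd hx (by
            simp only [List.singleton_append, Stack.fv_cons]
            exact .inl hx2)
        · exact hxs i (.inl (vars_subset_inUse (.inl hx)))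
      · exact Set.disjoint_left.1 hd hx (by simp [hx2])
  | @ifthen k n B C ihB ihC =>
    intro V σ θ α R M K A r hV hσ hθ hd hA hK hr
    obtain ⟨X, hX, hSX⟩ := hS.after σ
    have hform : Stack.subst σ [.fml ((Formula.ifthen n B C).bind f)] =
        [.fml (.ifthen n (B.bind (underBinders n fun z => (f z).subst σ.env))
          (C.bind (underBinders n fun z => (f z).subst σ.env)))] := by
      rw [← underBinders_underBinders, ← Formula.bind_bind, ← Formula.bind_bind]
      rfl
    rw [hform] at hd ⊢
    set f' : Var ⊕ Fin k → Tm L Var 0 := fun z => (f z).subst σ.env with hf'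
    set G : Formula L Var 0 := .ifthen n (B.bind (underBinders n f')) (C.bind (underBinders n f'))
      with hG
    obtain ⟨xs, hinj, hxs⟩ := exists_fresh n ((inUse_finite hV hθ
      ([StackElt.fml G] ++ α)).union hX)
    have hS' := FinSupp.withFresh (hS.after σ) xs Set.finite_univ
    have hB := ihB (S := withFresh (after S σ) xs Set.univ) hS'
      (ext σ xs fun w δ h => ⟨fun x hx => (he w δ h).1 x (.inl hx), (he w δ h).2⟩)
    have hC := ihC (S := withFresh (after S σ) xs Set.univ) hS'
      (ext σ xs fun w δ h => ⟨fun x hx => (he w δ h).1 x (.inr hx), (he w δ h).2⟩)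
    have hV' : (inUse V θ ([StackElt.fml G] ++ α) ∪ Set.range xs).Finite :=
      (inUse_finite hV hθ _).union (Set.finite_range xs)
    have hdB : Disjoint θ.dom (Stack.fv (Stack.subst fvar
        [.fml (B.bind (extEnv f' fun i => fvar (xs i)))])) := by
      rw [Stack.subst_id, ← Formula.inst_bind]
      refine Set.disjoint_left.2 fun x hx hx2 => ?_
      rw [Stack.fv_cons, Stack.fv_nil, Set.union_empty] at hx2
      rcases Formula.mem_fv_inst _ _ hx2 with hx2 | ⟨i, rfl⟩
      · exact Set.disjoint_left.1 hd hx (by simp [hG, StackElt.fv, Formula.fv, hx2])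
      · exact hxs i (.inl (vars_subset_inUse (.inl hx)))
    have hdC : Disjoint θ.dom (Stack.fv (Stack.subst fvar
        [.fml (C.bind (extEnv f' fun i => fvar (xs i)))] ++ α)) := by
      rw [Stack.subst_id, ← Formula.inst_bind]
      refine Set.disjoint_left.2 fun x hx hx2 => ?_
      rw [List.singleton_append, Stack.fv_cons] at hx2
      rcases hx2 with hx2 | hx2
      · rcases Formula.mem_fv_inst _ _ hx2 with hx2 | ⟨i, rfl⟩
        · exact Set.disjoint_left.1 hd hx (by simp [hG, StackElt.fv, Formula.fv, hx2])
        · exact hxs i (.inl (vars_subset_inUse (.inl hx)))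
      · exact Set.disjoint_left.1 hd hx (by simp [hx2])
    have hA' := liftRel_withFresh hinj hSX (fun i (_ : i ∈ Set.univ) h => hxs i (.inr h)) hA
    rcases hr with ⟨A₁, h1, h2⟩ | ⟨h1, rfl⟩
    · obtain ⟨θ', hans, h3⟩ := hB.run (σ := fvar) hV' dom_fvar_finite hθ hdB hA' h1
      have key := hC.resume (σ := fvar) hV' dom_fvar_finite hθ hdC hK.withFresh hans h2
      refine key.map fun ρ hρ => Comp.if_succ hinj (fun i h => hxs i (.inl h))
        (θ' := θ') ?_ ?_
      · rw [Formula.inst_bind]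
        simpa using h3
      · rw [Formula.inst_bind]
        rw [Stack.subst_append, Stack.subst_id] at hρ
        exact hρ
    · have h3 := hB.run (σ := fvar) hV' dom_fvar_finite hθ hdB hA' h1
      refine Comp.if_fail hinj (fun i h => hxs i (.inl h)) ?_
      rw [Formula.inst_bind]
      simpa [Run] using h3

variable {S : W → Subst L Var → Prop} {e : W → Subst L Var} {f : Subst L Var}

theorem denF_realizes [Infinite Var] (hI : CallReal P I) (hS : FinSupp S) (F : Formula L Var 0)
    (he : ∀ w δ, S w δ → ∀ x ∈ F.fv, e w x = substTm δ (f x)) :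
    Realizes P S (denF I F e) [.fml (F.subst f)] :=
  den_realizes hI F hS fun w δ h => ⟨he w δ h, fun j => j.elim0⟩

theorem goals_realizes [Infinite Var] (hI : CallReal P I) (hS : FinSupp S)
    (η : List (Formula L Var 0))
    (he : ∀ w δ, S w δ → ∀ x ∈ bodyFv (noCuts η), e w x = substTm δ (f x)) :
    Realizes P S (denStack I e (goals η)) (Stack.subst f (goals η)) := by
  induction η with
  | nil => exact .skip
  | cons F η ih =>
    exact .seq (denF_realizes hI hS F fun w δ h x hx =>
        he w δ h x (by rw [noCuts, List.map_cons, bodyFv_cons]; exact .inl hx))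
      (ih fun w δ h x hx => he w δ h x (by
        rw [noCuts, List.map_cons, bodyFv_cons]
        exact .inr hx))

omit [DecidableEq Var] in
theorem forall_fin_succ_set {W : Type*} {n : ℕ} (q : W → Fin (n + 1) → Prop) :
    {w | ∀ i, q w i} = {w | q w 0} ∩ {w | ∀ i : Fin n, q w i.succ} := by
  ext w
  simp [Fin.forall_fin_succ]

theorem eqGoals_realizes [Infinite Var] {n : ℕ} {a b : W → Fin n → Tm L Var 0}
    {s t : Fin n → Tm L Var 0} (ha : ∀ w δ, S w δ → ∀ i, a w i = substTm δ (s i))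
    (hb : ∀ w δ, S w δ → ∀ i, b w i = substTm δ (t i)) :
    Realizes P S (constrain {w | ∀ i, a w i = b w i}) (eqGoals s t) := by
  induction n with
  | zero =>
    have : {w | ∀ i : Fin 0, a w i = b w i} = Set.univ := by
      ext w
      simp
    rw [this, constrain_univ]
    exact .skip
  | succ n ih =>
    rw [forall_fin_succ_set, ← constrain_seq_constrain]
    have h := (Realizes.eq (P := P) (fun w δ h => ha w δ h 0) (fun w δ h => hb w δ h 0)).seq
      (ih (a := fun w i => a w i.succ) (b := fun w i => b w i.succ)
        (fun w δ h i => ha w δ h i.succ) (fun w δ h i => hb w δ h i.succ))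
    rw [eqGoals, List.ofFn_succ]
    exact h

theorem body_realizes [Infinite Var] (hI : CallReal P I) (hS : FinSupp S)
    (η : List (BodyElt L Var))
    (he : ∀ w δ, S w δ → ∀ x ∈ bodyFv η, e w x = substTm δ (f x)) :
    Realizes P S (denBody I e skip η) [.body (η.map (BodyElt.subst f))] := by
  induction hn : η.length using Nat.strong_induction_on generalizing η with
  | _ N ih =>
  rcases body_cases η with ⟨η₁, rfl⟩ | ⟨η₁, η₂, rfl⟩
  · rw [denBody_noCuts, skip_seq]
    intro V σ θ α R M K A r hV hσ hθ hd hA hK hr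
    have hform : Stack.subst σ [.body ((noCuts η₁).map (BodyElt.subst f))] =
        [.body (noCuts (η₁.map (Formula.subst (f.comp σ))))] := by
      rw [← map_subst_noCuts, ← bodySubst_subst]
      rfl
    have hform' : Stack.subst σ (Stack.subst f (goals η₁)) =
        goals (η₁.map (Formula.subst (f.comp σ))) := by
      rw [Stack.subst_subst, Stack.subst_goals]
    rw [hform] at hd ⊢
    have key := goals_realizes hI hS η₁ he (inUse V θ _) σ θ α R M K A r
      (inUse_finite hV hθ (.body (noCuts (η₁.map (Formula.subst (f.comp σ)))) :: α)) hσ hθ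
      (by rw [hform', Stack.fv_append, fv_goals]; simpa [StackElt.fv] using hd) hA hK hr
    rw [hform'] at key
    exact key.map fun ρ hρ => Comp.body_nocut hρ
  · rw [denBody_cut, skip_seq, ← cutThen_fail]
    rw [fv_body_cut] at he
    intro V σ θ α R M K A r hV hσ hθ hd hA hK hr
    have hform : Stack.subst σ [.body ((noCuts η₁ ++ .cut :: η₂).map (BodyElt.subst f))] =
        [.body (noCuts (η₁.map (Formula.subst (f.comp σ))) ++
          .cut :: η₂.map (BodyElt.subst (f.comp σ)))] := by
      rw [← map_subst_noCuts, ← bodySubst_subst, ← bodySubst_subst]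
      simp [Stack.subst, StackElt.subst, BodyElt.subst]
    have hform' : Stack.subst σ (Stack.subst f (goals η₁)) =
        goals (η₁.map (Formula.subst (f.comp σ))) := by
      rw [Stack.subst_subst, Stack.subst_goals]
    have hform₂ : Stack.subst σ [.body (η₂.map (BodyElt.subst f))] =
        [.body (η₂.map (BodyElt.subst (f.comp σ)))] := by
      rw [← bodySubst_subst]
      rfl
    rw [hform] at hd ⊢
    rw [List.singleton_append, Stack.fv_cons, StackElt.fv, fv_body_cut] at hd
    have hV' := inUse_finite hV hθ (.body (noCuts (η₁.map (Formula.subst (f.comp σ))) ++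
          .cut :: η₂.map (BodyElt.subst (f.comp σ))) :: α)
    have hd₁ : Disjoint θ.dom (Stack.fv (Stack.subst σ (Stack.subst f (goals η₁)))) := by
      rw [hform', fv_goals]
      exact hd.mono_right fun x hx => .inl (.inl hx)
    have h₁ := goals_realizes hI hS η₁ fun w δ h x hx => he w δ h x (.inl hx)
    have h₂ := ih η₂.length (by simp [← hn]; omega) η₂
      (fun w δ h x hx => he w δ h x (.inr hx)) rfl
    rcases hr with ⟨A₁, h3, h4⟩ | ⟨h3, rfl⟩
    · obtain ⟨θ', hans, h5⟩ := h₁.run hV' hσ hθ hd₁ hA h3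
      have key := h₂.resume hV' hσ hθ ?_ hK hans h4
      · rw [hform'] at h5
        rw [hform₂] at key
        exact key.map fun ρ hρ => Comp.body_cut_succ h5 hρ
      · rw [hform₂, List.singleton_append, Stack.fv_cons, StackElt.fv]
        exact hd.mono_right (Set.union_subset_union_left _ Set.subset_union_right)
    · have h5 := h₁.run hV' hσ hθ hd₁ hA h3
      rw [hform'] at h5
      exact Comp.body_cut_fail h5

/-- By induction on the clauses; the failure of a clause leads to the remaining ones. -/
theorem using_realizes [Infinite Var] (hI : CallReal P I) (hS : FinSupp S) {n : ℕ}
    (p : L.Relations n) {a : W → Fin n → Tm L Var 0} {s : Fin n → Tm L Var 0}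
    (ha : ∀ w δ, S w δ → ∀ i, a w i = substTm δ (s i)) (γ : List (Clause L Var))
    (he : ∀ w δ, S w δ → ∀ x ∈ Program.fv γ, e w x = substTm δ (f x)) :
    Realizes P S (denUsing I p a e γ) [.using p s (γ.map (Clause.subst f))] := by
  induction γ with
  | nil =>
    rintro V σ θ α R M K A r hV hσ hθ hd hA hK rfl
    exact Comp.using_empty
  | cons c γ ih =>
    intro V σ θ α R M K A r hV hσ hθ hd hA hK hr
    obtain ⟨q, t, η⟩ := c
    have hc : (⟨_, q⟩ : Σ n, L.Relations n) = ⟨n, p⟩ := hr.1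
    cases hc
    rw [denUsing_cons] at hr
    rw [programFv_cons] at he
    have hγ := ih fun w δ h x hx => he w δ h x (.inr hx)
    have hη := fun w δ h x hx => he w δ h x (.inl (.inr hx))
    have ht : ∀ w δ, S w δ → ∀ i, substTm (e w) (t i) = substTm δ (substTm f (t i)) := by
      intro w δ h i
      rw [substTm_substTm]
      exact substTm_congr _ fun x hx => he w δ h x (.inl (.inl (Set.mem_iUnion.2 ⟨i, hx⟩)))
    have hhead : Realizes P S (constrain {w | ∀ i, a w i = substTm (e w) (t i)})
        (eqGoals s fun i => substTm f (t i)) := eqGoals_realizes ha ht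
    have hform : Stack.subst σ [.using p s ((⟨p, t, η⟩ :: γ).map (Clause.subst f))] =
        [.using p (fun i => substTm σ (s i)) (⟨p, fun i => substTm (f.comp σ) (t i),
          η.map (BodyElt.subst (f.comp σ))⟩ :: γ.map (Clause.subst (f.comp σ)))] := by
      rw [← programSubst_subst, ← bodySubst_subst]
      simp only [← substTm_substTm]
      rfl
    have hformγ : Stack.subst σ [.using p s (γ.map (Clause.subst f))] =
        [.using p (fun i => substTm σ (s i)) (γ.map (Clause.subst (f.comp σ)))] := by
      rw [← programSubst_subst]
      rfl
    have hform₁ : ∀ η₁, Stack.subst σ ((eqGoals s fun i => substTm f (t i)) ++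
        Stack.subst f (goals η₁)) =
        eqGoals (fun i => substTm σ (s i)) (fun i => substTm (f.comp σ) (t i)) ++
          goals (η₁.map (Formula.subst (f.comp σ))) := by
      intro η₁
      rw [Stack.subst_append, Stack.subst_subst, Stack.subst_goals, Stack.subst_eqGoals]
      simp only [substTm_substTm]
    rw [hform] at hd ⊢
    rw [List.singleton_append] at hd ⊢
    have hV' := inUse_finite hV hθ (.using p (fun i => substTm σ (s i))
      (⟨p, fun i => substTm (f.comp σ) (t i), η.map (BodyElt.subst (f.comp σ))⟩ ::
        γ.map (Clause.subst (f.comp σ))) :: α)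
    rw [Stack.fv_cons, fv_using_cons] at hd
    have hdγ : Disjoint θ.dom (Stack.fv (Stack.subst σ
        [.using p s (γ.map (Clause.subst f))] ++ α)) := by
      rw [hformγ, List.singleton_append, Stack.fv_cons, StackElt.fv]
      refine hd.mono_right fun x hx => ?_
      simp only [Set.mem_union] at hx ⊢
      tauto
    rcases body_cases η with ⟨η₁, rfl⟩ | ⟨η₁, η₂, rfl⟩
    · rw [denClause_noCuts] at hr
      rw [map_subst_noCuts] at hd hV' ⊢
      have h₁ := hhead.seq (goals_realizes hI hS η₁ hη)
      have hd₁ : Disjoint θ.dom (Stack.fv (Stack.subst σ ((eqGoals s fun i => substTm f (t i)) ++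
          Stack.subst f (goals η₁)) ++ α)) := by
        rw [hform₁, Stack.fv_append, Stack.fv_append, fv_eqGoals, fv_goals]
        refine hd.mono_right fun x hx => ?_
        simp only [Set.mem_union] at hx ⊢
        tauto
      rcases hr with ⟨⟨x, rfl⟩, h3⟩ | ⟨h3, h4⟩
      · obtain ⟨θ', hM, h5⟩ := h₁ _ σ θ α R M K A _ hV' hσ hθ hd₁ hA hK h3
        rw [hform₁] at h5
        exact ⟨θ', hM, Comp.using_nocut_succ h5⟩
      · have h5 := h₁ _ σ θ α R M K A _ hV' hσ hθ hd₁ hA hK h3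
        rw [hform₁] at h5
        have key := hγ _ σ θ α R M K A r hV' hσ hθ hdγ hA hK h4
        rw [hformγ] at key
        exact key.map fun ρ hρ => Comp.using_nocut_fail h5 hρ
    · rw [denClause_cut] at hr
      rw [fv_body_cut] at hη
      have hcut : (noCuts η₁ ++ .cut :: η₂).map (BodyElt.subst (f.comp σ)) =
          noCuts (η₁.map (Formula.subst (f.comp σ))) ++
            .cut :: η₂.map (BodyElt.subst (f.comp σ)) := by
        rw [← map_subst_noCuts]
        simp [BodyElt.subst]
      rw [hcut] at hd hV' ⊢
      rw [fv_body_cut] at hd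
      have h₁ := hhead.seq (goals_realizes hI hS η₁ fun w δ h x hx => hη w δ h x (.inl hx))
      have h₂ := body_realizes hI hS η₂ fun w δ h x hx => hη w δ h x (.inr hx)
      have hform₂ : Stack.subst σ [.body (η₂.map (BodyElt.subst f))] =
          [.body (η₂.map (BodyElt.subst (f.comp σ)))] := by
        rw [← bodySubst_subst]
        rfl
      have hd₁ : Disjoint θ.dom (Stack.fv (Stack.subst σ ((eqGoals s fun i => substTm f (t i)) ++
          Stack.subst f (goals η₁)))) := by
        rw [hform₁, Stack.fv_append, fv_eqGoals, fv_goals]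
        refine hd.mono_right fun x hx => ?_
        simp only [Set.mem_union] at hx ⊢
        tauto
      rcases hr with ⟨A₁, h3, h4⟩ | ⟨h3, h4⟩
      · obtain ⟨θ', hans, h5⟩ := h₁.run hV' hσ hθ hd₁ hA h3
        have key := h₂.resume hV' hσ hθ ?_ hK hans h4
        · rw [hform₁] at h5
          rw [hform₂] at key
          exact key.map fun ρ hρ => Comp.using_cut_succ h5 hρ
        · rw [hform₂, List.singleton_append, Stack.fv_cons, StackElt.fv]
          refine hd.mono_right fun x hx => ?_
          simp only [Set.mem_union] at hx ⊢
          tauto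
      · have h5 := h₁.run hV' hσ hθ hd₁ hA h3
        rw [hform₁] at h5
        have key := hγ _ σ θ α R M K A r hV' hσ hθ hdγ hA hK h4
        rw [hformγ] at key
        exact key.map fun ρ hρ => Comp.using_cut_fail h5 hρ

theorem stack_realizes [Infinite Var] (hI : CallReal P I) (hS : FinSupp S) (α : Stack L Var)
    (he : ∀ w δ, S w δ → ∀ x ∈ Stack.fv α, e w x = substTm δ (f x)) :
    Realizes P S (denStack I e α) (Stack.subst f α) := by
  induction α with
  | nil => exact .skip
  | cons b α ih =>
    rw [Stack.fv_cons] at he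
    refine Realizes.seq (β := [b.subst f]) ?_ (ih fun w δ h x hx => he w δ h x (.inr hx))
    have hb := fun w δ h x hx => he w δ h x (.inl hx)
    rcases b with F | ⟨p, s, γ⟩ | η
    · exact denF_realizes hI hS F hb
    · refine using_realizes hI hS p (fun w δ h i => ?_) γ fun w δ h x hx => hb w δ h x (.inr hx)
      rw [substTm_substTm]
      exact substTm_congr _ fun x hx => hb w δ h x (.inl (Set.mem_iUnion.2 ⟨i, hx⟩))
    · exact body_realizes hI hS η hb

/-- A call is realized by choosing new names for the variables of the clauses. -/
theorem CallReal.step [Infinite Var] (hI : CallReal P I) : CallReal P (stepInterp P I) := by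
  intro n p W a S s hS ha V σ θ α R M K A r hV hσ hθ hd hA hK hr
  obtain ⟨X, hX, hSX⟩ := hS.after σ
  have hform : Stack.subst σ [.fml (.atom p s)] = [.fml (.atom p fun i => substTm σ (s i))] := rfl
  rw [hform] at hd ⊢
  have hV' := inUse_finite hV hθ (.fml (.atom p fun i => substTm σ (s i)) :: α)
  obtain ⟨π, hπ⟩ := exists_perm_fresh (programFv_finite (clausesOf p P)) (hV'.union hX)
  have hfresh : Disjoint (Program.fv ((clausesOf p P).map (Clause.subst (renameBy π))))
      (inUse V θ (.fml (.atom p fun i => substTm σ (s i)) :: α)) := by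
    refine Set.disjoint_left.2 fun x hx hx2 => ?_
    obtain ⟨y, hy, hx⟩ := mem_programFv_subst _ _ hx
    rw [renameBy, fvTm_fvar, Set.mem_singleton_iff] at hx
    exact hπ y hy (.inl (hx ▸ hx2))
  have hu := using_realizes hI (P := P) (S := withFresh (after S σ) π (Program.fv (clausesOf p P)))
    (FinSupp.withFresh (hS.after σ) π (programFv_finite _)) p
    (a := fun v => a v.1) (e := fun v => v.2) (f := renameBy π) (s := fun i => substTm σ (s i))
    (fun v δ h i => by rw [substTm_substTm]; exact ha _ _ h.1 i) (clausesOf p P)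
    (fun v δ h x hx => (h.2 x hx).symm)
  have key := hu _ fvar θ α R M (fun A' => K (Prod.fst '' A')) (Prod.fst ⁻¹' A) r hV'
    dom_fvar_finite hθ ?_ (liftRel_withFresh π.injective hSX (fun y hy h => hπ y hy (.inr h)) hA)
    hK.withFresh hr
  · rw [Stack.subst_id] at key
    exact key.map fun ρ hρ => Comp.pred hfresh hρ
  · rw [Stack.subst_id, List.singleton_append, Stack.fv_cons, StackElt.fv,
      Set.disjoint_union_right, Set.disjoint_union_right]
    rw [List.singleton_append, Stack.fv_cons, Set.disjoint_union_right] at hd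
    exact ⟨⟨hd.1, Set.disjoint_left.2 fun x hx hx2 =>
      Set.disjoint_left.1 hfresh hx2 (vars_subset_inUse (.inl hx))⟩, hd.2⟩

/-- By fixed point induction: the interpretation `J` whose results are those that are realized by
computations is a prefixed point. -/
theorem sem_callReal [Infinite Var] (P : Program L Var) : CallReal P (sem P) := by
  let J : Interp L Var := fun n p W a R K A r =>
    ∀ (S : W → Subst L Var → Prop) (s : Fin n → Tm L Var 0) (V : Set Var) (θ : Subst L Var)
      (α : Stack L Var) (M : R → Subst L Var → Prop), FinSupp S →
      (∀ w δ, S w δ → ∀ i, a w i = substTm δ (s i)) → V.Finite → θ.dom.Finite →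
      Disjoint θ.dom (Stack.fv (.fml (.atom p s) :: α)) → LiftRel S A Set.univ →
      KReal P M S θ α K → Run P M V θ (.fml (.atom p s) :: α) r
  have hJ : CallReal P J := by
    intro n p W a S s hS ha V σ θ α R M K A r hV hσ hθ hd hA hK hr
    exact hr (after S σ) (fun i => substTm σ (s i)) V θ α M (hS.after σ)
      (fun w δ h i => by rw [substTm_substTm]; exact ha _ _ h i) hV hθ hd hA hK
  have hle : sem P ≤ J := sem_le fun n p W a R K A r h S s V θ α M hS ha hV hθ hd hA hK => by
    have key := hJ.step n p W a S s hS ha V fvar θ α R M K A r hV dom_fvar_finite hθ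
      (by rwa [Stack.subst_id]) hA hK h
    rwa [Stack.subst_id] at key
  intro n p W a S s hS ha V σ θ α R M K A r hV hσ hθ hd hA hK hr
  exact hJ n p W a S s hS ha V σ θ α R M K A r hV hσ hθ hd hA hK (hle n p W a R K A r hr)

/-- The denotational semantics agrees with computations. -/
theorem exists_comp [Infinite Var] {P : Program L Var} {θ : Subst L Var} (hθ : θ.dom.Finite)
    {α : Stack L Var} (hd : Disjoint θ.dom (Stack.fv α)) {X : Set Var} (hX : X.Finite)
    (hα : Stack.fv α ⊆ X) {r : Option (Set (Subst L Var))}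
    (h : denStack (sem P) id α _ ret Set.univ r) :
    Run P (Answer (fun τ δ => ∀ x ∈ X, τ x = δ x) θ) ∅ θ α r := by
  have hr := stack_realizes (W := Subst L Var) (sem_callReal P)
    (S := fun τ δ => ∀ x ∈ X, τ x = δ x) (f := fvar)
    ⟨X, hX, fun w δ δ' h1 h2 x hx => (h2 x hx).trans (h1 x hx)⟩ α
    (e := id) (fun w δ h x hx => h x (hα hx))
  rw [Stack.subst_id] at hr
  have key := hr.run (σ := fvar) (θ := θ) Set.finite_empty dom_fvar_finite hθ
    (by rwa [Stack.subst_id])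
    ⟨fun τ _ => ⟨τ, trivial, fun _ _ => rfl⟩, fun τ _ => ⟨τ, trivial, fun _ _ => rfl⟩⟩ h
  rwa [Stack.subst_id] at key

end Completeness

/-! ### Equivalence of clauses -/

section Equivalence

theorem ResSim.imp {R : Type z} {p₁ p₂ : Option R → Prop} (h : ResSim Eq p₁ p₂) {r : Option R}
    (hr : p₁ r) : p₂ r := by
  cases r with
  | none => exact h.none hr
  | some x =>
    obtain ⟨y, rfl, hy⟩ := h.some hr
    exact hy

theorem kSim_image {W W₁ W₂ R : Type z} {S : W₁ → W₂ → Prop} (K : Set W → Option R → Prop)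
    {f₁ : W₁ → W} {f₂ : W₂ → W} (hS : ∀ w₁ w₂, S w₁ w₂ → f₁ w₁ = f₂ w₂) :
    KSim S Eq (fun A => K (f₁ '' A)) (fun A => K (f₂ '' A)) := by
  intro A₁ A₂ hA r hr
  have h := liftRel_eq.1 (hA.image (S := Eq) hS)
  rw [h] at hr
  exact ⟨r, by cases r <;> constructor; rfl, hr⟩

theorem Goal.eq_of_gSim {W : Type z} {g h : Goal W} (h₁ : GSim Eq g h) (h₂ : GSim Eq h g) :
    g = h := by
  funext R K A r
  have hK : KSim Eq Eq K K := by
    simpa using kSim_image (S := Eq) K (f₁ := id) (f₂ := id) fun _ _ h => h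
  exact propext ⟨(h₁ (liftRel_eq.2 rfl) hK).imp, (h₂ (liftRel_eq.2 rfl) hK).imp⟩

/-- Least fixed points of step functions that agree on the invariant, deterministic
interpretations are equal. -/
theorem sem_eq [DecidableEq Var] {Q Q' : Program L Var}
    (h : ∀ I : Interp L Var, InterpSim I I → InterpDet I I → stepInterp Q I = stepInterp Q' I) :
    sem Q = sem Q' := by
  apply le_antisymm
  · refine sem_le (le_of_eq ?_)
    rw [h _ (sem_sim Q') (sem_det Q'), stepInterp_sem]
  · refine sem_le (le_of_eq ?_)
    rw [← h _ (sem_sim Q) (sem_det Q), stepInterp_sem]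

theorem clausesOf_append {n : ℕ} (p : L.Relations n) (P Q : Program L Var) :
    clausesOf p (P ++ Q) = clausesOf p P ++ clausesOf p Q := List.filter_append ..

theorem clausesOf_cons_of_eq {n : ℕ} (p : L.Relations n) {c : Clause L Var} (h : c.symb = ⟨n, p⟩)
    (P : Program L Var) : clausesOf p (c :: P) = c :: clausesOf p P := by
  simp [clausesOf, h]

theorem clausesOf_cons_of_ne {n : ℕ} (p : L.Relations n) {c : Clause L Var} (h : c.symb ≠ ⟨n, p⟩)
    (P : Program L Var) : clausesOf p (c :: P) = clausesOf p P := by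
  simp [clausesOf, h]

theorem clausesOf_eq_nil {n : ℕ} (p : L.Relations n) {P : Program L Var}
    (h : ∀ c ∈ P, c.symb ≠ ⟨n, p⟩) : clausesOf p P = [] := by
  simpa [clausesOf] using h

/-- Calls of `p` have the same results by means of the clauses `γ` and `γ'`. -/
def SameCalls (I : Interp L Var) {n : ℕ} (p : L.Relations n) (γ γ' : List (Clause L Var)) : Prop :=
  ∀ (W : Type (max u w)) (a : W → Fin n → Tm L Var 0),
    (denUsing I p (fun v : W × Subst L Var => a v.1) (fun v => v.2) γ).hide Prod.fst =
      (denUsing I p (fun v : W × Subst L Var => a v.1) (fun v => v.2) γ').hide Prod.fst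

variable {I : Interp L Var} {W : Type (max u w)}

/-- Only the results of the alternatives from the same state and continuation matter. -/
theorem denClause_alt_congr (e : W → Subst L Var) {k k' g : Goal W} (η : List (BodyElt L Var))
    {R : Type (max u w)} {K : Set W → Option R → Prop} {A : Set W}
    (h : ∀ r, k R K A r ↔ k' R K A r) (r : Option R) :
    denClause I e k g η R K A r ↔ denClause I e k' g η R K A r := by
  rcases body_cases η with ⟨η₁, rfl⟩ | ⟨η₁, η₂, rfl⟩
  · simp only [denClause_noCuts, orElse, h]
  · simp only [denClause_cut, cutThen, h]

theorem SameCalls.append {n : ℕ} {p : L.Relations n} {γ γ' : List (Clause L Var)}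
    (h : SameCalls I p γ γ') (γ₀ : List (Clause L Var)) : SameCalls I p (γ₀ ++ γ) (γ₀ ++ γ') := by
  intro W a
  induction γ₀ with
  | nil => exact h W a
  | cons c γ₀ ih =>
    funext R K A r
    apply propext
    simp only [List.cons_append, Goal.hide, denUsing]
    refine and_congr_right fun _ => denClause_alt_congr _ _ (fun r => ?_) r
    exact iff_of_eq (congrFun (congrFun (congrFun (congrFun ih R) K) A) r)

theorem stepInterp_eq_of_sameCalls {Q Q' : Program L Var}
    (h : ∀ (n : ℕ) (p : L.Relations n), SameCalls I p (clausesOf p Q) (clausesOf p Q')) :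
    stepInterp Q I = stepInterp Q' I := by
  funext n p W a
  exact h n p W a

theorem sameCalls_replace {P₁ P₂ : Program L Var} {m : ℕ} {q : L.Relations m}
    {t t' : Fin m → Tm L Var 0} {η η' : List (BodyElt L Var)}
    (h : SameCalls I q (⟨q, t, η⟩ :: clausesOf q P₂) (⟨q, t', η'⟩ :: clausesOf q P₂)) {n : ℕ}
    (p : L.Relations n) : SameCalls I p (clausesOf p (P₁ ++ ⟨q, t, η⟩ :: P₂))
      (clausesOf p (P₁ ++ ⟨q, t', η'⟩ :: P₂)) := by
  by_cases hp : (⟨m, q⟩ : Σ n, L.Relations n) = ⟨n, p⟩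
  · cases hp
    rw [clausesOf_append, clausesOf_append, clausesOf_cons_of_eq q (c := ⟨q, t, η⟩) rfl,
      clausesOf_cons_of_eq q (c := ⟨q, t', η'⟩) rfl]
    exact h.append _
  · rw [clausesOf_append, clausesOf_append, clausesOf_cons_of_ne p (c := ⟨q, t, η⟩) hp,
      clausesOf_cons_of_ne p (c := ⟨q, t', η'⟩) hp]
    exact fun _ _ => rfl

/-- It suffices to compare the first clauses, with arbitrary alternatives. -/
theorem sameCalls_cons {n : ℕ} {q : L.Relations n} {t t' : Fin n → Tm L Var 0}
    {η η' : List (BodyElt L Var)} {γ : List (Clause L Var)}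
    (h : ∀ (W : Type (max u w)) (a : W → Fin n → Tm L Var 0) (k : Goal (W × Subst L Var))
      (R : Type (max u w)) (K : Set W → Option R → Prop) (A : Set W) (r : Option R),
      denClause I (fun v => v.2) k
          (constrain {v : W × Subst L Var | ∀ i, a v.1 i = substTm v.2 (t i)}) η R
          (fun A' => K (Prod.fst '' A')) (Prod.fst ⁻¹' A) r ↔
        denClause I (fun v => v.2) k
          (constrain {v : W × Subst L Var | ∀ i, a v.1 i = substTm v.2 (t' i)}) η' R
          (fun A' => K (Prod.fst '' A')) (Prod.fst ⁻¹' A) r) :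
    SameCalls I q (⟨q, t, η⟩ :: γ) (⟨q, t', η'⟩ :: γ) := by
  intro W a
  rw [denUsing_cons, denUsing_cons]
  funext R K A r
  exact propext (h W a _ R K A r)

end Equivalence

/-! ### Rewriting clause bodies -/

section Body

/-- The bodies `η` and `η'` have the same denotation in all contexts. -/
def BodyEquiv (I : Interp L Var) (η η' : List (BodyElt L Var)) : Prop :=
  ∀ (W : Type (max u w)) (e : W → Subst L Var),
    (∀ k g, denClause I e k g η = denClause I e k g η') ∧ ∀ g, denBody I e g η = denBody I e g η'

variable {I : Interp L Var} {η η' : List (BodyElt L Var)}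

theorem BodyEquiv.append (h : BodyEquiv I η η') (η₀ : List (BodyElt L Var)) :
    BodyEquiv I (η₀ ++ η) (η₀ ++ η') := by
  induction η₀ with
  | nil => exact h
  | cons b η₀ ih =>
    intro W e
    cases b with
    | fml F => exact ⟨fun k g => (ih W e).1 k _, fun g => (ih W e).2 _⟩
    | cut =>
      refine ⟨fun k g => ?_, fun g => ?_⟩
      · simp only [List.cons_append, denClause, (ih W e).2]
      · simp only [List.cons_append, denBody, (ih W e).2]

theorem denF_trueF (zero : L.Term Empty) {W : Type (max u w)} (e : W → Subst L Var) :
    denF I (trueF zero) e = skip := by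
  rw [← constrain_univ]
  simp only [denF, trueF, den]
  exact congrArg _ (Set.eq_univ_of_forall fun _ => trivial)

theorem bodyEquiv_conjStep (h : ConjStep η η') : BodyEquiv I η η' := by
  obtain ⟨⟩ := h
  refine BodyEquiv.append (fun W e => ?_) _
  exact ⟨fun _ _ => rfl, fun _ => rfl⟩

theorem bodyEquiv_emptyStep {zero : L.Term Empty} (h : EmptyStep zero η η') :
    BodyEquiv I η η' := by
  obtain ⟨⟩ := h
  intro W e
  simp [denClause, denBody, denF_trueF, seq_skip]

theorem bodyEquiv_cutCutStep (h : CutCutStep η η') : BodyEquiv I η η' := by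
  obtain ⟨⟩ := h
  refine BodyEquiv.append (fun W e => ?_) _
  simp [denClause, denBody, once_skip, skip_seq]

theorem bodyEquiv_initialCutStep {zero : L.Term Empty} (h : InitialCutStep zero η η') :
    BodyEquiv I η η' := by
  obtain ⟨⟩ := h
  intro W e
  simp [denClause, denBody, denF_trueF, seq_skip]

theorem bodyEquiv_finalCutStep {zero : L.Term Empty} (h : FinalCutStep zero η η') :
    BodyEquiv I η η' := by
  obtain ⟨⟩ := h
  refine BodyEquiv.append (fun W e => ?_) _
  simp [denClause, denBody, denF_trueF, seq_skip]

theorem BodyEquiv.sameCalls (h : BodyEquiv I η η') {n : ℕ} (q : L.Relations n)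
    (t : Fin n → Tm L Var 0) (γ : List (Clause L Var)) :
    SameCalls I q (⟨q, t, η⟩ :: γ) (⟨q, t, η'⟩ :: γ) :=
  sameCalls_cons fun W a k R K A r => by rw [(h _ _).1]

/-- The programs `Q` and `Q'` have the same denotation, and the predicate symbols of `Q` occur in
`Q'`. -/
def Preserves (Q Q' : Program L Var) : Prop := sem Q = sem Q' ∧ Q.preds ⊆ Q'.preds

theorem Preserves.trans {P Q Q' : Program L Var} (h : Preserves P Q) (h' : Preserves Q Q') :
    Preserves P Q' := ⟨h.1.trans h'.1, h.2.trans h'.2⟩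

theorem preserves_of_reflTransGen {step : Program L Var → Program L Var → Prop}
    (h : ∀ Q Q', step Q Q' → Preserves Q Q') {Q Q' : Program L Var}
    (hQ : Relation.ReflTransGen step Q Q') : Preserves Q Q' := by
  induction hQ with
  | refl => exact ⟨rfl, subset_rfl⟩
  | tail _ h' ih => exact ih.trans (h _ _ h')

theorem programPreds_append (P Q : Program L Var) :
    (P ++ Q).preds = P.preds ∪ Q.preds := by
  ext p
  simp [Program.preds, or_and_right, exists_or]

theorem programPreds_cons (c : Clause L Var) (Q : Program L Var) :
    Program.preds (c :: Q) = c.preds ∪ Q.preds := by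
  ext p
  simp [Program.preds]

theorem programPreds_replace {P₁ P₂ : Program L Var} {c c' : Clause L Var}
    (h : c.preds ⊆ c'.preds) :
    Program.preds (P₁ ++ c :: P₂) ⊆ Program.preds (P₁ ++ c' :: P₂) := by
  rw [programPreds_append, programPreds_append, programPreds_cons, programPreds_cons]
  gcongr

theorem preserves_bodyLoop [DecidableEq Var]
    {r : List (BodyElt L Var) → List (BodyElt L Var) → Prop}
    (h : ∀ I : Interp L Var, ∀ η η', r η η' → BodyEquiv I η η')
    (hp : ∀ η η' : List (BodyElt L Var), r η η' → ∀ b ∈ η, ∀ p ∈ b.preds, ∃ b ∈ η', p ∈ b.preds)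
    {Q Q' : Program L Var} (hQ : BodyLoop r Q Q') : Preserves Q Q' := by
  refine preserves_of_reflTransGen (fun Q Q' hs => ?_) hQ.1
  obtain @⟨P₁, P₂, c, c', η', hr, rfl⟩ := hs
  obtain ⟨q, t, η⟩ := c
  refine ⟨sem_eq fun I _ _ => stepInterp_eq_of_sameCalls fun n p =>
    sameCalls_replace ((h I _ _ hr).sameCalls q t _) p, programPreds_replace ?_⟩
  rintro p (hc | ⟨b, hb, hpb⟩)
  · exact .inl hc
  · exact .inr (hp _ _ hr b hb p hpb)

end Body

/-! ### Standard heads -/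

section Heads

variable [DecidableEq Var] {I : Interp L Var}

/-- A clause simulates another one with the same body, if the goals before the body and the
alternatives do. The alternatives are compared only for the given states and continuations. -/
theorem denClause_imp (h : InterpSim I I) {W₁ W₂ R : Type (max u w)} {S : W₁ → W₂ → Prop}
    (η : List (BodyElt L Var)) {e₁ : W₁ → Subst L Var} {e₂ : W₂ → Subst L Var}
    (he : ∀ w₁ w₂, S w₁ w₂ → ∀ x ∈ bodyFv η, e₁ w₁ x = e₂ w₂ x)
    {K₁ : Set W₁ → Option R → Prop} {K₂ : Set W₂ → Option R → Prop} (hK : KSim S Eq K₁ K₂)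
    {A₁ : Set W₁} {A₂ : Set W₂} {g₁ k₁ : Goal W₁} {g₂ k₂ : Goal W₂}
    (hk : ∀ r, k₁ R K₁ A₁ r → k₂ R K₂ A₂ r) (hg : GSimAt S A₁ A₂ g₁ g₂) {r : Option R}
    (hr : denClause I e₁ k₁ g₁ η R K₁ A₁ r) : denClause I e₂ k₂ g₂ η R K₂ A₂ r := by
  rcases body_cases η with ⟨η₁, rfl⟩ | ⟨η₁, η₂, rfl⟩
  · rw [denClause_noCuts] at hr ⊢
    have hg' := hg.seq (denStack_sim h (goals η₁) (by rwa [fv_goals]))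
    rcases hr with ⟨hx, h1⟩ | ⟨h1, h2⟩
    · exact .inl ⟨hx, (hg' hK).imp h1⟩
    · exact .inr ⟨(hg' hK).imp h1, hk _ h2⟩
  · rw [denClause_cut] at hr ⊢
    rw [fv_body_cut] at he
    have hg' := hg.seq (denStack_sim h (goals η₁) (e₁ := e₁) (e₂ := e₂) (by
      rw [fv_goals]
      exact fun w₁ w₂ hS x hx => he w₁ w₂ hS x (.inl hx)))
    rcases hr with ⟨A', h1, h2⟩ | ⟨h1, h2⟩
    · obtain ⟨A'', hA, h3⟩ := (hg' kSim_ret).some h1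
      exact .inl ⟨A'', h3, (denBody_sim h η₂ (fun w₁ w₂ hS x hx => he w₁ w₂ hS x (.inr hx))
        (GSim.skip hA) hK).imp h2⟩
    · exact .inr ⟨(hg' kSim_ret).none h1, hk _ h2⟩

theorem substTm_args_congr {n : ℕ} {p : L.Relations n} {t : Fin n → Tm L Var 0}
    {η : List (BodyElt L Var)} {σ τ : Subst L Var}
    (h : ∀ z ∈ Clause.fv ⟨p, t, η⟩, σ z = τ z) (i : Fin n) :
    substTm σ (t i) = substTm τ (t i) :=
  substTm_congr _ fun z hz => h z (.inl (Set.mem_iUnion.2 ⟨i, hz⟩))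

/-- Renaming `y` to a variable `x` that does not occur in the clause. -/
theorem sameCalls_rename (hI : InterpSim I I) {n : ℕ} {p : L.Relations n} {t : Fin n → Tm L Var 0}
    {η : List (BodyElt L Var)} {x y : Var} (hx : x ∉ Clause.fv ⟨p, t, η⟩)
    (γ : List (Clause L Var)) :
    SameCalls I p (⟨p, t, η⟩ :: γ) (Clause.subst (single y (fvar x)) ⟨p, t, η⟩ :: γ) := by
  set σ : Subst L Var := single y (fvar x) with hσ
  refine sameCalls_cons fun W a k R K A r => ?_
  rw [denClause_subst]
  simp only [substTm_substTm]
  let S : W × Subst L Var → W × Subst L Var → Prop := fun v₁ v₂ =>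
    v₁.1 = v₂.1 ∧ ∀ z ∈ Clause.fv ⟨p, t, η⟩, v₁.2 z = σ.comp v₂.2 z
  have hA : LiftRel S (Prod.fst ⁻¹' A) (Prod.fst ⁻¹' A) := by
    refine ⟨fun v hv => ⟨(v.1, Function.update v.2 x (v.2 y)), hv, rfl, fun z hz => ?_⟩,
      fun v hv => ⟨(v.1, σ.comp v.2), hv, rfl, fun _ _ => rfl⟩⟩
    have hzx : z ≠ x := fun h => hx (h ▸ hz)
    change v.2 z = substTm (Function.update v.2 x (v.2 y)) (single y (fvar x) z)
    by_cases hzy : z = y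
    · rw [hzy, single_self, substTm_fvar, Function.update_self]
    · rw [single_of_ne _ hzy, substTm_fvar, Function.update_of_ne hzx]
  have hhead : ∀ v₁ v₂, S v₁ v₂ → (v₁ ∈ {v : W × Subst L Var | ∀ i, a v.1 i = substTm v.2 (t i)} ↔
      v₂ ∈ {v : W × Subst L Var | ∀ i, a v.1 i = substTm (σ.comp v.2) (t i)}) := by
    rintro ⟨w₁, d₁⟩ ⟨w₂, d₂⟩ ⟨h1, h2⟩
    cases h1
    have := substTm_args_congr h2
    simp only [Set.mem_ofPred_eq, this]
  constructor
  · exact denClause_imp hI η (fun v₁ v₂ h z hz => h.2 z (.inr hz))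
      (kSim_image K fun _ _ h => h.1) (fun _ h => h) (GSim.constrain hhead hA)
  · exact denClause_imp hI η (S := fun v₂ v₁ => S v₁ v₂)
      (fun v₁ v₂ h z hz => (h.2 z (.inr hz)).symm)
      (kSim_image K fun _ _ h => h.1.symm) (fun _ h => h)
      (GSim.constrain (fun v₁ v₂ h => (hhead v₂ v₁ h).symm) hA.symm)

/-- An argument of the head can be replaced by a variable `x` that does not occur in the clause and
is equated to it: the value of `x` is that of the argument of the call. -/
theorem sameCalls_equate (hI : InterpSim I I) {n : ℕ} {p : L.Relations n} {t : Fin n → Tm L Var 0}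
    {η : List (BodyElt L Var)} {x : Var} (hx : x ∉ Clause.fv ⟨p, t, η⟩) (k : Fin n)
    (γ : List (Clause L Var)) :
    SameCalls I p (⟨p, t, η⟩ :: γ)
      (⟨p, Function.update t k (fvar x), .fml (.eq (fvar x) (t k)) :: η⟩ :: γ) := by
  refine sameCalls_cons fun W a alt R K A r => ?_
  have hden : denF I (.eq (fvar x) (t k)) (fun v : W × Subst L Var => v.2) =
      constrain {v | v.2 x = substTm v.2 (t k)} := rfl
  rw [denClause, hden, constrain_seq_constrain]
  set X₁ := {v : W × Subst L Var | ∀ i, a v.1 i = substTm v.2 (t i)} with hX₁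
  set X₂ := {v : W × Subst L Var | ∀ i, a v.1 i = substTm v.2 (Function.update t k (fvar x) i)} ∩
    {v | v.2 x = substTm v.2 (t k)} with hX₂
  let S : W × Subst L Var → W × Subst L Var → Prop := fun v₁ v₂ =>
    v₁.1 = v₂.1 ∧ ∀ z ∈ Clause.fv ⟨p, t, η⟩, v₁.2 z = v₂.2 z
  have hA : LiftRel S (Prod.fst ⁻¹' A ∩ X₁) (Prod.fst ⁻¹' A ∩ X₂) := by
    constructor
    · rintro ⟨w, d⟩ ⟨hw, hd⟩
      have hd' : ∀ z ∈ Clause.fv ⟨p, t, η⟩, d z = Function.update d x (a w k) z := fun z hz => by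
        have hzx : z ≠ x := fun h => hx (h ▸ hz)
        rw [Function.update_of_ne hzx]
      refine ⟨(w, Function.update d x (a w k)), ⟨hw, fun i => ?_, ?_⟩, rfl, hd'⟩
      · change a w i = substTm (Function.update d x (a w k)) (Function.update t k (fvar x) i)
        by_cases hi : i = k
        · rw [hi, Function.update_self, substTm_fvar, Function.update_self]
        · rw [Function.update_of_ne hi, ← substTm_args_congr hd' i]
          exact hd i
      · change Function.update d x (a w k) x = substTm (Function.update d x (a w k)) (t k)
        rw [Function.update_self, ← substTm_args_congr hd' k]
        exact hd k
    · rintro ⟨w, d⟩ ⟨hw, hd, hdk⟩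
      refine ⟨(w, d), ⟨hw, fun i => ?_⟩, rfl, fun _ _ => rfl⟩
      have h1 := hd i
      by_cases hi : i = k
      · rw [hi] at h1 ⊢
        rw [Function.update_self, substTm_fvar] at h1
        exact h1.trans hdk
      · rwa [Function.update_of_ne hi] at h1
  constructor
  · exact denClause_imp hI η (fun v₁ v₂ h z hz => h.2 z (.inr hz))
      (kSim_image K fun _ _ h => h.1) (fun _ h => h)
      (GSimAt.constrain (S' := Eq) (liftRel_eq.2 rfl) hA)
  · exact denClause_imp hI η (S := fun v₂ v₁ => S v₁ v₂)
      (fun v₁ v₂ h z hz => (h.2 z (.inr hz)).symm)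
      (kSim_image K fun _ _ h => h.1.symm) (fun _ h => h)
      (GSimAt.constrain (S' := Eq) (liftRel_eq.2 rfl) hA.symm)

/-- The variables `x₁, x₂, …` occur in the clause only where its head has already been made
standard. -/
def HeadInv (x : ℕ → Var) (c : Clause L Var) : Prop :=
  ∀ i, x i ∈ c.fv → i < c.arity ∧ ∀ j : Fin c.arity, i ≤ j → c.args j = fvar (x j)

theorem HeadInv.notMem {x : ℕ → Var} {n : ℕ} {p : L.Relations n} {t : Fin n → Tm L Var 0}
    {η : List (BodyElt L Var)} (h : HeadInv x ⟨p, t, η⟩) {k : Fin n} (hk : t k ≠ fvar (x k)) :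
    x k ∉ Clause.fv ⟨p, t, η⟩ := fun hx => hk ((h k hx).2 k le_rfl)

theorem mem_clauseFv_subst (σ : Subst L Var) (c : Clause L Var) {y : Var}
    (h : y ∈ (c.subst σ).fv) : ∃ x ∈ c.fv, y ∈ fvTm (σ x) := by
  rcases h with h | h
  · obtain ⟨x, hx, hy⟩ := mem_iUnion_fv_subst σ c.args h
    exact ⟨x, .inl hx, hy⟩
  · obtain ⟨x, hx, hy⟩ := mem_bodyFv_subst σ c.body h
    exact ⟨x, .inr hx, hy⟩

theorem HeadInv.step {x : ℕ → Var} (hx : Function.Injective x) {c c' : Clause L Var}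
    (h : HeadInv x c) (hs : HeadStep x c c') : HeadInv x c' := by
  cases hs with
  | @rename n p t η k y hlt hk hy hne =>
    intro i hi
    change i < n ∧ ∀ j : Fin n, i ≤ j → substTm _ (t j) = fvar (x j)
    obtain ⟨z, hz, hzi⟩ := mem_clauseFv_subst _ _ hi
    have hsub : ∀ j : Fin n, t j = fvar (x j) →
        substTm (single y (fvar (x k))) (t j) = fvar (x j) := fun j hj => by
      rw [hj, substTm_fvar, single_of_ne _ (hne j).symm]
    by_cases hzy : z = y
    · rw [hzy, single_self, fvTm_fvar, Set.mem_singleton_iff] at hzi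
      rw [hx hzi]
      refine ⟨k.2, fun j hj => ?_⟩
      rcases eq_or_lt_of_le hj with hj | hj
      · rw [← Fin.ext hj, hy, substTm_fvar, single_self]
      · exact hsub j (hlt j hj)
    · rw [single_of_ne _ hzy, fvTm_fvar, Set.mem_singleton_iff] at hzi
      have := h i (hzi ▸ hz)
      exact ⟨this.1, fun j hj => hsub j (this.2 j hj)⟩
  | @equate n p t η k hlt hk _ =>
    intro i hi
    change i < n ∧ ∀ j : Fin n, i ≤ j → Function.update t k (fvar (x k)) j = fvar (x j)
    have hcases : x i = x k ∨ x i ∈ Clause.fv ⟨p, t, η⟩ := by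
      rcases hi with hi | hi
      · obtain ⟨j, hj⟩ := Set.mem_iUnion.1 hi
        change x i ∈ fvTm (Function.update t k (fvar (x k)) j) at hj
        by_cases hjk : j = k
        · rw [hjk, Function.update_self, fvTm_fvar] at hj
          exact .inl hj
        · rw [Function.update_of_ne hjk] at hj
          exact .inr (.inl (Set.mem_iUnion.2 ⟨j, hj⟩))
      · rw [bodyFv_cons] at hi
        rcases hi with (hi | hi) | hi
        · rw [fvTm_fvar] at hi
          exact .inl hi
        · exact .inr (.inl (Set.mem_iUnion.2 ⟨k, hi⟩))
        · exact .inr (.inr hi)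
    rcases hcases with hik | hi
    · rw [hx hik]
      refine ⟨k.2, fun j hj => ?_⟩
      rcases eq_or_lt_of_le hj with hj | hj
      · rw [← Fin.ext hj, Function.update_self]
      · have hjk : j ≠ k := fun h => absurd hj (h ▸ lt_irrefl _)
        rw [Function.update_of_ne hjk]
        exact hlt j hj
    · obtain ⟨h1, h2⟩ := h i hi
      refine ⟨h1, fun j hj => ?_⟩
      by_cases hjk : j = k
      · rw [hjk, Function.update_self]
      · rw [Function.update_of_ne hjk]
        exact h2 j hj

omit [DecidableEq Var] in
theorem Formula.preds_bind {k : ℕ} (B : Formula L Var k) {m : ℕ} (f : Var ⊕ Fin k → Tm L Var m) :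
    (B.bind f).preds = B.preds := by
  induction B generalizing m with
  | eq s t => rfl
  | atom p ts => rfl
  | conj B C ihB ihC => simp [Formula.bind, Formula.preds, ihB, ihC]
  | disj B C ihB ihC => simp [Formula.bind, Formula.preds, ihB, ihC]
  | neg B ihB => simp [Formula.bind, Formula.preds, ihB]
  | ex B ihB => simp [Formula.bind, Formula.preds, ihB]
  | ifthen n B C ihB ihC => simp [Formula.bind, Formula.preds, ihB, ihC]

omit [DecidableEq Var] in
theorem Clause.preds_subst (σ : Subst L Var) (c : Clause L Var) : (c.subst σ).preds = c.preds := by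
  have : ∀ b : BodyElt L Var, (b.subst σ).preds = b.preds := fun b => by
    cases b with
    | fml F => exact Formula.preds_bind F _
    | cut => rfl
  ext p
  simp [Clause.preds, Clause.subst, Clause.symb, this]

/-- While the heads are made standard, the denotation does not change. -/
theorem preserves_headLoop {x : ℕ → Var} (hx : Function.Injective x) {P Q : Program L Var}
    (hP : ∀ i, x i ∉ P.fv) (h : Relation.ReflTransGen (ReplaceClause (HeadStep x)) P Q) :
    Preserves P Q := by
  suffices H : Preserves P Q ∧ ∀ c ∈ Q, HeadInv x c from H.1
  induction h with
  | refl =>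
    exact ⟨⟨rfl, subset_rfl⟩, fun c hc i hi => (hP i ⟨c, hc, hi⟩).elim⟩
  | tail _ hs ih =>
    obtain @⟨P₁, P₂, c, c', hc⟩ := hs
    have hinv : HeadInv x c := ih.2 c (by simp)
    refine ⟨ih.1.trans ⟨sem_eq fun I hI _ => stepInterp_eq_of_sameCalls fun n p => ?_,
      programPreds_replace ?_⟩, fun d hd => ?_⟩
    · cases hc with
      | rename hlt hk hy hne => exact sameCalls_replace (sameCalls_rename hI (hinv.notMem hk) _) p
      | equate hlt hk _ => exact sameCalls_replace (sameCalls_equate hI (hinv.notMem hk) _ _) p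
    · cases hc with
      | rename hlt hk hy hne => rw [Clause.preds_subst]
      | equate hlt hk _ =>
        rintro q (hq | ⟨b, hb, hq⟩)
        · exact .inl hq
        · exact .inr ⟨b, List.mem_cons_of_mem _ hb, hq⟩
    · simp only [List.mem_append, List.mem_cons] at hd
      rcases hd with hd | rfl | hd
      · exact ih.2 d (by simp [hd])
      · exact hinv.step hx hc
      · exact ih.2 d (by simp [hd])

end Heads

/-! ### Binding the local variables of a clause -/

section Scope

variable [DecidableEq Var] {I : Interp L Var} {W : Type (max u w)}

omit [DecidableEq Var] in
theorem Goal.hide_id {W : Type z} (g : Goal W) : g.hide id = g := by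
  funext R K A
  simp [Goal.hide]

omit [DecidableEq Var] in
theorem Goal.hide_hide {W₁ W₂ W₃ : Type z} (f : W₁ → W₂) (f' : W₂ → W₃) (g : Goal W₁) :
    (g.hide f).hide f' = g.hide (f' ∘ f) := by
  funext R K A
  simp [Goal.hide, Set.image_image, Set.preimage_preimage]
  rfl

omit [DecidableEq Var] in
/-- Hiding additional variables on both sides of an equivalence. -/
theorem hide_eq_hide {W W₁ W₂ : Type z} {S : W₁ → W₂ → Prop} {f₁ : W₁ → W} {f₂ : W₂ → W}
    {g₁ : Goal W₁} {g₂ : Goal W₂} (h : GSim S g₁ g₂) (h' : GSim (fun v₂ v₁ => S v₁ v₂) g₂ g₁)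
    (hS : ∀ v₁ v₂, S v₁ v₂ → f₁ v₁ = f₂ v₂) (h₁ : ∀ v₁, ∃ v₂, S v₁ v₂) (h₂ : ∀ v₂, ∃ v₁, S v₁ v₂) :
    g₁.hide f₁ = g₂.hide f₂ := by
  apply Goal.eq_of_gSim
  · refine h.hide hS (fun v₁ w hw => ?_) (fun w v₂ hw => ?_)
    · obtain ⟨v₂, hv⟩ := h₁ v₁
      exact ⟨v₂, (hS _ _ hv).symm.trans hw, hv⟩
    · obtain ⟨v₁, hv⟩ := h₂ v₂
      exact ⟨v₁, (hS _ _ hv).trans hw.symm, hv⟩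
  · refine h'.hide (fun v₂ v₁ hv => (hS _ _ hv).symm) (fun v₂ w hw => ?_) (fun w v₁ hw => ?_)
    · obtain ⟨v₁, hv⟩ := h₂ v₂
      exact ⟨v₁, (hS _ _ hv).trans hw, hv⟩
    · obtain ⟨v₂, hv⟩ := h₁ v₁
      exact ⟨v₂, (hS _ _ hv).symm.trans hw.symm, hv⟩

/-- The values of the variables when those of `ys` are local: they are given by the second
component. -/
def localEnv (ys : List Var) (e : W → Subst L Var) (v : W × Subst L Var) : Subst L Var :=
  fun x => if x ∈ ys then v.2 x else e v.1 x

/-- The values of the variables when those of `ys` are the bound variables `ts`. -/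
def boundEnv (ys : List Var) (e : W → Subst L Var) (v : W × (Fin ys.length → Tm L Var 0)) :
    Subst L Var :=
  fun x => if h : x ∈ ys then v.2 ⟨ys.idxOf x, List.idxOf_lt_length_of_mem h⟩ else e v.1 x

/-- A closed formula has the same values as the original one, if the bound variables take the place
of `ys`. -/
theorem den_close (ys : List Var) (F : Formula L Var 0) (e : W → Subst L Var) :
    den I (F.close ys) (fun v : W × (Fin ys.length → Tm L Var 0) => extEnv (e v.1).env v.2) =
      denF I F (boundEnv ys e) := by
  rw [Formula.close, den_bind, denF]
  congr 1
  funext v z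
  rcases z with x | i
  · by_cases hx : x ∈ ys
    · simp only [Sum.elim_inl, hx, dif_pos, bvar, FirstOrder.Language.Term.subst, extEnv_natAdd,
        Subst.env_inl, boundEnv]
    · simp [boundEnv, hx, fvar, FirstOrder.Language.Term.subst]
  · exact i.elim0

theorem boundEnv_eq_localEnv (ys : List Var) (e : W → Subst L Var)
    (v : W × (Fin ys.length → Tm L Var 0)) :
    boundEnv ys e v = localEnv ys e
      (v.1, fun x =>
        if h : x ∈ ys then v.2 ⟨ys.idxOf x, List.idxOf_lt_length_of_mem h⟩ else fvar x) := by
  funext x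
  by_cases hx : x ∈ ys <;> simp [boundEnv, localEnv, hx]

theorem boundEnv_get (ys : List Var) (e : W → Subst L Var) (v : W × Subst L Var) :
    boundEnv ys e (v.1, fun i => v.2 (ys.get i)) = localEnv ys e v := by
  funext x
  by_cases hx : x ∈ ys <;> simp [boundEnv, localEnv, hx]

/-- The bound variables of `ifs ys F G` may be regarded as local variables with the names `ys`. -/
theorem denF_ifs (hI : InterpSim I I) (ys : List Var) (F G : Formula L Var 0)
    (e : W → Subst L Var) : denF I (ifs ys F G) e =
      ((denF I F (localEnv ys e)).once.seq (denF I G (localEnv ys e))).hide Prod.fst := by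
  have : denF I (ifs ys F G) e =
      ((denF I F (boundEnv ys e)).once.seq (denF I G (boundEnv ys e))).hide Prod.fst := by
    rw [← den_close, ← den_close]
    rfl
  rw [this]
  refine hide_eq_hide (S := fun v₁ v₂ => v₁.1 = v₂.1 ∧ boundEnv ys e v₁ = localEnv ys e v₂)
    (.seq (.once ?_) ?_) (.seq (.once ?_) ?_) (fun _ _ h => h.1)
    (fun v => ⟨_, rfl, boundEnv_eq_localEnv ys e v⟩) (fun v => ⟨_, rfl, boundEnv_get ys e v⟩)
  · exact denF_sim hI F fun _ _ h x _ => by rw [h.2]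
  · exact denF_sim hI G fun _ _ h x _ => by rw [h.2]
  · exact denF_sim hI F fun _ _ h x _ => by rw [h.2]
  · exact denF_sim hI G fun _ _ h x _ => by rw [h.2]

/-- The bound variables of `exs ys G` may be regarded as local variables with the names `ys`. -/
theorem denF_exs (hI : InterpSim I I) (ys : List Var) (G : Formula L Var 0)
    (e : W → Subst L Var) :
    denF I (exs ys G) e = (denF I G (localEnv ys e)).hide Prod.fst := by
  induction ys generalizing W with
  | nil =>
    rw [exs, ← Goal.hide_id (denF I G e)]
    refine hide_eq_hide (S := fun w (v : W × Subst L Var) => w = v.1)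
      (denF_sim hI G ?_) (denF_sim hI G ?_)
      (fun _ _ h => h) (fun w => ⟨(w, fvar), rfl⟩) (fun v => ⟨_, rfl⟩)
    · rintro w v rfl x -
      simp [localEnv]
    · rintro v w rfl x -
      simp [localEnv]
  | cons y ys ih =>
    have : denF I (exs (y :: ys) G) e = (denF I (exs ys G) (boundEnv [y] e)).hide Prod.fst := by
      rw [← den_close]
      rfl
    rw [this, ih, Goal.hide_hide]
    refine hide_eq_hide (S := fun v₁ v₂ => v₁.1.1 = v₂.1 ∧
      localEnv ys (boundEnv [y] e) v₁ = localEnv (y :: ys) e v₂)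
      (denF_sim hI G fun _ _ h x _ => by rw [h.2]) (denF_sim hI G fun _ _ h x _ => by rw [h.2])
      (fun _ _ h => h.1) (fun v => ⟨(v.1.1, fun x => if x ∈ ys then v.2 x else v.1.2 0), rfl, ?_⟩)
      (fun v => ⟨((v.1, fun _ => v.2 y), v.2), rfl, ?_⟩)
    · funext x
      by_cases hx : x ∈ ys
      · simp [localEnv, hx]
      · by_cases hxy : x = y <;> simp [localEnv, boundEnv, hx, hxy]
    · funext x
      by_cases hx : x ∈ ys
      · simp [localEnv, hx]
      · by_cases hxy : x = y <;> simp [localEnv, boundEnv, hx, hxy]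

/-- The relation between the worlds of a clause and the worlds that have local variables `ys` in
addition. -/
def ScopeRel (ys : List Var) (v : W × Subst L Var) (v' : (W × Subst L Var) × Subst L Var) : Prop :=
  v.1 = v'.1.1 ∧ v.2 = localEnv ys (fun v => v.2) v'

theorem liftRel_scopeRel {ys : List Var} {B : Set (W × Subst L Var)}
    (hB : ∀ v ∈ B, ∀ d : Subst L Var, (∀ x ∉ ys, d x = v.2 x) → (v.1, d) ∈ B) :
    LiftRel (ScopeRel ys) B (Prod.fst ⁻¹' B) := by
  refine ⟨fun v hv => ⟨(v, v.2), hv, rfl, ?_⟩, fun v hv => ⟨(v.1.1, localEnv ys (fun v => v.2) v),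
    hB _ hv _ fun x hx => by simp [localEnv, hx], rfl, rfl⟩⟩
  funext x
  simp [localEnv]

/-- If membership in the state does not depend on the values of `ys`, then these variables may be
made local. -/
theorem hide_scope {ys : List Var} {B : Set (W × Subst L Var)}
    (hB : ∀ v ∈ B, ∀ d : Subst L Var, (∀ x ∉ ys, d x = v.2 x) → (v.1, d) ∈ B)
    {g : Goal (W × Subst L Var)} {g' : Goal ((W × Subst L Var) × Subst L Var)}
    (h : GSim (ScopeRel ys) g g') (h' : GSim (fun v' v => ScopeRel ys v v') g' g)
    {R : Type (max u w)} (K : Set W → Option R → Prop) (r : Option R) :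
    g R (fun A' => K (Prod.fst '' A')) B r ↔
      g'.hide Prod.fst R (fun A' => K (Prod.fst '' A')) B r := by
  have hK : ∀ A : Set ((W × Subst L Var) × Subst L Var),
      Prod.fst '' (Prod.fst '' A) = (fun v => v.1.1) '' A := fun A => Set.image_image _ _ _
  simp only [Goal.hide, hK]
  exact ⟨(h (liftRel_scopeRel hB) (kSim_image K fun _ _ h => h.1)).imp,
    (h' (liftRel_scopeRel hB).symm (kSim_image K fun _ _ h => h.1.symm)).imp⟩

theorem denF_scope_sim (hI : InterpSim I I) (ys : List Var) (F : Formula L Var 0) :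
    GSim (ScopeRel (W := W) ys) (denF I F fun v => v.2) (denF I F (localEnv ys fun v => v.2)) :=
  denF_sim hI F fun _ _ h x _ => by rw [h.2]

theorem denF_scope_sim' (hI : InterpSim I I) (ys : List Var) (F : Formula L Var 0) :
    GSim (fun v' v => ScopeRel (W := W) ys v v') (denF I F (localEnv ys fun v => v.2))
      (denF I F fun v => v.2) :=
  denF_sim hI F fun _ _ h x _ => by rw [h.2]

/-- Quantifying variables that the state does not restrict does not change the results, provided
that the continuation does not depend on them. -/
theorem exs_iff (hI : InterpSim I I) {ys : List Var} {B : Set (W × Subst L Var)}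
    (hB : ∀ v ∈ B, ∀ d : Subst L Var, (∀ x ∉ ys, d x = v.2 x) → (v.1, d) ∈ B)
    (G : Formula L Var 0) {R : Type (max u w)} (K : Set W → Option R → Prop) (r : Option R) :
    denF I (exs ys G) (fun v => v.2) R (fun A' => K (Prod.fst '' A')) B r ↔
      denF I G (fun v => v.2) R (fun A' => K (Prod.fst '' A')) B r := by
  rw [denF_exs hI]
  exact (hide_scope hB (denF_scope_sim hI ys G) (denF_scope_sim' hI ys G) K r).symm

/-- Binding variables that the state does not restrict does not change the results, provided that
the continuation does not depend on them. -/
theorem ifs_iff (hI : InterpSim I I) {ys : List Var} {B : Set (W × Subst L Var)}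
    (hB : ∀ v ∈ B, ∀ d : Subst L Var, (∀ x ∉ ys, d x = v.2 x) → (v.1, d) ∈ B)
    (F G : Formula L Var 0) {R : Type (max u w)} (K : Set W → Option R → Prop) (r : Option R) :
    denF I (ifs ys F G) (fun v => v.2) R (fun A' => K (Prod.fst '' A')) B r ↔
      ((denF I F fun v => v.2).once.seq (denF I G fun v => v.2)) R
        (fun A' => K (Prod.fst '' A')) B r := by
  rw [denF_ifs hI]
  exact (hide_scope hB ((denF_scope_sim hI ys F).once.seq (denF_scope_sim hI ys G))
    ((denF_scope_sim' hI ys F).once.seq (denF_scope_sim' hI ys G)) K r).symm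

omit [DecidableEq Var] in
/-- Answers that are compared only for existence. -/
theorem kSim_ret_image {W₁ W₂ W : Type z} {S : W₁ → W₂ → Prop} (f : W₂ → W) :
    KSim S (fun _ _ => True) ret (fun A => ret (f '' A)) := by
  rintro A₁ A₂ - r rfl
  exact ⟨some (f '' A₂), .some trivial, rfl⟩

omit [DecidableEq Var] in
theorem kSim_image_ret {W₁ W₂ W : Type z} {S : W₁ → W₂ → Prop} (f : W₁ → W) :
    KSim S (fun _ _ => True) (fun A => ret (f '' A)) ret := by
  rintro A₁ A₂ - r rfl
  exact ⟨some A₂, .some trivial, rfl⟩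

/-- Quantifying variables that the state does not restrict preserves the failure of a guard. -/
theorem exs_none_iff (hI : InterpSim I I) {ys : List Var} {B : Set (W × Subst L Var)}
    (hB : ∀ v ∈ B, ∀ d : Subst L Var, (∀ x ∉ ys, d x = v.2 x) → (v.1, d) ∈ B)
    (G : Formula L Var 0) : denF I (exs ys G) (fun v => v.2) _ ret B none ↔
      denF I G (fun v => v.2) _ ret B none := by
  rw [denF_exs hI]
  exact ⟨(denF_scope_sim' hI ys G (liftRel_scopeRel hB).symm (kSim_image_ret _)).none,
    (denF_scope_sim hI ys G (liftRel_scopeRel hB) (kSim_ret_image _)).none⟩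

/-- Quantifying variables that the state does not restrict preserves the success of a guard. The
answers differ, since the quantified formula forgets the values of `ys`. -/
theorem exs_some_iff (hI : InterpSim I I) {ys : List Var} {B : Set (W × Subst L Var)}
    (hB : ∀ v ∈ B, ∀ d : Subst L Var, (∀ x ∉ ys, d x = v.2 x) → (v.1, d) ∈ B)
    (G : Formula L Var 0) : (∃ A', denF I (exs ys G) (fun v => v.2) _ ret B (some A')) ↔
      ∃ A', denF I G (fun v => v.2) _ ret B (some A') := by
  rw [denF_exs hI]
  constructor
  · rintro ⟨A', hA'⟩
    obtain ⟨A'', -, h⟩ :=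
      (denF_scope_sim' hI ys G (liftRel_scopeRel hB).symm (kSim_image_ret _)).some hA'
    exact ⟨A'', h⟩
  · rintro ⟨A', hA'⟩
    obtain ⟨A'', -, h⟩ := (denF_scope_sim hI ys G (liftRel_scopeRel hB) (kSim_ret_image _)).some hA'
    exact ⟨A'', h⟩

end Scope

/-! ### Scoping and merging clauses -/

section Scope

variable [DecidableEq Var] {I : Interp L Var}

/-- The state in which a clause body starts does not restrict the variables that are not in the
head. -/
theorem mem_head_of_eq_off {W : Type (max u w)} {n : ℕ} {t : Fin n → Tm L Var 0} {ys : List Var}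
    (hys : ∀ y ∈ ys, y ∉ ⋃ i, fvTm (t i)) (a : W → Fin n → Tm L Var 0) (A : Set W) :
    ∀ v ∈ Prod.fst ⁻¹' A ∩ {v : W × Subst L Var | ∀ i, a v.1 i = substTm v.2 (t i)},
      ∀ d : Subst L Var, (∀ x ∉ ys, d x = v.2 x) →
        (v.1, d) ∈ Prod.fst ⁻¹' A ∩ {v : W × Subst L Var | ∀ i, a v.1 i = substTm v.2 (t i)} := by
  rintro ⟨w, d'⟩ ⟨hw, h⟩ d hd
  refine ⟨hw, fun i => ?_⟩
  change a w i = substTm d (t i)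
  rw [substTm_congr (t i) fun x hx => hd x fun hxy => hys x hxy (Set.mem_iUnion.2 ⟨i, hx⟩)]
  exact h i

omit [DecidableEq Var] in
theorem constrain_seq_congr {W R : Type z} {X A : Set W} {K : Set W → Option R → Prop}
    {g h : Goal W} (H : ∀ r, g R K (A ∩ X) r ↔ h R K (A ∩ X) r) (r : Option R) :
    (constrain X).seq g R K A r ↔ (constrain X).seq h R K A r := by
  simp only [constrain_seq_apply, H]

theorem sameCalls_scope_nocut (hI : InterpSim I I) {n : ℕ} {p : L.Relations n}
    {t : Fin n → Tm L Var 0} {G : Formula L Var 0} {ys : List Var}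
    (hys : Lists ys (G.fv \ ⋃ i, fvTm (t i))) (γ : List (Clause L Var)) :
    SameCalls I p (⟨p, t, [.fml G]⟩ :: γ) (⟨p, t, [.fml (exs ys G)]⟩ :: γ) := by
  refine sameCalls_cons fun W a k R K A r => ?_
  have h := constrain_seq_congr fun r => exs_iff hI
    (mem_head_of_eq_off (fun y hy => ((hys.2 y).1 hy).2) a A) G K r
  simp only [denClause, orElse, h]

theorem sameCalls_scope_cut (hI : InterpSim I I) {n : ℕ} {p : L.Relations n}
    {t : Fin n → Tm L Var 0} {F G : Formula L Var 0} {ys : List Var}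
    (hys : Lists ys ((F.fv ∪ G.fv) \ ⋃ i, fvTm (t i))) :
    SameCalls I p [⟨p, t, [.fml F, .cut, .fml G]⟩] [⟨p, t, [.fml (ifs ys F G)]⟩] := by
  intro W a
  rw [denUsing_cons, denUsing_cons]
  funext R K A r
  apply propext
  have h := constrain_seq_congr (fun r => ifs_iff hI
    (mem_head_of_eq_off (fun y hy => ((hys.2 y).1 hy).2) a A) F G K r) r
  simp only [denClause, denUsing, Goal.hide, orElse_fail, h, denBody, skip_seq]
  rw [← constrain_seq_fail, constrain_seq_cutThen, cutThen_fail]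

theorem sameCalls_merge_nocut (hI : InterpSim I I) {n : ℕ} {p : L.Relations n}
    {t : Fin n → Tm L Var 0} {G H : Formula L Var 0} {ys : List Var}
    (hys : Lists ys (G.fv \ ⋃ i, fvTm (t i))) :
    SameCalls I p [⟨p, t, [.fml G]⟩, ⟨p, t, [.fml H]⟩] [⟨p, t, [.fml (.disj (exs ys G) H)]⟩] := by
  intro W a
  rw [denUsing_cons, denUsing_cons, denUsing_cons]
  funext R K A r
  apply propext
  have h := exs_iff hI (mem_head_of_eq_off (fun y hy => ((hys.2 y).1 hy).2) a A) G K
  simp only [denClause, denUsing, Goal.hide, orElse_fail, constrain_seq_orElse]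
  refine constrain_seq_congr (fun r => ?_) r
  change _ ↔ (denF I (exs ys G) fun v : W × Subst L Var => v.2).orElse
    (denF I H fun v : W × Subst L Var => v.2) _ _ _ _
  simp only [orElse, h]

theorem sameCalls_merge_cut (hI : InterpSim I I) (hdet : InterpDet I I) {n : ℕ}
    {p : L.Relations n} {t : Fin n → Tm L Var 0} {F G H : Formula L Var 0} {ys : List Var}
    (hys : Lists ys ((F.fv ∪ G.fv) \ ⋃ i, fvTm (t i))) :
    SameCalls I p [⟨p, t, [.fml F, .cut, .fml G]⟩, ⟨p, t, [.fml H]⟩]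
      [⟨p, t, [.fml (.disj (ifs ys F G) (.conj (.neg (exs ys F)) H))]⟩] := by
  intro W a
  rw [denUsing_cons, denUsing_cons, denUsing_cons]
  funext R K A r
  apply propext
  have hB := mem_head_of_eq_off (fun y hy => ((hys.2 y).1 hy).2) a A
  have hifs := ifs_iff hI hB F G K
  have hnone := exs_none_iff hI hB F
  have hsome := exs_some_iff hI hB F
  simp only [denClause, denUsing, Goal.hide, orElse_fail, constrain_seq_cutThen, denBody, skip_seq]
  refine constrain_seq_congr (fun r => ?_) r
  change _ ↔ (denF I (ifs ys F G) fun v : W × Subst L Var => v.2).orElse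
    ((denF I (exs ys F) fun v : W × Subst L Var => v.2).naf.seq
      (denF I H fun v : W × Subst L Var => v.2)) _ _ _ _
  simp only [orElse, hifs, naf_seq]
  simp only [once, cutThen, seq, skip, fail, hnone, exists_and_right, hsome]
  -- a formula that succeeds does not fail
  have hF : (∃ A', denF I F (fun v : W × Subst L Var => v.2) _ ret
      (Prod.fst ⁻¹' A ∩ {v | ∀ i, a v.1 i = substTm v.2 (t i)}) (some A')) →
      ¬ denF I F (fun v : W × Subst L Var => v.2) _ ret
        (Prod.fst ⁻¹' A ∩ {v | ∀ i, a v.1 i = substTm v.2 (t i)}) none := by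
    rintro ⟨A', h1⟩ h2
    cases den_det hdet F _ Goal.det_ret _ _ _ h1 h2
  constructor
  · rintro (⟨A', h1, h2⟩ | ⟨h1, h2⟩)
    · cases r with
      | none => exact .inr ⟨.inl ⟨A', h1, h2⟩, .inl ⟨⟨A', h1⟩, rfl⟩⟩
      | some x => exact .inl ⟨⟨x, rfl⟩, .inl ⟨A', h1, h2⟩⟩
    · exact .inr ⟨.inr ⟨h1, trivial⟩, .inr ⟨h1, h2⟩⟩
  · rintro (⟨⟨x, rfl⟩, h1 | h1⟩ | ⟨h1, ⟨h2, rfl⟩ | ⟨h2, h3⟩⟩)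
    · exact .inl h1
    · cases h1.2
    · exact .inl (h1.resolve_right fun h => hF h2 h.1)
    · exact .inr ⟨h2, h3⟩

theorem exs_preds (ys : List Var) (G : Formula L Var 0) : (exs ys G).preds = G.preds := by
  induction ys with
  | nil => rfl
  | cons y ys ih => rw [exs, Formula.preds, Formula.close, Formula.preds_bind, ih]

theorem ifs_preds (ys : List Var) (F G : Formula L Var 0) :
    (ifs ys F G).preds = F.preds ∪ G.preds := by
  rw [ifs, Formula.preds, Formula.close, Formula.close, Formula.preds_bind, Formula.preds_bind]

omit [DecidableEq Var] in
theorem clause_preds_mk {n : ℕ} {p : L.Relations n} {t : Fin n → Tm L Var 0}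
    {η : List (BodyElt L Var)} :
    Clause.preds ⟨p, t, η⟩ = {⟨n, p⟩} ∪ {q | ∃ b ∈ η, q ∈ b.preds} := rfl

theorem preserves_scopeStep {Q Q' : Program L Var} (h : ScopeStep Q Q') : Preserves Q Q' := by
  obtain @⟨P₁, P₂, c, c', hP₂, -, hc⟩ := h
  refine ⟨sem_eq fun I hI _ => stepInterp_eq_of_sameCalls fun n p => ?_, programPreds_replace ?_⟩
  · cases hc with
    | nocut hys => exact sameCalls_replace (sameCalls_scope_nocut hI hys _) p
    | cut hys =>
      refine sameCalls_replace ?_ p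
      rw [clausesOf_eq_nil _ hP₂]
      exact sameCalls_scope_cut hI hys
  · cases hc with
    | nocut hys => simp [clause_preds_mk, BodyElt.preds, exs_preds]
    | cut hys =>
      simp only [clause_preds_mk, List.mem_cons, List.not_mem_nil, or_false, exists_eq_or_imp,
        exists_eq_left, BodyElt.preds, ifs_preds]
      gcongr
      rintro (h | h | h)
      · exact .inl h
      · exact h.elim
      · exact .inr h

theorem preserves_mergeStep {Q Q' : Program L Var} (h : MergeStep Q Q') : Preserves Q Q' := by
  obtain @⟨P₁, P₂, P₃, n, p, t, η, H, K, hP₂, hP₃, hK⟩ := h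
  refine ⟨sem_eq fun I hI hdet => stepInterp_eq_of_sameCalls fun m q => ?_, ?_⟩
  · by_cases hq : (⟨n, p⟩ : Σ n, L.Relations n) = ⟨m, q⟩
    · cases hq
      simp only [clausesOf_append, List.append_assoc, List.cons_append,
        clausesOf_cons_of_eq p (c := ⟨p, t, η⟩) rfl,
        clausesOf_cons_of_eq p (c := ⟨p, t, [.fml H]⟩) rfl,
        clausesOf_cons_of_eq p (c := ⟨p, t, [.fml K]⟩) rfl, clausesOf_eq_nil p hP₂,
        clausesOf_eq_nil p hP₃, List.nil_append]
      refine SameCalls.append ?_ _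
      cases hK with
      | nocut hys => exact sameCalls_merge_nocut hI hys
      | cut hys => exact sameCalls_merge_cut hI hdet hys
    · simp only [clausesOf_append, List.append_assoc, List.cons_append,
        clausesOf_cons_of_ne q (c := ⟨p, t, η⟩) hq,
        clausesOf_cons_of_ne q (c := ⟨p, t, [.fml H]⟩) hq,
        clausesOf_cons_of_ne q (c := ⟨p, t, [.fml K]⟩) hq]
      exact fun _ _ => rfl
  · have hsub : Clause.preds ⟨p, t, η⟩ ∪ Clause.preds ⟨p, t, [.fml H]⟩ ⊆
        Clause.preds ⟨p, t, [.fml K]⟩ := by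
      cases hK with
      | nocut hys =>
        simp only [clause_preds_mk, List.mem_cons, List.not_mem_nil, or_false, exists_eq_left,
          BodyElt.preds, Formula.preds, exs_preds]
        rintro q ((h | h) | (h | h))
        · exact .inl h
        · exact .inr (.inl h)
        · exact .inl h
        · exact .inr (.inr h)
      | cut hys =>
        simp only [clause_preds_mk, List.mem_cons, List.not_mem_nil, or_false, exists_eq_or_imp,
          exists_eq_left, BodyElt.preds, Formula.preds, exs_preds, ifs_preds]
        rintro q ((h | h | h | h) | (h | h))
        · exact .inl h
        · exact .inr (.inl (.inl h))
        · exact h.elim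
        · exact .inr (.inl (.inr h))
        · exact .inl h
        · exact .inr (.inr (.inr h))
    simp only [List.append_assoc, List.cons_append, programPreds_append, programPreds_cons]
    rintro q (h | h | h | h | h)
    · exact .inl h
    · exact .inr (.inl (hsub (.inl h)))
    · exact .inr (.inr (.inl h))
    · exact .inr (.inl (hsub (.inr h)))
    · exact .inr (.inr (.inr h))

end Scope

/-! ### Introducing new predicates -/

section Congr

/-- The interpretations `I` and `J` agree on the predicate symbols in `N`. -/
def AgreeOn (N : Set (Σ n, L.Relations n)) (I J : Interp L Var) : Prop :=
  ∀ (n : ℕ) (p : L.Relations n), (⟨n, p⟩ : Σ n, L.Relations n) ∈ N → I n p = J n p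

variable {I J : Interp L Var} {W : Type (max u w)}

theorem AgreeOn.mono {N N' : Set (Σ n, L.Relations n)} (h : AgreeOn N I J) (hN : N' ⊆ N) :
    AgreeOn N' I J := fun n p hp => h n p (hN hp)

/-- The denotation of a formula depends only on the interpretation of its predicate symbols. -/
theorem den_congr {k : ℕ} (B : Formula L Var k) (h : AgreeOn B.preds I J) {W : Type (max u w)}
    (e : W → Var ⊕ Fin k → Tm L Var 0) : den I B e = den J B e := by
  induction B generalizing W with
  | eq s t => rfl
  | @atom k n p ts =>
    have hp : I n p = J n p := h _ _ rfl
    simp only [den]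
    unfold call
    rw [hp]
  | conj B C ihB ihC =>
    simp only [den, ihB (h.mono Set.subset_union_left), ihC (h.mono Set.subset_union_right)]
  | disj B C ihB ihC =>
    simp only [den, ihB (h.mono Set.subset_union_left), ihC (h.mono Set.subset_union_right)]
  | neg B ihB => simp only [den, ihB h]
  | ex B ihB => simp only [den, ihB h]
  | ifthen n B C ihB ihC =>
    simp only [den, ihB (h.mono Set.subset_union_left), ihC (h.mono Set.subset_union_right)]

theorem denBody_congr (η : List (BodyElt L Var)) (h : AgreeOn {p | ∃ b ∈ η, p ∈ b.preds} I J)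
    (e : W → Subst L Var) (g : Goal W) : denBody I e g η = denBody J e g η := by
  induction η generalizing g with
  | nil => rfl
  | cons b η ih =>
    have hη := ih (h.mono fun _ hp => hp.imp fun _ hb => ⟨List.mem_cons_of_mem _ hb.1, hb.2⟩)
    cases b with
    | fml F =>
      have hF : denF I F e = denF J F e :=
        den_congr F (h.mono fun p hp => ⟨_, List.mem_cons_self, hp⟩) _
      simp only [denBody, hη, hF]
    | cut => simp only [denBody, hη]

theorem denClause_congr (η : List (BodyElt L Var)) (h : AgreeOn {p | ∃ b ∈ η, p ∈ b.preds} I J)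
    (e : W → Subst L Var) (k g : Goal W) : denClause I e k g η = denClause J e k g η := by
  induction η generalizing g with
  | nil => rfl
  | cons b η ih =>
    have hη : AgreeOn {p | ∃ b ∈ η, p ∈ b.preds} I J :=
      h.mono fun _ hp => hp.imp fun _ hb => ⟨List.mem_cons_of_mem _ hb.1, hb.2⟩
    cases b with
    | fml F =>
      have hF : denF I F e = denF J F e :=
        den_congr F (h.mono fun p hp => ⟨_, List.mem_cons_self, hp⟩) _
      simp only [denClause, ih hη, hF]
    | cut => simp only [denClause, denBody_congr η hη]

theorem denUsing_congr (γ : List (Clause L Var))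
    (h : AgreeOn {p | ∃ c ∈ γ, ∃ b ∈ c.body, p ∈ b.preds} I J) {n : ℕ}
    (p : L.Relations n) (a : W → Fin n → Tm L Var 0) (e : W → Subst L Var) :
    denUsing I p a e γ = denUsing J p a e γ := by
  induction γ with
  | nil => rfl
  | cons c γ ih =>
    have hc := fun k g => denClause_congr c.body
      (h.mono fun p hp => ⟨c, List.mem_cons_self, hp⟩) e k g
    have hγ := ih (h.mono fun _ hp => hp.imp fun _ hb => ⟨List.mem_cons_of_mem _ hb.1, hb.2⟩)
    simp only [denUsing, hγ, hc]

theorem denStack_congr (α : Stack L Var) (h : AgreeOn α.preds I J) (e : W → Subst L Var) :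
    denStack I e α = denStack J e α := by
  induction α with
  | nil => rfl
  | cons b α ih =>
    have hα := ih (h.mono fun _ hp => hp.imp fun _ hb => ⟨List.mem_cons_of_mem _ hb.1, hb.2⟩)
    have hb : AgreeOn b.preds I J := h.mono fun p hp => ⟨_, List.mem_cons_self, hp⟩
    rw [denStack, denStack, hα]
    congr 1
    rcases b with F | ⟨p, s, γ⟩ | η
    · exact den_congr F hb _
    · exact denUsing_congr γ (hb.mono fun p ⟨c, hc, hp⟩ => .inr ⟨c, hc, .inr hp⟩) _ _ _
    · exact denBody_congr η hb _ _

theorem stepInterp_congr (Q : Program L Var) (h : AgreeOn Q.preds I J) :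
    stepInterp Q I = stepInterp Q J := by
  funext n p W a
  refine congrArg _ (denUsing_congr _ (h.mono ?_) _ _ _)
  rintro q ⟨c, hc, hq⟩
  exact ⟨c, List.mem_of_mem_filter hc, .inr hq⟩

end Congr

section Split

open Classical in
/-- The interpretation `J` with the interpretation of `q` taken from `I`. -/
noncomputable def override (q : Σ n, L.Relations n) (I J : Interp L Var) : Interp L Var :=
  fun n p => if (⟨n, p⟩ : Σ n, L.Relations n) = q then I n p else J n p

variable {I J : Interp L Var} {q : Σ n, L.Relations n}

theorem override_eq {n : ℕ} {p : L.Relations n} (h : (⟨n, p⟩ : Σ n, L.Relations n) = q) :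
    override q I J n p = I n p := if_pos h

theorem override_ne {n : ℕ} {p : L.Relations n} (h : (⟨n, p⟩ : Σ n, L.Relations n) ≠ q) :
    override q I J n p = J n p := if_neg h

theorem InterpSim.override (hI : InterpSim I I) (hJ : InterpSim J J) :
    InterpSim (override q I J) (override q I J) := by
  intro n p
  by_cases h : (⟨n, p⟩ : Σ n, L.Relations n) = q
  · rw [override_eq h]
    exact hI n p
  · rw [override_ne h]
    exact hJ n p

variable [DecidableEq Var]

/-- A call of a predicate that is defined by the single clause `q(ys) :- F, !, G`, where `ys` lists
the free variables of `F` and `G`. -/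
theorem denF_split (hJ : InterpSim J J) {F G : Formula L Var 0} {ys : List Var}
    {q : L.Relations ys.length} (hys : Lists ys (F.fv ∪ G.fv))
    (hq : ∀ (W : Type (max u w)) (a : W → Fin ys.length → Tm L Var 0), J _ q W a =
      (denUsing J q (fun v : W × Subst L Var => a v.1) (fun v => v.2)
        [⟨q, fun i => fvar (ys.get i), [.fml F, .cut, .fml G]⟩]).hide Prod.fst)
    {W : Type (max u w)} (e : W → Subst L Var) :
    denF J (.atom q fun i => fvar (ys.get i)) e = (denF J F e).once.seq (denF J G e) := by
  have hcall : denF J (.atom q fun i => fvar (ys.get i)) e =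
      J _ q W fun w i => e w (ys.get i) := by
    funext R K A r
    apply propext
    constructor
    · rintro ⟨K', hK', hr⟩
      rw [hq] at hr
      rw [hq]
      exact (denUsing_le le_rfl _ _ _ _).hide hK' _ _ hr
    · exact fun hr => ⟨K, fun _ _ h => h, hr⟩
  rw [hcall, hq, denUsing_cons]
  simp only [denClause, denUsing, denBody, skip_seq]
  rw [← constrain_seq_fail, constrain_seq_cutThen, cutThen_fail]
  funext R K A r
  apply propext
  let S : W → W × Subst L Var → Prop := fun w v =>
    w = v.1 ∧ ∀ i, e w (ys.get i) = v.2 (ys.get i)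
  have hA : LiftRel S A (Prod.fst ⁻¹' A ∩ {v : W × Subst L Var |
      ∀ i, e v.1 (ys.get i) = substTm v.2 (fvar (ys.get i))}) :=
    ⟨fun w hw => ⟨(w, e w), ⟨hw, fun _ => rfl⟩, rfl, fun _ => rfl⟩,
      fun v hv => ⟨v.1, hv.1, rfl, hv.2⟩⟩
  have hS : ∀ w v, S w v → ∀ x ∈ F.fv ∪ G.fv, e w x = v.2 x := by
    intro w v h x hx
    obtain ⟨i, rfl⟩ := List.mem_iff_get.1 ((hys.2 x).2 hx)
    exact h.2 i
  rw [Goal.hide, constrain_seq_apply_iff fun h => by rw [hA.eq_empty_iff.2 h, Set.preimage_empty]]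
  have hK := kSim_image (S := S) K (f₁ := id) (f₂ := Prod.fst) fun _ _ h => h.1
  have hK' := kSim_image (S := fun v w => S w v) K (f₁ := Prod.fst) (f₂ := id) fun _ _ h => h.1.symm
  simp only [Set.image_id] at hK hK'
  constructor
  · exact ((denF_sim hJ F fun v w h x hx => (hS w v h x (.inl hx)).symm).once.seq
      (denF_sim hJ G fun v w h x hx => (hS w v h x (.inr hx)).symm) hA.symm hK').imp
  · exact ((denF_sim hJ F fun w v h x hx => hS w v h x (.inl hx)).once.seq
      (denF_sim hJ G fun w v h x hx => hS w v h x (.inr hx)) hA hK).imp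

omit [DecidableEq Var] in
theorem bodyEquiv_split {F G H : Formula L Var 0}
    (h : ∀ (W : Type (max u w)) (e : W → Subst L Var),
      denF J H e = (denF J F e).once.seq (denF J G e)) (η : List (BodyElt L Var)) :
    BodyEquiv J (η ++ [.cut, .fml F, .cut, .fml G]) (η ++ [.cut, .fml H]) := by
  refine BodyEquiv.append (fun W e => ?_) _
  simp only [denClause, denBody, skip_seq, h, implies_true, and_self]

/-- A new predicate that abbreviates the end of a clause body does not change the denotations of
the other predicates. -/
theorem agreeOn_splitStep {Q Q' : Program L Var} (h : SplitStep Q Q') :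
    ∃ q, q ∉ Q.preds ∧ q ∈ Q'.preds ∧ Q.preds ⊆ Q'.preds ∧ AgreeOn {q}ᶜ (sem Q) (sem Q') := by
  obtain @⟨P₁, P₂, n, p, t, η, F, G, ys, q, hys, hq⟩ := h
  set c : Clause L Var := ⟨p, t, η ++ [.cut, .fml F, .cut, .fml G]⟩ with hc
  set c' : Clause L Var := ⟨p, t, η ++ [.cut, .fml (.atom q fun i => fvar (ys.get i))]⟩ with hc'
  set d : Clause L Var := ⟨q, fun i => fvar (ys.get i), [.fml F, .cut, .fml G]⟩ with hd
  set Q := P₁ ++ c :: P₂ with hQ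
  set Q' := P₁ ++ c' :: P₂ ++ [d] with hQ'
  have hQq : ∀ b ∈ Q, b.symb ≠ ⟨_, q⟩ := fun b hb h => hq ⟨b, hb, .inl h.symm⟩
  have hQ'q : ∀ b ∈ P₁ ++ c' :: P₂, b.symb ≠ ⟨_, q⟩ := by
    intro b hb
    simp only [List.mem_append, List.mem_cons] at hb
    rcases hb with hb | rfl | hb
    · exact hQq b (by simp [hQ, hb])
    · exact hQq c (by simp [hQ])
    · exact hQq b (by simp [hQ, hb])
  have hclQ : clausesOf q Q = [] := clausesOf_eq_nil q hQq
  have hclQ' : clausesOf q Q' = [d] := by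
    rw [hQ', clausesOf_append, clausesOf_eq_nil q hQ'q, clausesOf_cons_of_eq q (c := d) rfl]
    rfl
  have hsub : Q.preds ⊆ Q'.preds := by
    simp only [hQ, hQ', programPreds_append, programPreds_cons]
    rintro s (hs | (hs | ⟨b, hb, hs⟩) | hs)
    · exact .inl (.inl hs)
    · exact .inl (.inr (.inl (.inl hs)))
    · simp only [hc, List.mem_append, List.mem_cons, List.not_mem_nil, or_false] at hb
      rcases hb with hb | rfl | rfl | rfl | rfl
      · exact .inl (.inr (.inl (.inr ⟨b, by simp [hc', hb], hs⟩)))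
      · exact hs.elim
      · exact .inr (.inl (.inr ⟨.fml F, by simp [hd], hs⟩))
      · exact hs.elim
      · exact .inr (.inl (.inr ⟨.fml G, by simp [hd], hs⟩))
    · exact .inl (.inr (.inr hs))
  -- the steps agree under interpretations for which the clause of the new predicate holds
  have core : ∀ J : Interp L Var, InterpSim J J → J _ q = stepInterp Q' J _ q →
      AgreeOn {⟨_, q⟩}ᶜ (stepInterp Q J) (stepInterp Q' J) := by
    intro J hJ hJq m r hr
    have hden := fun (W : Type (max u w)) (e : W → Subst L Var) =>
      denF_split hJ hys (fun W a => by rw [hJq, stepInterp, hclQ']) e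
    have hr' : d.symb ≠ ⟨m, r⟩ := fun h => hr h.symm
    have hcl : clausesOf r Q' = clausesOf r (P₁ ++ c' :: P₂) := by
      rw [hQ', clausesOf_append, clausesOf_cons_of_ne r hr']
      exact List.append_nil _
    funext W a
    rw [stepInterp, stepInterp, hcl]
    exact sameCalls_replace ((bodyEquiv_split hden η).sameCalls p t _) r W a
  have hagree : ∀ I J : Interp L Var, AgreeOn {⟨_, q⟩}ᶜ I J → AgreeOn Q.preds I J :=
    fun I J h => h.mono fun s hs hsq => hq (hsq ▸ hs)
  refine ⟨⟨_, q⟩, hq, ?_, hsub, fun m r hr => le_antisymm ?_ ?_⟩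
  · rw [hQ', programPreds_append]
    exact .inr ⟨d, by simp, .inl rfl⟩
  -- `sem Q'`, with `q` interpreted as in `sem Q`, is a prefixed point of the step of `Q`
  · have hle : sem Q ≤ override ⟨_, q⟩ (sem Q) (sem Q') := by
      refine sem_le fun m r => ?_
      by_cases hr : (⟨m, r⟩ : Σ n, L.Relations n) = ⟨_, q⟩
      · cases hr
        rw [override_eq rfl, ← stepInterp_sem Q]
        intro W a
        rw [stepInterp, stepInterp, hclQ]
        exact le_rfl
      · rw [override_ne hr, stepInterp_congr Q (hagree _ (sem Q') fun m r hr => override_ne hr),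
          core _ (sem_sim Q') (by rw [stepInterp_sem]) m r hr, stepInterp_sem]
    have := hle m r
    rwa [override_ne hr] at this
  -- `sem Q`, with `q` interpreted by its clause, is a prefixed point of the step of `Q'`
  · set I := override ⟨_, q⟩ (stepInterp Q' (sem Q)) (sem Q) with hI
    have hIsim : InterpSim I I := (stepInterp_sim Q' (sem_sim Q)).override (sem_sim Q)
    have hIsem : AgreeOn {⟨_, q⟩}ᶜ I (sem Q) := fun m r hr => override_ne hr
    have hIq : I _ q = stepInterp Q' I _ q := by
      rw [hI, override_eq rfl, ← hI]
      funext W a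
      rw [stepInterp, stepInterp, hclQ']
      refine congrArg _ (denUsing_congr _ ?_ _ _ _)
      refine fun m r hr => (hagree _ _ hIsem m r ⟨c, by simp [hQ], .inr ?_⟩).symm
      obtain ⟨b, hb, s, hs, hr⟩ := hr
      rw [List.mem_singleton.1 hb] at hs
      refine ⟨s, ?_, hr⟩
      simp only [hd, List.mem_cons, List.not_mem_nil, or_false] at hs
      rcases hs with rfl | rfl | rfl <;> simp [hc]
    have hle : sem Q' ≤ I := by
      refine sem_le fun m r => ?_
      by_cases hr : (⟨m, r⟩ : Σ n, L.Relations n) = ⟨_, q⟩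
      · cases hr
        rw [← hIq]
      · rw [← core I hIsim hIq m r hr, stepInterp_congr Q (hagree _ _ hIsem), stepInterp_sem,
          hIsem m r hr]
    have := hle m r
    rwa [hIsem m r hr] at this

end Split

/-! ### The completion algorithm preserves results -/

section Final

variable [DecidableEq Var]

theorem agreeOn_splitLoop {P Q : Program L Var} (h : Relation.ReflTransGen SplitStep P Q) :
    P.preds ⊆ Q.preds ∧ AgreeOn {p | p ∈ Q.preds → p ∈ P.preds} (sem P) (sem Q) := by
  induction h with
  | refl => exact ⟨subset_rfl, fun _ _ _ => rfl⟩
  | tail _ hs ih =>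
    obtain ⟨q, hq, hq', hsub, hag⟩ := agreeOn_splitStep hs
    refine ⟨ih.1.trans hsub, fun n p hp => ?_⟩
    rw [ih.2 n p fun h => hp (hsub h), hag n p]
    rintro rfl
    exact hq (ih.1 (hp hq'))

/-- The completion does not change the denotations of the predicates that it does not introduce. -/
theorem agreeOn_completion {zero : L.Term Empty} {P P' : Program L Var}
    (h : IsCompletion zero P P') :
    AgreeOn {p | p ∈ P'.preds → p ∈ P.preds} (sem P) (sem P') := by
  obtain ⟨x, hx, hxP, P₂, P₃, P₄, P₅, P₆, P₇, P₈, P₉, h2, h3, h4, h5, h6, h7, h8, h9, h10⟩ := h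
  have h₇ : Preserves P P₇ := by
    refine (((((preserves_headLoop hx hxP h2.1).trans (preserves_bodyLoop
      (fun _ _ _ => bodyEquiv_conjStep) ?_ h3)).trans (preserves_bodyLoop
      (fun _ _ _ => bodyEquiv_emptyStep) ?_ h4)).trans (preserves_bodyLoop
      (fun _ _ _ => bodyEquiv_cutCutStep) ?_ h5)).trans (preserves_bodyLoop
      (fun _ _ _ => bodyEquiv_initialCutStep) ?_ h6)).trans (preserves_bodyLoop
      (fun _ _ _ => bodyEquiv_finalCutStep) ?_ h7)
    · rintro _ _ ⟨⟩ b hb p hp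
      simp only [List.mem_append, List.mem_cons] at hb
      rcases hb with hb | rfl | rfl | hb
      · exact ⟨b, by simp [hb], hp⟩
      · exact ⟨_, List.mem_append_right _ List.mem_cons_self, .inl hp⟩
      · exact ⟨_, List.mem_append_right _ List.mem_cons_self, .inr hp⟩
      · exact ⟨b, by simp [hb], hp⟩
    · rintro _ _ ⟨⟩ b hb
      exact absurd hb List.not_mem_nil
    · rintro _ _ ⟨⟩ b hb p hp
      simp only [List.mem_append, List.mem_cons, or_self_left] at hb
      exact ⟨b, by simpa using hb, hp⟩
    · rintro _ _ ⟨⟩ b hb p hp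
      exact ⟨b, List.mem_cons_of_mem _ hb, hp⟩
    · rintro _ _ ⟨⟩ b hb p hp
      simp only [List.mem_append, List.mem_singleton] at hb
      exact ⟨b, by simp only [List.mem_append, List.mem_cons]; tauto, hp⟩
  have h₉ : Preserves P₈ P' :=
    (preserves_of_reflTransGen (fun _ _ => preserves_scopeStep) h9.1).trans
      (preserves_of_reflTransGen (fun _ _ => preserves_mergeStep) h10.1)
  rw [h₇.1, ← h₉.1]
  exact (agreeOn_splitLoop h8.1).2.mono fun p hp hp₈ => h₇.2 (hp (h₉.2 hp₈))

/-- An injection on a finite set of variables extends to a permutation. -/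
theorem exists_perm_extend {Y : Set Var} (hY : Y.Finite) {f : Var → Var} (hf : Set.InjOn f Y) :
    ∃ π : Equiv.Perm Var, ∀ y ∈ Y, π y = f y := by
  induction Y, hY using Set.Finite.induction_on with
  | empty => exact ⟨1, fun _ h => h.elim⟩
  | @insert y Y hy hY ih =>
    obtain ⟨π, hπ⟩ := ih (hf.mono (Set.subset_insert _ _))
    refine ⟨π.trans (Equiv.swap (π y) (f y)), fun y' hy' => ?_⟩
    rw [Equiv.trans_apply]
    rcases hy' with rfl | hy'
    · exact Equiv.swap_apply_left _ _
    · have hne : y' ≠ y := fun h => hy (h ▸ hy')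
      rw [Equiv.swap_apply_of_ne_of_ne (π.injective.ne hne), hπ y' hy']
      rw [hπ y' hy']
      exact fun h => hne (hf (.inr hy') (.inl rfl) h)

/-- Substitutions that are instances of each other are renamings of each other. -/
theorem exists_renaming {X : Set Var} (hX : X.Finite) {σ τ δ δ' : Subst L Var}
    (h : Inst X σ τ δ) (h' : Inst X τ σ δ') :
    ∃ π : Equiv.Perm Var, ∀ x ∈ X, substTm (renameBy π) (σ x) = τ x := by
  have key : ∀ y ∈ ⋃ x ∈ X, fvTm (σ x), ∃ z, δ y = fvar z ∧ δ' z = fvar y := by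
    intro y hy
    obtain ⟨x, hx, hy⟩ := Set.mem_iUnion₂.1 hy
    have h1 : substTm (δ.comp δ') (σ x) = substTm fvar (σ x) := by
      rw [← substTm_substTm, ← h x hx, ← h' x hx, substTm_id]
    have h2 : substTm δ' (δ y) = fvar y := (substTm_eq_iff _).1 h1 y hy
    generalize δ y = s at h2
    induction s using tm_induction with
    | hv z => exact ⟨z, rfl, h2⟩
    | hf f ts _ => cases h2
  choose! f hf hf' using key
  obtain ⟨π, hπ⟩ := exists_perm_extend (hX.biUnion fun x _ => fvTm_finite (σ x))
    (f := f) fun y hy y' hy' hyy => by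
      have h1 := hf' y hy
      rw [hyy, hf' y' hy'] at h1
      exact (Sum.inl_injective (FirstOrder.Language.Term.var.inj h1)).symm
  refine ⟨π, fun x hx => ?_⟩
  rw [h x hx]
  refine substTm_congr _ fun y hy => ?_
  have hy' : y ∈ ⋃ x ∈ X, fvTm (σ x) := Set.mem_biUnion hx hy
  rw [renameBy, hπ y hy', hf y hy']

/-- Results are determined by the denotations of the predicates in the goal stack. -/
theorem goes_of_agreeOn [Infinite Var] {P P' : Program L Var} {θ : Subst L Var}
    (hθ : θ.dom.Finite) {α : Stack L Var} (hd : Disjoint θ.dom α.fv)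
    (h : AgreeOn α.preds (sem P) (sem P')) {ρ : Result L Var} (hρ : Goes P θ α ρ) :
    Goes P' θ α ρ := by
  obtain ⟨ρ', hc, hs⟩ := hρ
  have ho := hc.outcome hd
  rw [denStack_congr α h] at ho
  have hX : (inUse ∅ θ α).Finite := inUse_finite Set.finite_empty hθ α
  have hvar : ∀ x ∈ inUse ∅ θ α, fvTm (θ x) ⊆ inUse ∅ θ α := by
    intro x hx
    by_cases hxd : x ∈ θ.dom
    · exact fun y hy => .inl (.inr (.inr ⟨x, hxd, hy⟩))
    · rw [Subst.eq_fvar_of_notMem_dom hxd, fvTm_fvar]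
      exact Set.singleton_subset_iff.2 hx
  cases hs with
  | fail => exact ⟨_, exists_comp hθ hd hX fv_subset_inUse ho, .fail⟩
  | flounder => exact ho.elim
  | diverge => exact ho.elim
  | @subst _ θ₁ π h1 =>
    obtain ⟨σ, A, rfl, -, hA, hσ⟩ := ho
    obtain ⟨_, ⟨τ, rfl, -, -, hτ⟩, hcomp⟩ := exists_comp hθ hd hX fv_subset_inUse hA
    refine ⟨_, hcomp, ?_⟩
    -- the answer consists of the instances of `σ`, and also of those of `τ`; so it contains both
    obtain ⟨υ, hυ, h2⟩ := hσ.2 fvar trivial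
    obtain ⟨δ, -, h3⟩ := hτ.1 υ hυ
    obtain ⟨υ', hυ', h4⟩ := hτ.2 fvar trivial
    obtain ⟨δ', -, h5⟩ := hσ.1 υ' hυ'
    obtain ⟨π', hπ'⟩ := exists_renaming hX (σ := τ) (τ := σ) (δ := δ) (δ' := δ')
      (fun x hx => by rw [← substTm_id (σ x), ← h2 x hx]; exact h3 x hx)
      (fun x hx => by rw [← substTm_id (τ x), ← h5 x hx]; exact (h4 x hx).symm)
    refine .subst (π'.trans π) fun x hx => ?_
    have hx' : x ∈ inUse ∅ θ α := hx.elim (fun h => .inl (.inr h)) .inr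
    have hcomp : (renameBy (π'.trans π) : Subst L Var) = (renameBy π').comp (renameBy π) := rfl
    have h6 : substTm (τ.comp (renameBy π')) (θ x) = substTm σ (θ x) :=
      substTm_congr _ fun y hy => hπ' y (hvar x hx' hy)
    rw [← h1 x hx, hcomp, ← substTm_substTm, Subst.comp_apply, Subst.comp_apply,
      substTm_substTm τ, h6]

end Final

end CutLP

theorem mainTheorem4 {L : FirstOrder.Language} {Var : Type*} [DecidableEq Var]
    (zero : L.Term Empty) (P P' : CutLP.Program L Var)
    (hP' : CutLP.IsCompletion zero P P')
    (θ : CutLP.Subst L Var) (hfin : θ.dom.Finite)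
    (α : CutLP.Stack L Var) (hdom : Disjoint θ.dom α.fv)
    (hnew : ∀ p ∈ α.preds, p ∈ P'.preds → p ∈ P.preds)
    (ρ : CutLP.Result L Var) :
    CutLP.Goes P θ α ρ ↔ CutLP.Goes P' θ α ρ := by
  have : Infinite Var := by
    obtain ⟨x, hx, -⟩ := hP'
    exact Infinite.of_injective x hx
  have h := (CutLP.agreeOn_completion hP').mono hnew
  exact ⟨CutLP.goes_of_agreeOn hfin hdom h,
    CutLP.goes_of_agreeOn hfin hdom fun n p hp => (h n p hp).symm⟩
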